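/- **Setting.** Let $T>0$, let $U,V$ be non-empty compact metric spaces, and let $f:[0,T]\times\mathbb R^d\times U\times V\to\mathbb R^d$ be bounded, continuous, and Lipschitz in $x$ uniformly in $(t,u,v)$; let $g:\mathbb R^d\to\mathbb R$ be bounded and Lipschitz. Let $\Omega=([0,1]^2)^{\mathbb N}$ with the product $\sigma$-field and $P=\lambda_2^{\otimes\mathbb N}$, $\lambda_2$ the Lebesgue measure on $[0,1]^2$; let $\zeta_j=(\zeta_{j,1},\zeta_{j,2})$, $j\ge1$, be the coordinates, $\mathcal G_j=\sigma(\zeta_{j,1})$, $\mathcal H_j=\sigma(\zeta_{j,2})$, $\mathcal F_j=\sigma(\zeta_1,\dots,\zeta_j)$, with $\mathcal F_0$ trivial. For a partition $\Pi=\{0=t_0<\dots<t_n=T\}$ with mesh $|\Pi|=\max_j(t_j-t_{j-1})$, an admissible control of Player 1 is a measurable $U$-valued process $u$ on $[0,T]\times\Omega$ such that, for each $1\le j\le n$, $u=\sum_{k\ge1}I_{\Gamma_{j,k}}u^{j,k}$ on $[t_{j-1},t_j)$, where $(\Gamma_{j,k})_k\subset\mathcal F_{j-1}$ is a partition of $\Omega$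 and each $u^{j,k}$ is a measurable $U$-valued process with $u^{j,k}_s$ $\mathcal G_j$-measurable for all $s\in[t_{j-1},t_j)$. Admissible controls $v$ of Player 2 are defined likewise with $V$ and $\mathcal H_j$. Controls over $[t,T]$ are restrictions of admissible controls. An NAD-strategy $\beta$ of Player 2 over $[t,T]$ maps controls of Player 1 over $[t,T]$ to controls of Player 2 over $[t,T]$ such that, for every $\tau:\Omega\to\{0,\dots,n-1\}$ with $\{\tau=j\}\in\mathcal F_j$ for all $j$, and all $u,u'$: if $u=u'$ $ds\,dP$-a.e. on $\{(s,\omega):t\le s\le t_{\tau(\omega)}\}$, then $\beta(u)=\beta(u')$ $ds\,dP$-a.e. on $\{(s,\omega):t\le s\le t_{\tau(\omega)+1}\}$. NAD-strategies $\alpha$ of Player 1 are defined symmetrically. Let $\mathcal A^\Pi_{t,T}$, $\mathcal B^\Pi_{t,T}$ be the sets of NAD-strategies of Players 1 and 2. Each $(\alpha,\beta)$ determines a $ds\,dP$-a.e. unique couple of controls with $\alpha(v)=u$, $\beta(u)=v$ a.e. on $[t,T]\times\Omega$, and $X^{t,x,\alpha,\beta}$ denotes the pathwise solution of $X_s=x+\int_t^s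 f(r,X_r,u_r,v_r)\,dr$, $s\in[t,T]$. For $t_i\le t<t_{i+1}$ put $$V^\Pi(t,x)=\operatorname*{ess\,sup}_{\alpha\in\mathcal A^\Pi_{t,T}}\operatorname*{ess\,inf}_{\beta\in\mathcal B^\Pi_{t,T}}E[g(X_T^{t,x,\alpha,\beta})\mid\mathcal F_i],\qquad U^\Pi(t,x)=\operatorname*{ess\,inf}_{\beta\in\mathcal B^\Pi_{t,T}}\operatorname*{ess\,sup}_{\alpha\in\mathcal A^\Pi_{t,T}}E[g(X_T^{t,x,\alpha,\beta})\mid\mathcal F_i],$$ and $V^\Pi(T,x)=U^\Pi(T,x)=g(x)$. These random variables are almost surely constant and are identified with their expectations. Consider the Hamilton–Jacobi–Isaacs equation $$\frac{\partial W}{\partial t}(t,x)+\sup_{\mu\in\Delta U}\inf_{\nu\in\Delta V}\Big(\int_U\int_V f(t,x,u,v)\,\nu(dv)\,\mu(du)\Big)\cdot\nabla W(t,x)=0,\qquad W(T,x)=g(x),\tag{1}$$ where $\Delta U,\Delta V$ are the sets of Borel probability measures on $U,V$. A continuous $W:[0,T]\times\mathbb R^d\to\mathbb R$ is a viscosity subsolution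 (supersolution) of (1) if $W(T,\cdot)\le g$ (resp. $\ge g$) and, for all $\varphi\in C^1([0,T]\times\mathbb R^d)$ and all $(t,x)\in[0,T)\times\mathbb R^d$ at which $W-\varphi$ attains a local maximum (resp. minimum) relative to $[0,T]\times\mathbb R^d$, the left-hand side of the differential equation in (1), with $\varphi$ in place of $W$, is $\ge0$ (resp. $\le0$) at $(t,x)$; it is a viscosity solution if it is both. **Proposition.** Let $(\Pi_n)_{n\ge1}$ be a sequence of partitions of $[0,T]$ with $|\Pi_n|\to0$. If $V^{\Pi_n}\to V$ locally uniformly on $[0,T]\times\mathbb R^d$, then $V$ is a bounded continuous viscosity solution of (1). Likewise, if $U^{\Pi_n}\to U$ locally uniformly on $[0,T]\times\mathbb R^d$, then $U$ is a bounded continuous viscosity solution of (1). -/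

import Mathlib

open MeasureTheory Set Filter Topology

noncomputable section

namespace MixedGame

/-! ### The probability space -/

/-- Sequences of points of the unit square. The coordinates are numbered from `0`, so that the usual
coordinate `ζ_{j+1} = (ζ_{j+1,1}, ζ_{j+1,2})` is `ω ↦ ω j`. -/
abbrev Om : Type := ℕ → unitInterval × unitInterval

/-- The infinite product of the Lebesgue measure on the unit square. -/
def P : Measure Om :=
  Measure.infinitePi (fun _ : ℕ => (volume : Measure (unitInterval × unitInterval)))

instance : IsProbabilityMeasure P := by unfold P; infer_instance

/-- `Fil j` is the σ-field generated by the first `j` coordinates (`Fil 0` is trivial). -/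
abbrev Fil (j : ℕ) : MeasurableSpace Om :=
  ⨆ k : Fin j, MeasurableSpace.comap (fun ω : Om => ω k) inferInstance

/-- The private randomness of Player 1 in the time slot number `j` (counted from `0`). -/
abbrev Gf (j : ℕ) : MeasurableSpace Om :=
  MeasurableSpace.comap (fun ω : Om => (ω j).1) inferInstance

/-- The private randomness of Player 2 in the time slot number `j` (counted from `0`). -/
abbrev Hf (j : ℕ) : MeasurableSpace Om :=
  MeasurableSpace.comap (fun ω : Om => (ω j).2) inferInstance

/-! ### Partitions of `[0,T]` -/

/-- A partition `0 = t_0 < t_1 < ... < t_n = T`. -/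
structure Partition (T : ℝ) where
  n : ℕ
  pt : Fin (n + 1) → ℝ
  strictMono : StrictMono pt
  pt_zero : pt 0 = 0
  pt_last : pt (Fin.last n) = T

/-- The largest distance between two neighbouring points. -/
def Partition.mesh {T : ℝ} (π : Partition T) : ℝ :=
  ⨆ j : Fin π.n, (π.pt j.succ - π.pt j.castSucc)

/-! ### Admissible controls and strategies -/

section Controls

variable {T : ℝ} (π : Partition T)

/-- Admissibility of a `C`-valued process along a partition, for the player whose private
randomness in the slot `[t_j, t_{j+1})` is `𝒢 j`: on that slot the process is
`∑ k, 1_{Γ k} (w k)`, with `(Γ k)` a countable partition of the probability space into elements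
of `Fil j` and each `w k` a measurable process all of whose values in the slot are
`𝒢 j`-measurable. Processes are functions of all real times; values outside `[0,T]` are never
looked at. -/
def IsAdmissible {C : Type*} [MeasurableSpace C] (𝒢 : ℕ → MeasurableSpace Om)
    (u : ℝ → Om → C) : Prop :=
  Measurable (Function.uncurry u) ∧
  ∀ j : Fin π.n, ∃ (Γ : ℕ → Set Om) (w : ℕ → ℝ → Om → C),
    (∀ k, MeasurableSet[Fil j] (Γ k)) ∧
    Pairwise (fun k l => Disjoint (Γ k) (Γ l)) ∧
    (⋃ k, Γ k) = univ ∧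
    (∀ k, Measurable (Function.uncurry (w k))) ∧
    (∀ k, ∀ s ∈ Ico (π.pt j.castSucc) (π.pt j.succ), Measurable[𝒢 j] (w k s)) ∧
    ∀ k, ∀ s ∈ Ico (π.pt j.castSucc) (π.pt j.succ), ∀ ω ∈ Γ k, u s ω = w k s ω

/-- Admissible controls of Player 1 with values in `A`. -/
def Control₁ (A : Type*) [MeasurableSpace A] : Type _ :=
  {u : ℝ → Om → A // IsAdmissible π Gf u}

/-- Admissible controls of Player 2 with values in `B`. -/
def Control₂ (B : Type*) [MeasurableSpace B] : Type _ :=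
  {v : ℝ → Om → B // IsAdmissible π Hf v}

/-- Stopping times with values in `{0, ..., n-1}`. -/
def IsStopping {n : ℕ} (τ : Om → Fin n) : Prop :=
  ∀ j : Fin n, MeasurableSet[Fil j] {ω | τ ω = j}

/-- Equality `ds dP`-almost everywhere on the stochastic interval `[[t, σ]]`. -/
def EqOn {C : Type*} (t : ℝ) (σ : Om → ℝ) (u u' : ℝ → Om → C) : Prop :=
  ∀ᵐ p ∂((volume : Measure ℝ).prod P), p.1 ∈ Icc t (σ p.2) → u p.1 p.2 = u' p.1 p.2

/-- Nonanticipative strategies with delay of Player 1 over `[t,T]`. A control over `[t,T]` is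
given by any admissible control over `[0,T]` of which it is the restriction. The condition
(with `τ = n - 1`) makes the response over `[t,T]` depend on that restriction only, and
responses, too, are only looked at on `[t,T]`. -/
def Strategy₁ (A B : Type*) [MeasurableSpace A] [MeasurableSpace B] (t : ℝ) : Type _ :=
  {α : Control₂ π B → Control₁ π A //
    ∀ τ : Om → Fin π.n, IsStopping τ → ∀ v v' : Control₂ π B,
      EqOn t (fun ω => π.pt (τ ω).castSucc) v.1 v'.1 →
      EqOn t (fun ω => π.pt (τ ω).succ) (α v).1 (α v').1}

/-- Nonanticipative strategies with delay of Player 2 over `[t,T]`. -/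
def Strategy₂ (A B : Type*) [MeasurableSpace A] [MeasurableSpace B] (t : ℝ) : Type _ :=
  {β : Control₁ π A → Control₂ π B //
    ∀ τ : Om → Fin π.n, IsStopping τ → ∀ u u' : Control₁ π A,
      EqOn t (fun ω => π.pt (τ ω).castSucc) u.1 u'.1 →
      EqOn t (fun ω => π.pt (τ ω).succ) (β u).1 (β u').1}

/-- `(u, v)` is a couple of controls associated with `(α, β)`: `α(v) = u` and `β(u) = v`,
`ds dP`-a.e. on `[t,T]`. -/
def IsAssociated {A B : Type*} [MeasurableSpace A] [MeasurableSpace B] {t : ℝ}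
    (α : Strategy₁ π A B t) (β : Strategy₂ π A B t)
    (c : Control₁ π A × Control₂ π B) : Prop :=
  EqOn t (fun _ => T) (α.1 c.2).1 c.1.1 ∧ EqOn t (fun _ => T) (β.1 c.1).1 c.2.1

end Controls

/-! ### Dynamics, payoff and value functions -/

/-- The state space `ℝ^d`, with the Euclidean norm. -/
abbrev E (d : ℕ) : Type := EuclideanSpace ℝ (Fin d)

section Game

variable {A B : Type*} {d : ℕ}

/-- `X` solves `X_s = x + ∫_t^s f(r, X_r, u_r, v_r) dr` on `[t,T]`. -/
def IsTrajectory (T : ℝ) (f : ℝ → E d → A → B → E d) (t : ℝ) (x : E d) (u : ℝ → A) (v : ℝ → B)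
    (X : ℝ → E d) : Prop :=
  ContinuousOn X (Icc t T) ∧
    ∀ s ∈ Icc t T, X s = x + ∫ r in t..s, f r (X r) (u r) (v r)

open Classical in
/-- The state `X_s^{t,x,u,v}`, obtained by solving the equation path by path. -/
def state (T : ℝ) (f : ℝ → E d → A → B → E d) (t : ℝ) (x : E d) (u : ℝ → Om → A)
    (v : ℝ → Om → B) (s : ℝ) (ω : Om) : E d :=
  if h : ∃ X, IsTrajectory T f t x (fun r => u r ω) (fun r => v r ω) X then h.choose s else 0

/-- The conditional expectation `E[g(X_T^{t,x,u,v}) | Fil i]`, as a class of random variables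
modulo almost sure equality. -/
def controlPayoff (T : ℝ) (f : ℝ → E d → A → B → E d) (g : E d → ℝ) (i : ℕ) (t : ℝ) (x : E d)
    (u : ℝ → Om → A) (v : ℝ → Om → B) : Om →ₘ[P] ℝ :=
  AEEqFun.mk (P[fun ω => g (state T f t x u v T ω) | Fil i])
    integrable_condExp.aestronglyMeasurable

open Classical in
/-- The essential supremum of a family of random variables, i.e. its least upper bound for the
almost sure order. -/
def essSupFamily {ι : Type*} (F : ι → Om →ₘ[P] ℝ) : Om →ₘ[P] ℝ :=
  if h : ∃ Y, IsLUB (range F) Y then h.choose else 0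

open Classical in
/-- The essential infimum of a family of random variables, i.e. its greatest lower bound for the
almost sure order. -/
def essInfFamily {ι : Type*} (F : ι → Om →ₘ[P] ℝ) : Om →ₘ[P] ℝ :=
  if h : ∃ Y, IsGLB (range F) Y then h.choose else 0

variable [MeasurableSpace A] [MeasurableSpace B] {T : ℝ}

open Classical in
/-- `E[g(X_T^{t,x,α,β}) | Fil i]`, through the couple of controls associated with `(α, β)`. -/
def payoff (π : Partition T) (f : ℝ → E d → A → B → E d) (g : E d → ℝ) (i : ℕ) (t : ℝ) (x : E d)
    (α : Strategy₁ π A B t) (β : Strategy₂ π A B t) : Om →ₘ[P] ℝ :=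
  if h : ∃ c, IsAssociated π α β c then
    controlPayoff T f g i t x h.choose.1.1 h.choose.2.1
  else 0

open Classical in
/-- The lower value function along a partition, as a random field: for `t_i ≤ t < t_{i+1}` it is
`esssup_α essinf_β E[g(X_T^{t,x,α,β}) | Fil i]`, and at `t = T` it is `g x`. -/
def lowerValueRV (π : Partition T) (f : ℝ → E d → A → B → E d) (g : E d → ℝ) (t : ℝ) (x : E d) :
    Om →ₘ[P] ℝ :=
  if h : ∃ i : Fin π.n, t ∈ Ico (π.pt i.castSucc) (π.pt i.succ) then
    essSupFamily fun α : Strategy₁ π A B t =>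
      essInfFamily fun β : Strategy₂ π A B t => payoff π f g h.choose t x α β
  else AEEqFun.const Om (g x)

open Classical in
/-- The upper value function along a partition, as a random field: for `t_i ≤ t < t_{i+1}` it is
`essinf_β esssup_α E[g(X_T^{t,x,α,β}) | Fil i]`, and at `t = T` it is `g x`. -/
def upperValueRV (π : Partition T) (f : ℝ → E d → A → B → E d) (g : E d → ℝ) (t : ℝ) (x : E d) :
    Om →ₘ[P] ℝ :=
  if h : ∃ i : Fin π.n, t ∈ Ico (π.pt i.castSucc) (π.pt i.succ) then
    essInfFamily fun β : Strategy₂ π A B t =>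
      essSupFamily fun α : Strategy₁ π A B t => payoff π f g h.choose t x α β
  else AEEqFun.const Om (g x)

/-- The deterministic version `V^Π(t,x) = E[V^Π(t,x)]` of the lower value function. -/
def lowerValue (π : Partition T) (f : ℝ → E d → A → B → E d) (g : E d → ℝ) (t : ℝ) (x : E d) :
    ℝ :=
  ∫ ω, lowerValueRV π f g t x ω ∂P

/-- The deterministic version `U^Π(t,x) = E[U^Π(t,x)]` of the upper value function. -/
def upperValue (π : Partition T) (f : ℝ → E d → A → B → E d) (g : E d → ℝ) (t : ℝ) (x : E d) :
    ℝ :=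
  ∫ ω, upperValueRV π f g t x ω ∂P

/-! ### The Hamilton-Jacobi-Isaacs equation -/

/-- The drift averaged over a couple of mixed actions. -/
def mixedDrift (f : ℝ → E d → A → B → E d) (t : ℝ) (x : E d) (μ : ProbabilityMeasure A)
    (ν : ProbabilityMeasure B) : E d :=
  ∫ a, ∫ b, f t x a b ∂(ν : Measure B) ∂(μ : Measure A)

/-- The mixed Hamiltonian `sup_μ inf_ν ⟨f̃(t,x,μ,ν), p⟩`. -/
def hamiltonian (f : ℝ → E d → A → B → E d) (t : ℝ) (x p : E d) : ℝ :=
  ⨆ μ : ProbabilityMeasure A, ⨅ ν : ProbabilityMeasure B, inner ℝ (mixedDrift f t x μ ν) p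

/-- `∂φ/∂t (t,x) + H(t, x, ∇φ(t,x))`; at the time boundary the time derivative is one-sided. -/
def hjiOperator (T : ℝ) (f : ℝ → E d → A → B → E d) (φ : ℝ × E d → ℝ) (t : ℝ) (x : E d) : ℝ :=
  derivWithin (fun s => φ (s, x)) (Icc 0 T) t +
    hamiltonian f t x (gradient (fun y => φ (t, y)) x)

/-- Continuous viscosity subsolutions of `∂W/∂t + H(t,x,∇W) = 0`, `W(T,·) = g`, on
`[0,T] × ℝ^d`. -/
def IsViscositySubsolution (T : ℝ) (f : ℝ → E d → A → B → E d) (g : E d → ℝ)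
    (W : ℝ × E d → ℝ) : Prop :=
  ContinuousOn W (Icc 0 T ×ˢ univ) ∧
  (∀ x, W (T, x) ≤ g x) ∧
  ∀ φ : ℝ × E d → ℝ, ContDiffOn ℝ 1 φ (Icc 0 T ×ˢ univ) →
    ∀ t ∈ Ico 0 T, ∀ x : E d,
      IsLocalMaxOn (fun p => W p - φ p) (Icc 0 T ×ˢ univ) (t, x) →
      0 ≤ hjiOperator T f φ t x

/-- Continuous viscosity supersolutions of the same terminal value problem. -/
def IsViscositySupersolution (T : ℝ) (f : ℝ → E d → A → B → E d) (g : E d → ℝ)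
    (W : ℝ × E d → ℝ) : Prop :=
  ContinuousOn W (Icc 0 T ×ˢ univ) ∧
  (∀ x, g x ≤ W (T, x)) ∧
  ∀ φ : ℝ × E d → ℝ, ContDiffOn ℝ 1 φ (Icc 0 T ×ˢ univ) →
    ∀ t ∈ Ico 0 T, ∀ x : E d,
      IsLocalMinOn (fun p => W p - φ p) (Icc 0 T ×ˢ univ) (t, x) →
      hjiOperator T f φ t x ≤ 0

/-- Viscosity solutions. -/
def IsViscositySolution (T : ℝ) (f : ℝ → E d → A → B → E d) (g : E d → ℝ)
    (W : ℝ × E d → ℝ) : Prop :=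
  IsViscositySubsolution T f g W ∧ IsViscositySupersolution T f g W

end Game

end MixedGame

end

noncomputable section

set_option linter.unusedSectionVars false

namespace MixedGame

/-! ### Ordinary differential equations with measurable controls -/

/-! Along a fixed partition the random game has a deterministic value. Let W satisfy W(T) = g and,
for t in a slot ending at t_{j+1}, let W(t, x) be the sup over U, inf over V, of the expectation of
W(t_{j+1}, X), where U and V are open loop controls, each randomized by one of two independent
private numbers (`IsValue`, constructed in `exists_isValue`). Then `lowerValue_eq` shows that V^Π is
W on [0,T].

Player 1 guarantees W - ε by feedback: at the beginning of each slot a mixed control nearly optimal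
for the current state is selected (`exists_optimal_strategy`). This is nonanticipative with delay
because the state at t_j depends only on the opponent's control before t_j. Conversely, what a
strategy α plays in a slot is determined by the opponent's control before that slot, so Player 2 can
build, slot by slot, one control that answers α nearly optimally (`exists_response`). Both halves
rest on `setIntegral_flow_eq`: given the past, the private numbers of the slot are fresh and
independent, so the expected value at its end is a `stepCost`. Everything is written for a pair of
coordinates (p, q) of the square in either order (`IsSplit`), so the same lemmas serve the upper
value: U^Π is minus the lower value of the game with exchanged players and payoff -g
(`upperValue_eq`).

For the limit, suppose V - φ has a local maximum at (t₀, x₀). A penalized difference W_n - φ has a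
maximum point (s, y) nearby for some fine partition, and up to the end of the slot containing s, W_n
grows along every trajectory at most like φ, that is, by about ∂φ/∂t (s' - s) plus the integral of
⟨f(t₀, x₀, u, v), ∇φ⟩ (`exists_slot_growth_le`). This is inserted in the recursion. For the
subsolution inequality only the occupation measure of U matters against a constant pure action of
the opponent (`nonneg_of_isMaxmin`); for the supersolution inequality U is a constant mixed action
realized through the private number (`nonpos_of_isMaxmin`). Division by s' - s gives the mixed
Hamiltonian directly. For the upper values the Hamiltonian of the exchanged game appears, and the
minimax theorem for mixed actions (`minimax`, `hamiltonian_swap`) turns it into the one of (1). -/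

lemma le_mul_exp_of_le_add_integral {y : ℝ → ℝ} {a K t S : ℝ} (hK0 : 0 ≤ K)
    (hy : ContinuousOn y (Icc t S)) (hy0 : ∀ s ∈ Icc t S, 0 ≤ y s)
    (h : ∀ s ∈ Icc t S, y s ≤ a + K * ∫ r in t..s, y r) :
    ∀ s ∈ Icc t S, y s ≤ a * Real.exp (K * (s - t)) := by
  intro s hs
  have htS : t ≤ S := hs.1.trans hs.2
  -- The constant extension of y is continuous on the line, so its primitive is differentiable
  -- everywhere. Gronwall's inequality in derivative form is applied to that primitive, which starts
  -- at 0.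
  set z : ℝ → ℝ := fun r => y (projIcc t S htS r) with hz
  have hzc : Continuous z :=
    (continuousOn_iff_continuous_domRestrict.1 hy).comp continuous_projIcc
  have hzy : ∀ r ∈ Icc t S, z r = y r := fun r hr => by simp [hz, projIcc_of_mem htS hr]
  have hint : ∀ r ∈ Icc t S, ∫ q in t..r, z q = ∫ q in t..r, y q := fun r hr =>
    intervalIntegral.integral_congr fun q hq => by
      rw [uIcc_of_le hr.1] at hq
      exact hzy q ⟨hq.1, hq.2.trans hr.2⟩
  have hd : ∀ r, HasDerivAt (fun r => ∫ q in t..r, z q) (z r) r := fun r =>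
    intervalIntegral.integral_hasDerivAt_right (hzc.intervalIntegrable _ _)
      (hzc.stronglyMeasurableAtFilter _ _) hzc.continuousAt
  have hpos : ∀ r ∈ Icc t S, 0 ≤ ∫ q in t..r, z q := fun r hr =>
    intervalIntegral.integral_nonneg hr.1 fun q hq => by
      have : q ∈ Icc t S := ⟨hq.1, hq.2.trans hr.2⟩
      rw [hzy q this]; exact hy0 q this
  have key := norm_le_gronwallBound_of_norm_deriv_right_le (f := fun r => ∫ q in t..r, z q)
    (f' := z) (δ := 0) (K := K) (ε := a) (a := t) (b := S)
    (fun r _ => (hd r).continuousAt.continuousWithinAt) (fun r _ => (hd r).hasDerivWithinAt)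
    (by simp) (fun r hr => by
      have hr' := Ico_subset_Icc_self hr
      rw [Real.norm_of_nonneg (hpos r hr'), hint r hr', hzy r hr',
        Real.norm_of_nonneg (hy0 r hr')]
      linarith [h r hr']) s hs
  rw [Real.norm_of_nonneg (hpos s hs), hint s hs] at key
  have h1 := h s hs
  -- `gronwallBound` has a separate formula at K = 0, where the claim is the hypothesis itself.
  by_cases hK : K = 0
  · subst hK; simpa using h1
  · rw [gronwallBound_of_K_ne_0 hK] at key
    have hK0 : 0 < K := lt_of_le_of_ne hK0 (Ne.symm hK)
    have h2 := mul_le_mul_of_nonneg_left key hK0.le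
    have h3 : K * (0 * Real.exp (K * (s - t)) + a / K * (Real.exp (K * (s - t)) - 1)) =
      a * Real.exp (K * (s - t)) - a := by field_simp; ring
    linarith

variable {d : ℕ}

/-! ### Picard iteration with a parameter, for drifts merely measurable in time. -/

section Picard

variable {S : Type*} [MeasurableSpace S]

/-- The Picard iterates of a differential equation with a parameter. -/
def picard (b : S → ℝ → E d → E d) (t : ℝ) (x : S → E d) : ℕ → ℝ → S → E d
  | 0 => fun _ ω => x ω
  | n + 1 => fun s ω => x ω + ∫ r in t..s, b ω r (picard b t x n r ω)

variable {b : S → ℝ → E d → E d} {C K : ℝ}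

/-- Continuity in time and measurability in the parameter give joint measurability. -/
lemma measurable_primitive {h : ℝ → S → E d} (hh : Measurable (Function.uncurry h))
    (hb : ∀ r ω, ‖h r ω‖ ≤ C) (t : ℝ) :
    Measurable (Function.uncurry fun s ω => ∫ r in t..s, h r ω) := by
  refine measurable_uncurry_of_continuous_of_measurable (fun ω => ?_) (fun s => ?_)
  · refine intervalIntegral.continuous_primitive (fun a c => ?_) t
    exact (intervalIntegrable_const (c := C)).mono_fun'
      (hh.comp (measurable_id.prodMk measurable_const)).aestronglyMeasurable
      (Eventually.of_forall fun r => hb r ω)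
  · have h1 : StronglyMeasurable (fun q : S × ℝ => h q.2 q.1) :=
      (hh.comp (measurable_snd.prodMk measurable_fst)).stronglyMeasurable
    simp only [intervalIntegral]
    exact (h1.integral_prod_right (ν := volume.restrict (Ioc t s))).measurable.sub
      (h1.integral_prod_right (ν := volume.restrict (Ioc s t))).measurable

lemma measurable_picard (hb : Measurable fun q : S × ℝ × E d => b q.1 q.2.1 q.2.2)
    (hC : ∀ ω r y, ‖b ω r y‖ ≤ C) {x : S → E d} (hx : Measurable x) (t : ℝ) (n : ℕ) :
    Measurable (Function.uncurry (picard b t x n)) := by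
  induction n with
  | zero => exact hx.comp measurable_snd
  | succ n ih =>
    refine (hx.comp measurable_snd).add (measurable_primitive (C := C)
      (h := fun r ω => b ω r (picard b t x n r ω)) ?_ ?_ t)
    · exact hb.comp (measurable_snd.prodMk (measurable_fst.prodMk ih))
    · intro r ω; exact hC _ _ _

lemma intervalIntegrable_of_bound {h : ℝ → E d} (hh : Measurable h) (hb : ∀ r, ‖h r‖ ≤ C)
    (a c : ℝ) : IntervalIntegrable h volume a c :=
  (intervalIntegrable_const (c := C)).mono_fun' hh.aestronglyMeasurable
    (Eventually.of_forall hb)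

/-- Each iteration integrates the previous gap once more; the factorial so produced makes the gaps
summable on every bounded interval, whatever the size of K. -/
lemma norm_picard_succ_sub_le (hb : Measurable fun q : S × ℝ × E d => b q.1 q.2.1 q.2.2)
    (hC : ∀ ω r y, ‖b ω r y‖ ≤ C) (hK : ∀ ω r y z, ‖b ω r y - b ω r z‖ ≤ K * ‖y - z‖)
    (hK0 : 0 ≤ K) {x : S → E d} (hx : Measurable x) (t : ℝ) (n : ℕ) (ω : S) :
    ∀ s ≥ t, ‖picard b t x (n + 1) s ω - picard b t x n s ω‖ ≤
      C * K ^ n * (s - t) ^ (n + 1) / (n + 1).factorial := by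
  induction n with
  | zero =>
    intro s hs
    simp only [picard, add_sub_cancel_left]
    have := intervalIntegral.norm_integral_le_of_norm_le_const (a := t) (b := s)
      (f := fun r => b ω r (x ω)) (C := C) (fun r _ => hC _ _ _)
    rw [abs_of_nonneg (by linarith)] at this
    simpa using this
  | succ n ih =>
    intro s hs
    have hm : ∀ m, Measurable fun r => b ω r (picard b t x m r ω) := fun m =>
      hb.comp (measurable_const.prodMk (measurable_id.prodMk
        ((measurable_picard hb hC hx t m).comp (measurable_id.prodMk measurable_const))))
    have hi : ∀ m, IntervalIntegrable (fun r => b ω r (picard b t x m r ω)) volume t s :=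
      fun m => intervalIntegrable_of_bound (hm m) (fun r => hC _ _ _) _ _
    have e : picard b t x (n + 1 + 1) s ω - picard b t x (n + 1) s ω =
        ∫ r in t..s, (b ω r (picard b t x (n + 1) r ω) - b ω r (picard b t x n r ω)) := by
      rw [intervalIntegral.integral_sub (hi _) (hi _)]
      simp only [picard, add_sub_add_left_eq_sub]
    rw [e]
    have hb1 : ∀ r ∈ Ioc t s, ‖b ω r (picard b t x (n + 1) r ω) - b ω r (picard b t x n r ω)‖ ≤
        C * K ^ (n + 1) / (n + 1).factorial * (r - t) ^ (n + 1) := fun r hr => by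
      refine (hK _ _ _ _).trans ((mul_le_mul_of_nonneg_left (ih r hr.1.le) hK0).trans_eq ?_)
      ring
    have h2 := intervalIntegral.norm_integral_le_of_norm_le hs
      (μ := volume) (ae_of_all _ hb1) (Continuous.intervalIntegrable (by fun_prop) _ _)
    refine h2.trans_eq ?_
    rw [intervalIntegral.integral_const_mul,
      intervalIntegral.integral_comp_sub_right (fun r => r ^ (n + 1)) t, integral_pow]
    rw [Nat.factorial_succ (n + 1)]
    have : ((n + 1).factorial : ℝ) ≠ 0 := by positivity
    push_cast
    field_simp
    simp

/-- The explicit iteration is used because the solution has to be jointly measurable in time and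
parameter, a property that passes to pointwise limits of the iterates. -/
lemma exists_measurable_solution (hb : Measurable fun q : S × ℝ × E d => b q.1 q.2.1 q.2.2)
    (hC : ∀ ω r y, ‖b ω r y‖ ≤ C) (hK : ∀ ω r y z, ‖b ω r y - b ω r z‖ ≤ K * ‖y - z‖)
    (hK0 : 0 ≤ K) {x : S → E d} (hx : Measurable x) (t : ℝ) :
    ∃ X : ℝ → S → E d, Measurable (Function.uncurry X) ∧
      ∀ ω, ∀ s ≥ t, X s ω = x ω + ∫ r in t..s, b ω r (X r ω) := by
  -- The factorial estimate holds for s ≥ t only; `max s t` freezes the iterates before t, so that a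
  -- limit exists at every real time.
  have hlim : ∀ ω s, ∃ l, Tendsto (fun n => picard b t x n (max s t) ω) atTop (𝓝 l) := by
    intro ω s
    apply cauchySeq_tendsto_of_complete
    refine cauchySeq_of_dist_le_of_summable
      (fun n => C * (max s t - t) * ((K * (max s t - t)) ^ n / n.factorial)) (fun n => ?_)
      ((Real.summable_pow_div_factorial _).mul_left _)
    rw [dist_comm, dist_eq_norm]
    refine (norm_picard_succ_sub_le hb hC hK hK0 hx t n ω _ (le_max_right _ _)).trans ?_
    have hC0 : 0 ≤ C := (norm_nonneg _).trans (hC ω t 0)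
    have hst : 0 ≤ max s t - t := sub_nonneg.2 (le_max_right _ _)
    rw [mul_pow, Nat.factorial_succ]
    have h1 : (0:ℝ) < n.factorial := by positivity
    push_cast
    rw [show C * K ^ n * (max s t - t) ^ (n + 1) / ((n + 1) * n.factorial) =
      (C * (max s t - t) * (K ^ n * (max s t - t) ^ n / n.factorial)) / (n + 1) by
        field_simp; ring]
    apply div_le_self (by positivity)
    linarith [n.cast_nonneg (α := ℝ)]
  choose X hX using hlim
  have hm : Measurable (Function.uncurry fun s ω => X ω s) := by
    refine measurable_of_tendsto_metrizable (f := fun n => fun q : ℝ × S =>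
      picard b t x n (max q.1 t) q.2) (fun n => ?_) (tendsto_pi_nhds.2 fun q => hX q.2 q.1)
    exact (measurable_picard hb hC hx t n).comp
      ((measurable_fst.max measurable_const).prodMk measurable_snd)
  refine ⟨fun s ω => X ω s, hm, fun ω s hs => ?_⟩
  have h1 : Tendsto (fun n => picard b t x n s ω) atTop (𝓝 (X ω s)) := by
    simpa [max_eq_left hs] using hX ω s
  refine tendsto_nhds_unique ((tendsto_add_atTop_iff_nat 1).2 h1) ?_
  simp only [picard]
  refine tendsto_const_nhds.add ?_
  refine intervalIntegral.tendsto_integral_filter_of_dominated_convergence (fun _ => C)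
    (Eventually.of_forall fun n => ?_) (Eventually.of_forall fun n => ae_of_all _ fun r _ => hC _ _ _)
    intervalIntegrable_const (ae_of_all _ fun r hr => ?_)
  · exact (hb.comp (measurable_const.prodMk (measurable_id.prodMk
      ((measurable_picard hb hC hx t n).comp
        (measurable_id.prodMk measurable_const))))).aestronglyMeasurable
  · rw [uIoc_of_le hs] at hr
    have h2 : Tendsto (fun n => picard b t x n r ω) atTop (𝓝 (X ω r)) := by
      simpa [max_eq_left hr.1.le] using hX ω r
    rw [tendsto_iff_norm_sub_tendsto_zero] at h2 ⊢
    refine squeeze_zero (fun _ => norm_nonneg _) (fun n => hK _ _ _ _) ?_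
    simpa using h2.const_mul K

end Picard

variable {A B : Type*}

/-! ### The controlled flow: uniqueness, stability, restart and measurability. -/

section Flow

open Classical in
/-- The solution at time `s` of the controlled equation started from `x` at time `t`. -/
def flow (T : ℝ) (f : ℝ → E d → A → B → E d) (t : ℝ) (x : E d) (u : ℝ → A) (v : ℝ → B)
    (s : ℝ) : E d :=
  if h : ∃ X, IsTrajectory T f t x u v X then h.choose s else 0

lemma state_eq_flow (T : ℝ) (f : ℝ → E d → A → B → E d) (t : ℝ) (x : E d) (u : ℝ → Om → A)
    (v : ℝ → Om → B) (s : ℝ) (ω : Om) :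
    state T f t x u v s ω = flow T f t x (fun r => u r ω) (fun r => v r ω) s := rfl

variable [TopologicalSpace A] [TopologicalSpace B]

/-- Bounded continuous drifts that are Lipschitz in the state. -/
structure IsDrift (f : ℝ → E d → A → B → E d) (C K : ℝ) : Prop where
  cont : Continuous fun q : ℝ × E d × A × B => f q.1 q.2.1 q.2.2.1 q.2.2.2
  bdd : ∀ t x a b, ‖f t x a b‖ ≤ C
  lip : ∀ t x y a b, ‖f t x a b - f t y a b‖ ≤ K * ‖x - y‖
  C_nonneg : 0 ≤ C
  K_nonneg : 0 ≤ K

lemma IsDrift.swap {f : ℝ → E d → A → B → E d} {C K : ℝ} (hf : IsDrift f C K) :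
    IsDrift (fun t x b a => f t x a b) C K where
  cont := hf.cont.comp (f := fun q : ℝ × E d × B × A => (q.1, q.2.1, q.2.2.2, q.2.2.1))
    (by fun_prop)
  bdd t x b a := hf.bdd t x a b
  lip t x y b a := hf.lip t x y a b
  C_nonneg := hf.C_nonneg
  K_nonneg := hf.K_nonneg

variable [SecondCountableTopology A] [SecondCountableTopology B]
  [MeasurableSpace A] [BorelSpace A] [MeasurableSpace B] [BorelSpace B]
  {f : ℝ → E d → A → B → E d} {C K : ℝ} (hf : IsDrift f C K)
include hf

lemma IsDrift.measurable : Measurable fun q : ℝ × E d × A × B => f q.1 q.2.1 q.2.2.1 q.2.2.2 :=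
  hf.cont.measurable

variable {T t t' S : ℝ} {x x' : E d} {u u' : ℝ → A} {v v' : ℝ → B} {X X' : ℝ → E d}

lemma exists_trajectory_family {S : Type*} [MeasurableSpace S] {x : S → E d} (hx : Measurable x)
    {u : ℝ → S → A} {v : ℝ → S → B} (hu : Measurable (Function.uncurry u))
    (hv : Measurable (Function.uncurry v)) (T t : ℝ) :
    ∃ X : ℝ → S → E d, (∀ s, Measurable (X s)) ∧
      ∀ ω, IsTrajectory T f t (x ω) (fun r => u r ω) (fun r => v r ω) (fun s => X s ω) := by
  have hb : Measurable fun q : S × ℝ × E d => f q.2.1 q.2.2 (u q.2.1 q.1) (v q.2.1 q.1) := by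
    have h1 : Measurable fun q : S × ℝ × E d => (q.2.1, q.1) := by fun_prop
    exact hf.measurable.comp ((measurable_fst.comp measurable_snd).prodMk
      ((measurable_snd.comp measurable_snd).prodMk ((hu.comp h1).prodMk (hv.comp h1))))
  obtain ⟨X, hXm, hX⟩ := exists_measurable_solution (b := fun ω r y => f r y (u r ω) (v r ω))
    (C := C) (K := K) hb (fun _ _ _ => hf.bdd _ _ _ _) (fun _ _ _ _ => hf.lip _ _ _ _ _)
    hf.K_nonneg hx t
  refine ⟨X, fun s => hXm.comp (measurable_const.prodMk measurable_id), fun ω => ⟨?_, ?_⟩⟩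
  · have hm : Measurable fun r => f r (X r ω) (u r ω) (v r ω) :=
      hb.comp (measurable_const.prodMk (measurable_id.prodMk
        (hXm.comp (measurable_id.prodMk measurable_const))))
    have hc : Continuous fun s => x ω + ∫ r in t..s, f r (X r ω) (u r ω) (v r ω) :=
      continuous_const.add (intervalIntegral.continuous_primitive
        (fun a c => intervalIntegrable_of_bound hm (fun r => hf.bdd _ _ _ _) a c) t)
    exact hc.continuousOn.congr fun s hs => hX ω s hs.1
  · exact fun s hs => hX ω s hs.1

lemma exists_trajectory (hu : Measurable u) (hv : Measurable v) (T t : ℝ) (x : E d) :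
    ∃ X, IsTrajectory T f t x u v X := by
  obtain ⟨X, -, hX⟩ := exists_trajectory_family hf (S := Unit) (x := fun _ => x)
    measurable_const (u := fun r _ => u r) (v := fun r _ => v r) (hu.comp measurable_fst)
    (hv.comp measurable_fst) T t
  exact ⟨_, hX ()⟩

lemma isTrajectory_flow (hu : Measurable u) (hv : Measurable v) (T t : ℝ) (x : E d) :
    IsTrajectory T f t x u v (flow T f t x u v) := by
  have h := exists_trajectory hf hu hv T t x
  have e : flow T f t x u v = h.choose := by funext s; simp only [flow, dif_pos h]
  rw [e]; exact h.choose_spec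

lemma IsTrajectory.intervalIntegrable (hu : Measurable u) (hv : Measurable v)
    (hX : IsTrajectory T f t x u v X) {a c : ℝ} (ha : a ∈ Icc t T) (hc : c ∈ Icc t T) :
    IntervalIntegrable (fun r => f r (X r) (u r) (v r)) volume a c := by
  have htT : t ≤ T := ha.1.trans ha.2
  have hm : Measurable fun r => f r (X (projIcc t T htT r)) (u r) (v r) := by
    have h1 : Continuous fun r => X (projIcc t T htT r) :=
      (continuousOn_iff_continuous_domRestrict.1 hX.1).comp continuous_projIcc
    exact hf.measurable.comp (measurable_id.prodMk (h1.measurable.prodMk (hu.prodMk hv)))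
  refine (intervalIntegrable_of_bound hm (fun r => hf.bdd _ _ _ _) a c).congr ?_
  intro r hr
  have : r ∈ Icc t T := uIcc_subset_Icc ha hc (uIoc_subset_uIcc hr)
  simp [projIcc_of_mem htT this]

/-- Gronwall's inequality. With x = x' it is uniqueness, and it makes the trajectory selected in
`flow` independent of the selection. -/
lemma IsTrajectory.norm_sub_le (hu : Measurable u) (hv : Measurable v) (hu' : Measurable u')
    (hv' : Measurable v') (hX : IsTrajectory T f t x u v X)
    (hX' : IsTrajectory T f t x' u' v' X') (hST : S ≤ T)
    (h : ∀ᵐ r, r ∈ Ico t S → u r = u' r ∧ v r = v' r) :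
    ∀ s ∈ Icc t S, ‖X s - X' s‖ ≤ ‖x - x'‖ * Real.exp (K * (s - t)) := by
  have hsub : Icc t S ⊆ Icc t T := Icc_subset_Icc_right hST
  have hcont : ContinuousOn (fun s => ‖X s - X' s‖) (Icc t T) := (hX.1.sub hX'.1).norm
  refine le_mul_exp_of_le_add_integral hf.K_nonneg (hcont.mono hsub)
    (fun s _ => norm_nonneg _) (fun s hs => ?_)
  have hs' := hsub hs
  have ht : t ∈ Icc t T := ⟨le_rfl, hs'.1.trans hs'.2⟩
  rw [hX.2 s hs', hX'.2 s hs']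
  have e : x + (∫ r in t..s, f r (X r) (u r) (v r)) - (x' + ∫ r in t..s, f r (X' r) (u' r) (v' r))
      = (x - x') + ∫ r in t..s, (f r (X r) (u r) (v r) - f r (X' r) (u' r) (v' r)) := by
    rw [intervalIntegral.integral_sub (hX.intervalIntegrable hf hu hv ht hs')
      (hX'.intervalIntegrable hf hu' hv' ht hs')]
    abel
  rw [e]
  refine (norm_add_le _ _).trans (add_le_add_right ?_ _)
  rw [← intervalIntegral.integral_const_mul]
  refine intervalIntegral.norm_integral_le_of_norm_le hs.1 ?_ ?_
  · have hne : ∀ᵐ r : ℝ, r ≠ S := by simp [ae_iff, measure_singleton]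
    filter_upwards [h, hne] with r hr hrS hr1
    obtain ⟨h1, h2⟩ := hr ⟨hr1.1.le, lt_of_le_of_ne (hr1.2.trans hs.2) hrS⟩
    rw [h1, h2]
    exact hf.lip _ _ _ _ _
  · exact ((hcont.mono (uIcc_subset_Icc ht hs')).intervalIntegrable).const_mul K

lemma IsTrajectory.restart (hu : Measurable u) (hv : Measurable v)
    (hX : IsTrajectory T f t x u v X) (ht : t ≤ t') (hT : t' ≤ T) :
    IsTrajectory T f t' (X t') u v X := by
  have h' : t' ∈ Icc t T := ⟨ht, hT⟩
  have h0 : t ∈ Icc t T := ⟨le_rfl, ht.trans hT⟩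
  refine ⟨hX.1.mono (Icc_subset_Icc_left ht), fun s hs => ?_⟩
  have hs' : s ∈ Icc t T := ⟨ht.trans hs.1, hs.2⟩
  rw [hX.2 s hs', hX.2 t' h', add_assoc, intervalIntegral.integral_add_adjacent_intervals
    (hX.intervalIntegrable hf hu hv h0 h') (hX.intervalIntegrable hf hu hv h' hs')]

omit [SecondCountableTopology A] [SecondCountableTopology B]
  [MeasurableSpace A] [BorelSpace A] [MeasurableSpace B] [BorelSpace B] in
lemma IsTrajectory.norm_sub_start_le (hX : IsTrajectory T f t x u v X) {s : ℝ}
    (hs : s ∈ Icc t T) : ‖X s - x‖ ≤ C * (s - t) := by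
  rw [hX.2 s hs, add_sub_cancel_left]
  refine (intervalIntegral.norm_integral_le_of_norm_le_const
    (fun r _ => hf.bdd r (X r) (u r) (v r))).trans_eq ?_
  rw [abs_of_nonneg (sub_nonneg.2 hs.1)]

lemma flow_self (hu : Measurable u) (hv : Measurable v) (h : t ≤ T) :
    flow T f t x u v t = x := by
  have := (isTrajectory_flow hf hu hv T t x).2 t ⟨le_rfl, h⟩
  simpa using this

lemma norm_flow_sub_flow_le (hu : Measurable u) (hv : Measurable v) (hu' : Measurable u')
    (hv' : Measurable v') (hST : S ≤ T) (h : ∀ᵐ r, r ∈ Ico t S → u r = u' r ∧ v r = v' r)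
    {s : ℝ} (hs : s ∈ Icc t S) : ‖flow T f t x u v s - flow T f t x' u' v' s‖ ≤
      ‖x - x'‖ * Real.exp (K * (s - t)) :=
  (isTrajectory_flow hf hu hv T t x).norm_sub_le hf hu hv hu' hv'
    (isTrajectory_flow hf hu' hv' T t x') hST h s hs

lemma flow_congr (hu : Measurable u) (hv : Measurable v) (hu' : Measurable u')
    (hv' : Measurable v') (hST : S ≤ T) (h : ∀ᵐ r, r ∈ Ico t S → u r = u' r ∧ v r = v' r)
    {s : ℝ} (hs : s ∈ Icc t S) : flow T f t x u v s = flow T f t x u' v' s := by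
  have := norm_flow_sub_flow_le hf (x := x) (x' := x) hu hv hu' hv' hST h hs
  rw [sub_self, norm_zero, zero_mul] at this
  exact sub_eq_zero.1 (norm_le_zero_iff.1 this)

lemma flow_flow (hu : Measurable u) (hv : Measurable v) {s : ℝ} (h1 : t ≤ t') (h2 : t' ≤ s)
    (h3 : s ≤ T) : flow T f t' (flow T f t x u v t') u v s = flow T f t x u v s := by
  have h := (isTrajectory_flow hf hu hv T t x).restart hf hu hv h1 (h2.trans h3)
  have := (isTrajectory_flow hf hu hv T t' (flow T f t x u v t')).norm_sub_le hf hu hv hu hv h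
    le_rfl (ae_of_all _ fun _ _ => ⟨rfl, rfl⟩) s ⟨h2, h3⟩
  rw [sub_self, norm_zero, zero_mul] at this
  exact sub_eq_zero.1 (norm_le_zero_iff.1 this)

lemma norm_flow_sub_le (hu : Measurable u) (hv : Measurable v) {s : ℝ} (hs : s ∈ Icc t T) :
    ‖flow T f t x u v s - x‖ ≤ C * (s - t) :=
  (isTrajectory_flow hf hu hv T t x).norm_sub_start_le hf hs

/-- `flow` is selected path by path, with no regularity in ω a priori; uniqueness identifies it with
the measurable family of solutions. -/
lemma measurable_flow {S : Type*} [MeasurableSpace S] {x : S → E d} (hx : Measurable x)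
    {u : ℝ → S → A} {v : ℝ → S → B} (hu : Measurable (Function.uncurry u))
    (hv : Measurable (Function.uncurry v)) {s : ℝ} (hs : s ∈ Icc t T) :
    Measurable fun ω => flow T f t (x ω) (fun r => u r ω) (fun r => v r ω) s := by
  obtain ⟨X, hXm, hX⟩ := exists_trajectory_family hf hx hu hv T t
  convert! hXm s using 2 with ω
  have hum : Measurable fun r => u r ω := hu.comp (measurable_id.prodMk measurable_const)
  have hvm : Measurable fun r => v r ω := hv.comp (measurable_id.prodMk measurable_const)
  have := (isTrajectory_flow hf hum hvm T t (x ω)).norm_sub_le hf hum hvm hum hvm (hX ω)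
    le_rfl (ae_of_all _ fun _ _ => ⟨rfl, rfl⟩) s hs
  rw [sub_self, norm_zero, zero_mul] at this
  exact sub_eq_zero.1 (norm_le_zero_iff.1 this)

end Flow

/-! ### Lower values of abstract two-person games. -/

section Maxmin

variable {X Y : Type*}

/-- `w` is the lower value `sup_U inf_V J U V`. -/
def IsMaxmin (J : X → Y → ℝ) (w : ℝ) : Prop :=
  (∀ ε > 0, ∃ U, ∀ V, w - ε ≤ J U V) ∧ ∀ ε > 0, ∀ U, ∃ V, J U V ≤ w + ε

lemma IsMaxmin.le_add {J J' : X → Y → ℝ} {w w' δ : ℝ} (h : IsMaxmin J w) (h' : IsMaxmin J' w')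
    (hJ : ∀ U V, J U V ≤ J' U V + δ) : w ≤ w' + δ := by
  refine le_of_forall_pos_le_add fun ε hε => ?_
  obtain ⟨U, hU⟩ := h.1 (ε / 2) (by linarith)
  obtain ⟨V, hV⟩ := h'.2 (ε / 2) (by linarith) U
  linarith [hU V, hJ U V]

lemma IsMaxmin.abs_sub_le {J J' : X → Y → ℝ} {w w' δ : ℝ} (h : IsMaxmin J w)
    (h' : IsMaxmin J' w') (hJ : ∀ U V, |J U V - J' U V| ≤ δ) : |w - w'| ≤ δ := by
  refine abs_le.2 ⟨?_, ?_⟩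
  · linarith [h'.le_add h (δ := δ) fun U V => by linarith [(abs_le.1 (hJ U V)).1]]
  · linarith [h.le_add h' (δ := δ) fun U V => by linarith [(abs_le.1 (hJ U V)).2]]

lemma exists_isMaxmin [Nonempty X] [Nonempty Y] {J : X → Y → ℝ} {M : ℝ}
    (hJ : ∀ U V, |J U V| ≤ M) : ∃ w, IsMaxmin J w ∧ |w| ≤ M := by
  have hb : ∀ U, BddBelow (range (J U)) := fun U => ⟨-M, by
    rintro _ ⟨V, rfl⟩; exact (abs_le.1 (hJ U V)).1⟩
  have h1 : ∀ U, ⨅ V, J U V ≤ M := fun U =>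
    (ciInf_le (hb U) (Classical.arbitrary Y)).trans (abs_le.1 (hJ U _)).2
  have h2 : ∀ U, -M ≤ ⨅ V, J U V := fun U => le_ciInf fun V => (abs_le.1 (hJ U V)).1
  have ha : BddAbove (range fun U => ⨅ V, J U V) := ⟨M, by rintro _ ⟨U, rfl⟩; exact h1 U⟩
  refine ⟨⨆ U, ⨅ V, J U V, ⟨fun ε hε => ?_, fun ε hε U => ?_⟩, abs_le.2 ⟨?_, ciSup_le h1⟩⟩
  · obtain ⟨U, hU⟩ := exists_lt_of_lt_ciSup (sub_lt_self (⨆ U, ⨅ V, J U V) hε)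
    exact ⟨U, fun V => hU.le.trans (ciInf_le (hb U) V)⟩
  · obtain ⟨V, hV⟩ := exists_lt_of_ciInf_lt (lt_add_of_pos_right (⨅ V, J U V) hε)
    exact ⟨V, hV.le.trans (by gcongr; exact le_ciSup ha U)⟩
  · exact (h2 (Classical.arbitrary X)).trans (le_ciSup ha _)

end Maxmin

/-- Randomized open loop controls: measurable functions of time and a private random number. -/
def MixedControl (A : Type*) [MeasurableSpace A] : Type _ :=
  {U : ℝ → unitInterval → A // Measurable (Function.uncurry U)}

/-! ### The expected cost of one slot under mixed open loop controls. -/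

section Step

variable [MeasurableSpace A] [MeasurableSpace B]

instance [Nonempty A] : Nonempty (MixedControl A) :=
  ⟨⟨fun _ _ => Classical.arbitrary A, measurable_const⟩⟩

lemma MixedControl.measurable_path (U : MixedControl A) (y : unitInterval) :
    Measurable fun r => U.1 r y :=
  U.2.comp (measurable_id.prodMk measurable_const)

/-- The expected value of `ψ` at the state reached at time `s₁` from `x` at time `s₀`, when the
players use independent randomized controls. -/
def stepCost (T : ℝ) (f : ℝ → E d → A → B → E d) (s₀ s₁ : ℝ) (ψ : E d → ℝ) (x : E d)
    (U : MixedControl A) (V : MixedControl B) : ℝ :=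
  ∫ z : unitInterval × unitInterval, ψ (flow T f s₀ x (fun r => U.1 r z.1) (fun r => V.1 r z.2) s₁)

variable {T : ℝ} {f : ℝ → E d → A → B → E d} {ψ : E d → ℝ} {C K L M : ℝ}

lemma abs_stepCost_le (hM : ∀ x, |ψ x| ≤ M) (s₀ s₁ : ℝ) (x : E d) (U : MixedControl A)
    (V : MixedControl B) : |stepCost T f s₀ s₁ ψ x U V| ≤ M := by
  have := norm_integral_le_of_norm_le_const (μ := (volume : Measure (unitInterval × unitInterval)))
    (f := fun z => ψ (flow T f s₀ x (fun r => U.1 r z.1) (fun r => V.1 r z.2) s₁))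
    (ae_of_all _ fun z => hM _)
  simpa [stepCost] using this

lemma continuous_of_abs_sub_le (hL : ∀ x y, |ψ x - ψ y| ≤ L * ‖x - y‖) : Continuous ψ := by
  refine (LipschitzWith.of_dist_le_mul (K := L.toNNReal) fun x y => ?_).continuous
  rw [Real.dist_eq, dist_eq_norm]
  exact (hL x y).trans (mul_le_mul_of_nonneg_right (Real.le_coe_toNNReal L) (norm_nonneg _))

variable [TopologicalSpace A] [TopologicalSpace B]
  [SecondCountableTopology A] [SecondCountableTopology B] [BorelSpace A] [BorelSpace B]
  (hf : IsDrift f C K)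
include hf

lemma measurable_flow_pair {s₀ s₁ : ℝ} (hs : s₁ ∈ Icc s₀ T) (x : E d) (U : MixedControl A)
    (V : MixedControl B) : Measurable fun z : unitInterval × unitInterval =>
      flow T f s₀ x (fun r => U.1 r z.1) (fun r => V.1 r z.2) s₁ := by
  have hU : Measurable (Function.uncurry fun r (z : unitInterval × unitInterval) => U.1 r z.1) :=
    U.2.comp (g := Function.uncurry U.1) (f := fun q : ℝ × unitInterval × unitInterval =>
      (q.1, q.2.1)) (by fun_prop)
  have hV : Measurable (Function.uncurry fun r (z : unitInterval × unitInterval) => V.1 r z.2) :=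
    V.2.comp (g := Function.uncurry V.1) (f := fun q : ℝ × unitInterval × unitInterval =>
      (q.1, q.2.2)) (by fun_prop)
  exact measurable_flow hf measurable_const hU hV hs

lemma integrable_stepCost (hψ : Continuous ψ) (hM : ∀ x, |ψ x| ≤ M)
    {s₀ s₁ : ℝ} (hs : s₁ ∈ Icc s₀ T) (x : E d) (U : MixedControl A) (V : MixedControl B) :
    Integrable fun z : unitInterval × unitInterval =>
      ψ (flow T f s₀ x (fun r => U.1 r z.1) (fun r => V.1 r z.2) s₁) :=
  (integrable_const M).mono' (hψ.measurable.comp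
    (measurable_flow_pair hf hs x U V)).aestronglyMeasurable (ae_of_all _ fun _ => hM _)

/-- The trajectory starting earlier is run up to s₀', having moved by at most C (s₀' - s₀), and
Gronwall's estimate applies from there. Unequal starting times are what yields the continuity of the
value in time. -/
lemma norm_flow_sub_flow_le_of_le {s₀ s₀' s₁ : ℝ} (h : s₀ ≤ s₀') (h' : s₀' ≤ s₁) (hT : s₁ ≤ T)
    {u : ℝ → A} {v : ℝ → B} (hu : Measurable u) (hv : Measurable v) (x x' : E d) :
    ‖flow T f s₀ x u v s₁ - flow T f s₀' x' u v s₁‖ ≤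
      (‖x - x'‖ + C * (s₀' - s₀)) * Real.exp (K * (s₁ - s₀')) := by
  rw [← flow_flow hf hu hv h h' hT]
  refine (norm_flow_sub_flow_le hf hu hv hu hv hT (ae_of_all _ fun _ _ => ⟨rfl, rfl⟩)
    ⟨h', le_rfl⟩).trans ?_
  gcongr
  have h1 := norm_flow_sub_le hf (x := x) hu hv ⟨h, h'.trans hT⟩
  calc ‖flow T f s₀ x u v s₀' - x'‖ = ‖(flow T f s₀ x u v s₀' - x) + (x - x')‖ := by congr 1; abel
    _ ≤ _ := (norm_add_le _ _).trans (by linarith)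

lemma abs_stepCost_sub_le (hL0 : 0 ≤ L) (hL : ∀ x y, |ψ x - ψ y| ≤ L * ‖x - y‖)
    (hM : ∀ x, |ψ x| ≤ M) {s₀ s₀' s₁ : ℝ} (h : s₀ ≤ s₀') (h' : s₀' ≤ s₁) (hT : s₁ ≤ T)
    (x x' : E d) (U : MixedControl A) (V : MixedControl B) :
    |stepCost T f s₀ s₁ ψ x U V - stepCost T f s₀' s₁ ψ x' U V| ≤
      L * ((‖x - x'‖ + C * (s₀' - s₀)) * Real.exp (K * (s₁ - s₀'))) := by
  have hψ := continuous_of_abs_sub_le hL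
  unfold stepCost
  rw [← integral_sub (integrable_stepCost hf hψ hM ⟨h.trans h', hT⟩ x U V)
    (integrable_stepCost hf hψ hM ⟨h', hT⟩ x' U V)]
  have := norm_integral_le_of_norm_le_const (μ := (volume : Measure (unitInterval × unitInterval)))
    (f := fun z => ψ (flow T f s₀ x (fun r => U.1 r z.1) (fun r => V.1 r z.2) s₁) -
      ψ (flow T f s₀' x' (fun r => U.1 r z.1) (fun r => V.1 r z.2) s₁))
    (ae_of_all _ fun z => (hL _ _).trans (mul_le_mul_of_nonneg_left
      (norm_flow_sub_flow_le_of_le hf h h' hT (U.measurable_path z.1) (V.measurable_path z.2) x x')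
      hL0))
  simpa using this

lemma stepCost_self {s : ℝ} (hs : s ≤ T) (x : E d) (U : MixedControl A) (V : MixedControl B) :
    stepCost T f s s ψ x U V = ψ x := by
  simp [stepCost, flow_self hf (U.measurable_path _) (V.measurable_path _) hs]

end Step

/-! ### The dynamic programming equation along a partition. -/

section DynamicProgramming

variable {T : ℝ} {C K L M : ℝ}

lemma Partition.pt_mem (π : Partition T) (j : Fin (π.n + 1)) : π.pt j ∈ Icc 0 T :=
  ⟨π.pt_zero.symm.trans_le (π.strictMono.monotone (Fin.zero_le j)),
    (π.strictMono.monotone (Fin.le_last j)).trans_eq π.pt_last⟩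

lemma Partition.pt_lt (π : Partition T) (j : Fin π.n) : π.pt j.castSucc < π.pt j.succ :=
  π.strictMono (Fin.castSucc_lt_succ)

variable [MeasurableSpace A] [MeasurableSpace B]

/-- Bounded Lipschitz solutions of the dynamic programming equation along a partition, for the
player choosing an `A`-valued control as maximizer moving first. -/
structure IsValue (π : Partition T) (f : ℝ → E d → A → B → E d) (g : E d → ℝ) (M L K : ℝ)
    (W : ℝ → E d → ℝ) : Prop where
  terminal : ∀ x, W T x = g x
  step : ∀ j : Fin π.n, ∀ t ∈ Icc (π.pt j.castSucc) (π.pt j.succ), ∀ x,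
    IsMaxmin (stepCost T f t (π.pt j.succ) (W (π.pt j.succ)) x) (W t x)
  bdd : ∀ t ∈ Icc 0 T, ∀ x, |W t x| ≤ M
  lip : ∀ t ∈ Icc 0 T, ∀ x y, |W t x - W t y| ≤ L * Real.exp (K * (T - t)) * ‖x - y‖

variable [TopologicalSpace A] [TopologicalSpace B] [Nonempty A] [Nonempty B]
  [SecondCountableTopology A] [SecondCountableTopology B] [BorelSpace A] [BorelSpace B]
  {f : ℝ → E d → A → B → E d} {g : E d → ℝ}

/-- Backward induction over the grid. One step keeps the bound M and multiplies the Lipschitz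
constant by the exponential of K times its length, so the factors combine to exp(K (T - t)) for
every partition. -/
lemma exists_isValue (π : Partition T) (hf : IsDrift f C K) (hM : ∀ x, |g x| ≤ M) (hL0 : 0 ≤ L)
    (hL : ∀ x y, |g x - g y| ≤ L * ‖x - y‖) : ∃ W, IsValue π f g M L K W := by
  suffices h : ∀ m : Fin (π.n + 1), ∃ W : ℝ → E d → ℝ, (∀ x, W T x = g x) ∧
      (∀ j : Fin π.n, m ≤ j.castSucc → ∀ t ∈ Icc (π.pt j.castSucc) (π.pt j.succ), ∀ x,
        IsMaxmin (stepCost T f t (π.pt j.succ) (W (π.pt j.succ)) x) (W t x)) ∧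
      ∀ t ∈ Icc (π.pt m) T, (∀ x, |W t x| ≤ M) ∧
        ∀ x y, |W t x - W t y| ≤ L * Real.exp (K * (T - t)) * ‖x - y‖ by
    obtain ⟨W, h1, h2, h3⟩ := h 0
    rw [π.pt_zero] at h3
    exact ⟨W, h1, fun j => h2 j (Fin.zero_le _), fun t ht => (h3 t ht).1, fun t ht => (h3 t ht).2⟩
  intro m
  induction m using Fin.reverseInduction with
  | last =>
    refine ⟨fun _ => g, fun _ => rfl, fun j hj => ?_, fun t ht => ⟨hM, fun x y => ?_⟩⟩
    · exact absurd (hj.trans_lt (Fin.castSucc_lt_last j)) (lt_irrefl _)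
    · rw [π.pt_last] at ht
      have : t = T := le_antisymm ht.2 ht.1
      simpa [this] using hL x y
  | cast i ih =>
    obtain ⟨W, hW1, hW2, hW3⟩ := ih
    have hiT := (π.pt_mem i.succ).2
    obtain ⟨hψM, hψL⟩ := hW3 (π.pt i.succ) ⟨le_rfl, hiT⟩
    have hL'0 : 0 ≤ L * Real.exp (K * (T - π.pt i.succ)) := by positivity
    have hex : ∀ t x, ∃ w, IsMaxmin (stepCost T f t (π.pt i.succ) (W (π.pt i.succ)) x) w ∧ |w| ≤ M :=
      fun t x => exists_isMaxmin fun U V => abs_stepCost_le hψM _ _ _ _ _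
    choose w hw hwM using hex
    have hlt := π.pt_lt i
    -- The old function is kept from t_{i+1} on. At t = t_{i+1} the equation of slot i is a step of
    -- length zero, for which `stepCost_self` shows that every pair of controls gives the value.
    refine ⟨fun t => if π.pt i.succ ≤ t then W t else w t, fun x => ?_, fun j hj t ht x => ?_,
      fun t ht => ?_⟩
    · simp only [if_pos hiT, hW1]
    · have hij : i ≤ j := Fin.castSucc_le_castSucc_iff.1 hj
      have h1 : π.pt i.succ ≤ π.pt j.succ := π.strictMono.monotone (Fin.succ_le_succ_iff.2 hij)
      simp only [if_pos h1]
      split_ifs with htle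
      · rcases hij.eq_or_lt with rfl | hlt'
        · have : t = π.pt i.succ := le_antisymm ht.2 htle
          subst this
          constructor
          · exact fun ε hε => ⟨Classical.arbitrary _, fun V => by
              rw [stepCost_self hf hiT]; linarith⟩
          · exact fun ε hε U => ⟨Classical.arbitrary _, by
              rw [stepCost_self hf hiT]; linarith⟩
        · exact hW2 j (Fin.le_def.2 (Nat.succ_le_of_lt (Fin.lt_def.1 hlt'))) t ht x
      · have : i = j := by
          refine le_antisymm hij (not_lt.1 fun hlt' => htle ?_)
          exact (π.strictMono.monotone
            (Fin.le_def.2 (Nat.succ_le_of_lt (Fin.lt_def.1 hlt')))).trans ht.1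
        subst this
        exact hw t x
    · dsimp only
      split_ifs with htle
      · exact hW3 t ⟨htle, ht.2⟩
      · refine ⟨hwM t, fun x y => ?_⟩
        have ht' := (not_le.1 htle).le
        refine ((hw t x).abs_sub_le (hw t y) fun U V => abs_stepCost_sub_le hf hL'0 hψL hψM le_rfl
          ht' hiT x y U V).trans_eq ?_
        rw [sub_self, mul_zero, add_zero,
          show K * (T - t) = K * (T - π.pt i.succ) + K * (π.pt i.succ - t) by ring, Real.exp_add]
        ring

variable {π : Partition T} {W : ℝ → E d → ℝ}

omit [TopologicalSpace A] [TopologicalSpace B] [Nonempty A] [Nonempty B]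
  [SecondCountableTopology A] [SecondCountableTopology B] [BorelSpace A] [BorelSpace B] in
lemma IsValue.lip_uniform (hW : IsValue π f g M L K W) (hK : 0 ≤ K) (hL0 : 0 ≤ L) {t : ℝ}
    (ht : t ∈ Icc 0 T) (x y : E d) : |W t x - W t y| ≤ L * Real.exp (K * T) * ‖x - y‖ := by
  refine (hW.lip t ht x y).trans ?_
  gcongr
  linarith [ht.1]

omit [MeasurableSpace A] [MeasurableSpace B] [TopologicalSpace A] [TopologicalSpace B] [Nonempty A]
  [Nonempty B] [SecondCountableTopology A] [SecondCountableTopology B] [BorelSpace A]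
  [BorelSpace B] in
lemma Partition.exists_mem_Ico (π : Partition T) {t : ℝ} (ht : t ∈ Ico 0 T) :
    ∃ j : Fin π.n, t ∈ Ico (π.pt j.castSucc) (π.pt j.succ) := by
  by_contra! h
  have : ∀ m : Fin (π.n + 1), π.pt m ≤ t := fun m => by
    induction m using Fin.induction with
    | zero => rw [π.pt_zero]; exact ht.1
    | succ i ih => exact not_lt.1 fun hlt => h i ⟨ih, hlt⟩
  have h1 := this (Fin.last _)
  rw [π.pt_last] at h1
  exact absurd ht.2 (not_lt.2 h1)

omit [Nonempty A] [Nonempty B] in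
lemma IsValue.continuousOn (hW : IsValue π f g M L K W) (hf : IsDrift f C K) (hL0 : 0 ≤ L) :
    ContinuousOn (fun p : ℝ × E d => W p.1 p.2) (Icc 0 T ×ˢ univ) := by
  have hslot : ∀ j : Fin π.n, ContinuousOn (fun p : ℝ × E d => W p.1 p.2)
      (Icc (π.pt j.castSucc) (π.pt j.succ) ×ˢ univ) := by
    intro j
    set a := π.pt j.castSucc
    set b := π.pt j.succ with hb
    have hbT := π.pt_mem j.succ
    set L' := L * Real.exp (K * T) with hL'
    have hL'0 : 0 ≤ L' := by positivity
    set D := L' * ((1 + C) * Real.exp (K * (b - a))) with hD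
    have hC := hf.C_nonneg
    have hK := hf.K_nonneg
    -- Two times of one slot lead to the same end b, so the values at both are compared through the
    -- same pairs of controls.
    have key : ∀ s ∈ Icc a b, ∀ t ∈ Icc a b, s ≤ t → ∀ x y, |W s x - W t y| ≤
        D * (‖x - y‖ + (t - s)) := by
      intro s hs t ht hst x y
      refine ((hW.step j s hs x).abs_sub_le (hW.step j t ht y) fun U V =>
        abs_stepCost_sub_le hf hL'0 (fun x y => hW.lip_uniform hK hL0 hbT x y)
          (hW.bdd _ hbT) hst ht.2 hbT.2 x y U V).trans ?_
      rw [hD, mul_assoc L']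
      refine mul_le_mul_of_nonneg_left ?_ hL'0
      have h1 : ‖x - y‖ + C * (t - s) ≤ (1 + C) * (‖x - y‖ + (t - s)) := by
        nlinarith [norm_nonneg (x - y), mul_nonneg hC (norm_nonneg (x - y))]
      have h2 : Real.exp (K * (b - t)) ≤ Real.exp (K * (b - a)) := by
        gcongr; exact ht.1
      calc _ ≤ (1 + C) * (‖x - y‖ + (t - s)) * Real.exp (K * (b - a)) :=
            mul_le_mul h1 h2 (Real.exp_pos _).le
              (by have := norm_nonneg (x - y); have := sub_nonneg.2 hst; positivity)
        _ = _ := by ring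
    have hD0 : 0 ≤ D := by positivity
    refine (LipschitzOnWith.of_dist_le_mul (K := (2 * D).toNNReal) ?_).continuousOn
    rintro ⟨s, x⟩ ⟨hs, -⟩ ⟨t, y⟩ ⟨ht, -⟩
    rw [Real.coe_toNNReal _ (by positivity), Real.dist_eq, Prod.dist_eq]
    have h1 : ‖x - y‖ ≤ max (dist s t) (dist x y) := by rw [← dist_eq_norm]; exact le_max_right _ _
    have h2 : |s - t| ≤ max (dist s t) (dist x y) := le_max_left _ _
    have h3 : |W s x - W t y| ≤ D * (‖x - y‖ + |s - t|) := by
      rcases le_total s t with h | h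
      · rw [abs_sub_comm s, abs_of_nonneg (sub_nonneg.2 h)]; exact key s hs t ht h x y
      · rw [abs_of_nonneg (sub_nonneg.2 h), abs_sub_comm, norm_sub_rev]
        exact key t ht s hs h y x
    refine h3.trans ?_
    nlinarith
  -- `exists_mem_Ico` reaches only times before T; the slice at T, where W is g, completes a finite
  -- closed cover on whose pieces W is continuous.
  have hU : (Icc 0 T ×ˢ univ : Set (ℝ × E d)) ⊆ {p | p.1 = T} ∩ (Icc 0 T ×ˢ univ) ∪
      ⋃ j : Fin π.n, Icc (π.pt j.castSucc) (π.pt j.succ) ×ˢ univ := by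
    rintro ⟨t, x⟩ ⟨ht, -⟩
    rcases ht.2.eq_or_lt with h | h
    · exact Or.inl ⟨h, ht, mem_univ _⟩
    · obtain ⟨j, hj⟩ := π.exists_mem_Ico ⟨ht.1, h⟩
      exact Or.inr (mem_iUnion.2 ⟨j, ⟨hj.1, hj.2.le⟩, mem_univ _⟩)
  refine ContinuousOn.mono ?_ hU
  refine ContinuousOn.union_of_isClosed ?_ ?_ ?_ ?_
  · have hg : Continuous (W T) := by
      by_cases hT : 0 ≤ T
      · exact continuous_of_abs_sub_le (hW.lip T ⟨hT, le_rfl⟩)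
      · have := π.pt_mem 0
        exact absurd (this.1.trans this.2) hT
    refine (hg.comp continuous_snd).continuousOn.congr ?_
    rintro ⟨t, x⟩ ⟨h, -⟩
    simp only [mem_ofPred_eq] at h
    simp [h]
  · exact (locallyFinite_of_finite _).continuousOn_iUnion
      (fun j => isClosed_Icc.prod isClosed_univ) hslot
  · exact (isClosed_eq continuous_fst continuous_const).inter (isClosed_Icc.prod isClosed_univ)
  · exact isClosed_iUnion_of_finite fun j => isClosed_Icc.prod isClosed_univ

end DynamicProgramming

/-! ### The product space -/

section ProductSpace

/-- Independence of the coordinates in the form used below: replacing coordinate j by an independent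
copy does not change the law. It is enough to test this on finite boxes. -/
lemma measurePreserving_update (j : ℕ) :
    MeasurePreserving (fun q : Om × (unitInterval × unitInterval) => Function.update q.1 j q.2)
      (P.prod volume) P := by
  have hm : Measurable (fun q : Om × (unitInterval × unitInterval) => Function.update q.1 j q.2) :=
    measurable_update'
  refine ⟨hm, ?_⟩
  rw [P]
  refine Measure.eq_infinitePi _ fun s t ht => ?_
  rw [Measure.map_apply hm (MeasurableSet.pi s.countable_toSet fun _ _ => ht _)]
  have e : (fun q : Om × (unitInterval × unitInterval) => Function.update q.1 j q.2) ⁻¹'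
      (Set.pi s t) = (Set.pi (s.erase j) t) ×ˢ (if j ∈ s then t j else univ) := by
    ext ⟨ω, z⟩
    simp only [mem_preimage, Set.mem_pi, mem_prod, Finset.mem_coe, Finset.mem_erase]
    constructor
    · intro h
      refine ⟨fun i hi => by simpa [Function.update_of_ne hi.1] using h i hi.2, ?_⟩
      split_ifs with hj
      · simpa using h j hj
      · trivial
    · rintro ⟨h1, h2⟩ i hi
      by_cases hij : i = j
      · subst hij; simpa [hi] using h2
      · simpa [Function.update_of_ne hij] using h1 i ⟨hij, hi⟩
  rw [e, Measure.prod_prod, Measure.infinitePi_pi _ fun i _ => ht i]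
  split_ifs with hj
  · exact Finset.prod_erase_mul s (fun i => volume (t i)) hj
  · simp [Finset.erase_eq_of_notMem hj]

lemma Fil_le (j : ℕ) : Fil j ≤ (inferInstance : MeasurableSpace Om) :=
  iSup_le fun k => (measurable_pi_apply (k : ℕ)).comap_le

lemma Fil_mono : Monotone Fil := fun _ j h => iSup_le fun k =>
  le_iSup (fun k : Fin j => MeasurableSpace.comap (fun ω : Om => ω k) inferInstance)
    (⟨k, k.2.trans_le h⟩ : Fin j)

lemma Fil_eq_comap (j : ℕ) :
    Fil j = MeasurableSpace.comap (fun (ω : Om) (k : Fin j) => ω k) inferInstance := by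
  simp only [MeasurableSpace.pi, MeasurableSpace.comap_iSup, MeasurableSpace.comap_comp]
  rfl

/-- Two points of the product space with the same first `j` coordinates. -/
def Agree (j : ℕ) (ω ω' : Om) : Prop := ∀ k < j, ω k = ω' k

lemma Agree.mono {i j : ℕ} (h : i ≤ j) {ω ω' : Om} (hω : Agree j ω ω') : Agree i ω ω' :=
  fun k hk => hω k (hk.trans_le h)

lemma agree_update (j : ℕ) (ω : Om) (z : unitInterval × unitInterval) :
    Agree j (Function.update ω j z) ω := fun _ hk => Function.update_of_ne hk.ne _ _

lemma Agree.mem_iff {j : ℕ} {ω ω' : Om} (h : Agree j ω ω') {Γ : Set Om}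
    (hΓ : MeasurableSet[Fil j] Γ) : ω ∈ Γ ↔ ω' ∈ Γ := by
  rw [Fil_eq_comap] at hΓ
  obtain ⟨S, -, rfl⟩ := hΓ
  have : (fun k : Fin j => ω k) = fun k : Fin j => ω' k := funext fun k => h k k.2
  simp only [mem_preimage, this]

variable {β : Type*} [MeasurableSpace β]

lemma Agree.eq [MeasurableSingletonClass β] {j : ℕ} {ω ω' : Om} (h : Agree j ω ω') {F : Om → β}
    (hF : Measurable[Fil j] F) : F ω = F ω' := by
  have h1 : MeasurableSet[Fil j] (F ⁻¹' {F ω'}) := hF (measurableSet_singleton _)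
  exact (h.mem_iff h1).2 rfl

/-- Converse to `Agree.eq`: such an F factors through the truncation ρ, which is `Fil j`-measurable.
Adaptedness can therefore be proved path by path. -/
lemma measurable_Fil_of_agree {j : ℕ} {F : Om → β} (hF : Measurable F)
    (h : ∀ ω ω', Agree j ω ω' → F ω = F ω') : Measurable[Fil j] F := by
  set ρ : Om → Om := fun ω k => if k < j then ω k else (0, 0) with hρ
  have h1 : @Measurable _ _ (Fil j) _ ρ := by
    refine @measurable_pi_lambda _ _ _ (Fil j) _ _ fun k => ?_
    by_cases hk : k < j
    · simp only [hρ, if_pos hk]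
      exact Measurable.mono (comap_measurable _)
        (le_iSup (fun k : Fin j => MeasurableSpace.comap (fun ω : Om => ω k) inferInstance)
          (⟨k, hk⟩ : Fin j)) le_rfl
    · simp only [hρ, if_neg hk]
      exact @measurable_const _ _ _ (Fil j) _
  have h2 : F = F ∘ ρ := funext fun ω => h _ _ fun k hk => by simp [hρ, hk]
  rw [h2]
  exact hF.comp h1

/-- Integration over a `Fil j`-measurable set is not affected by resampling coordinate `j`. -/
lemma setIntegral_resample {j : ℕ} {h : Om → ℝ} (hh : Measurable h) {M : ℝ} (hM : ∀ ω, |h ω| ≤ M) :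
    Integrable (fun ω => ∫ z, h (Function.update ω j z)) P ∧
    ∀ Γ, MeasurableSet[Fil j] Γ →
      ∫ ω in Γ, h ω ∂P = ∫ ω in Γ, (∫ z, h (Function.update ω j z)) ∂P := by
  have hmp := measurePreserving_update j
  have hi : Integrable (fun q : Om × (unitInterval × unitInterval) =>
      h (Function.update q.1 j q.2)) (P.prod volume) :=
    (integrable_const M).mono' (hh.comp hmp.measurable).aestronglyMeasurable
      (ae_of_all _ fun _ => hM _)
  refine ⟨hi.integral_prod_left, fun Γ hΓ => ?_⟩
  have hΓ' := Fil_le j _ hΓ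
  rw [← integral_indicator hΓ', ← integral_indicator hΓ']
  have hm : Measurable (Γ.indicator h) := hh.indicator hΓ'
  have e : ∀ (ω : Om) (z : unitInterval × unitInterval), Γ.indicator h (Function.update ω j z) =
      Γ.indicator (fun ω => h (Function.update ω j z)) ω := fun ω z => by
    have hiff := (agree_update j ω z).mem_iff hΓ
    by_cases hω : ω ∈ Γ
    · rw [indicator_of_mem hω, indicator_of_mem (hiff.2 hω)]
    · rw [indicator_of_notMem hω, indicator_of_notMem fun h' => hω (hiff.1 h')]
  have hi' : Integrable (fun q : Om × (unitInterval × unitInterval) =>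
      Γ.indicator h (Function.update q.1 j q.2)) (P.prod volume) := by
    refine (integrable_const M).mono' (hm.comp hmp.measurable).aestronglyMeasurable
      (ae_of_all _ fun q => ?_)
    exact (norm_indicator_le_norm_self _ _).trans (hM _)
  calc ∫ ω, Γ.indicator h ω ∂P
      = ∫ q, Γ.indicator h (Function.update q.1 j q.2) ∂(P.prod volume) := by
        conv_lhs => rw [← hmp.map_eq]
        rw [integral_map hmp.measurable.aemeasurable hm.aestronglyMeasurable]
    _ = ∫ ω, (∫ z, Γ.indicator h (Function.update ω j z)) ∂P := integral_prod _ hi'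
    _ = _ := by
        congr 1; funext ω
        simp only [e]
        by_cases hω : ω ∈ Γ <;> simp [hω]

end ProductSpace

/-! ### Controls -/

section Admissible

/-- `p` and `q` are the two coordinates of the unit square, in some order. -/
structure IsSplit (p q : unitInterval × unitInterval → unitInterval) : Prop where
  preserving : MeasurePreserving (fun z => (p z, q z)) volume volume
  inverse : ∃ r : unitInterval × unitInterval → unitInterval × unitInterval, Measurable r ∧
    ∀ y, p (r y) = y.1 ∧ q (r y) = y.2

lemma isSplit_fst_snd : IsSplit Prod.fst Prod.snd :=
  ⟨MeasurePreserving.id _, id, measurable_id, fun _ => ⟨rfl, rfl⟩⟩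

lemma IsSplit.symm {p q : unitInterval × unitInterval → unitInterval} (h : IsSplit p q) :
    IsSplit q p := by
  refine ⟨Measure.measurePreserving_swap.comp h.preserving, ?_⟩
  obtain ⟨r, hr, hr'⟩ := h.inverse
  exact ⟨r ∘ Prod.swap, hr.comp measurable_swap, fun y => ⟨(hr' _).2, (hr' _).1⟩⟩

lemma IsSplit.measurable_left {p q : unitInterval × unitInterval → unitInterval}
    (h : IsSplit p q) : Measurable p := measurable_fst.comp h.preserving.measurable

/-- The private randomness of the player observing the coordinate `p`. -/
abbrev Pf (p : unitInterval × unitInterval → unitInterval) (j : ℕ) : MeasurableSpace Om :=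
  MeasurableSpace.comap (fun ω : Om => p (ω j)) inferInstance

variable {T : ℝ} {π : Partition T} {C : Type*} [MeasurableSpace C]
  {p q : unitInterval × unitInterval → unitInterval}

lemma measurable_path {S : Type*} [MeasurableSpace S] {u : ℝ → S → C}
    (hu : Measurable (Function.uncurry u)) (ω : S) : Measurable fun r => u r ω :=
  hu.comp (measurable_id.prodMk measurable_const)

/-- The points of a partition, numbered by all natural numbers. -/
def Partition.grid (π : Partition T) (j : ℕ) : ℝ := π.pt ⟨min j π.n, by omega⟩

lemma Partition.grid_castSucc (j : Fin π.n) : π.grid j = π.pt j.castSucc := by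
  unfold Partition.grid; congr 1; ext; simp [j.2.le]

lemma Partition.grid_succ (j : Fin π.n) : π.grid (j + 1) = π.pt j.succ := by
  unfold Partition.grid; congr 1; ext; simp [Nat.succ_le_of_lt j.2]

lemma Partition.grid_mono (π : Partition T) : Monotone π.grid := fun _ _ h =>
  π.strictMono.monotone (Fin.le_def.2 (min_le_min_right _ h))

lemma Partition.grid_zero (π : Partition T) : π.grid 0 = 0 := by
  refine Eq.trans (congrArg π.pt ?_) π.pt_zero
  ext; simp

lemma Partition.grid_n (π : Partition T) : π.grid π.n = T := by
  refine Eq.trans (congrArg π.pt ?_) π.pt_last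
  ext; simp

lemma Partition.grid_mem (π : Partition T) (j : ℕ) : π.grid j ∈ Icc 0 T := π.pt_mem _

/-- The number of the slot containing the time `s`. -/
def Partition.slot (π : Partition T) (s : ℝ) : ℕ :=
  by classical exact Nat.findGreatest (fun j => π.grid j ≤ s) π.n

lemma Partition.measurable_slot (π : Partition T) : Measurable π.slot := by
  classical
  unfold Partition.slot
  refine measurable_findGreatest fun k _ => ?_
  exact measurableSet_Ici

lemma Partition.slot_eq {j : ℕ} (hj : j < π.n) {s : ℝ} (hs : s ∈ Ico (π.grid j) (π.grid (j + 1))) :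
    π.slot s = j := by
  classical
  unfold Partition.slot
  rw [Nat.findGreatest_eq_iff]
  exact ⟨hj.le, fun _ => hs.1, fun m hm _ => not_le.2 (hs.2.trans_le (π.grid_mono hm))⟩

lemma Partition.exists_slot (π : Partition T) {s : ℝ} (hs : 0 ≤ s) {m : ℕ} (hm : m ≤ π.n)
    (hsm : s < π.grid m) : ∃ j < m, s ∈ Ico (π.grid j) (π.grid (j + 1)) := by
  induction m with
  | zero => rw [π.grid_zero] at hsm; exact absurd hs (not_le.2 hsm)
  | succ m ih =>
    by_cases h : s < π.grid m
    · obtain ⟨j, hj, hj'⟩ := ih (by omega) h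
      exact ⟨j, by omega, hj'⟩
    · exact ⟨m, by omega, not_lt.1 h, hsm⟩

/-- `u` is, on a set of times, a mixed control chosen as a `Fil j`-measurable function among
countably many. -/
def IsSlotControl (p : unitInterval × unitInterval → unitInterval) (j : ℕ) (I : Set ℝ)
    (u : ℝ → Om → C) (cell : Om → ℕ) (w : ℕ → MixedControl C) : Prop :=
  Measurable[Fil j] cell ∧ ∀ s ∈ I, ∀ ω, u s ω = (w (cell ω)).1 s (p (ω j))

lemma IsSlotControl.mono {j : ℕ} {I I' : Set ℝ} {u : ℝ → Om → C} {cell : Om → ℕ}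
    {w : ℕ → MixedControl C} (h : IsSlotControl p j I u cell w) (hI : I' ⊆ I) :
    IsSlotControl p j I' u cell w := ⟨h.1, fun s hs => h.2 s (hI hs)⟩

lemma IsSlotControl.eq_of_agree {j : ℕ} {I : Set ℝ} {u : ℝ → Om → C} {cell : Om → ℕ}
    {w : ℕ → MixedControl C} (h : IsSlotControl p j I u cell w) {s : ℝ} (hs : s ∈ I) {ω ω' : Om}
    (hω : Agree (j + 1) ω ω') : u s ω = u s ω' := by
  rw [h.2 s hs, h.2 s hs, (hω.mono j.le_succ).eq h.1, hω j j.lt_succ_self]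

lemma measurable_slotControl (hp : Measurable p) {j : ℕ} {cell : Om → ℕ} (hc : Measurable cell)
    (w : ℕ → MixedControl C) :
    Measurable fun r : ℝ × Om => (w (cell r.2)).1 r.1 (p (r.2 j)) := by
  have h1 : Measurable fun r : ℕ × (ℝ × unitInterval) => (w r.1).1 r.2.1 r.2.2 :=
    measurable_from_prod_countable_right fun k => (w k).2
  exact h1.comp ((hc.comp measurable_snd).prodMk (measurable_fst.prodMk
    (hp.comp ((measurable_pi_apply j).comp measurable_snd))))

/-- The partition of Ω becomes a `Fil j`-measurable index, and a process measurable for the private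
randomness of the slot becomes a function of time and of one number. In this form the controls of a
slot are exactly the mixed controls of the dynamic programming equation. -/
lemma isAdmissible_iff [MeasurableSingletonClass C] (hpq : IsSplit p q) {u : ℝ → Om → C} :
    IsAdmissible π (Pf p) u ↔ Measurable (Function.uncurry u) ∧
      ∀ j < π.n, ∃ cell w, IsSlotControl p j (Ico (π.grid j) (π.grid (j + 1))) u cell w := by
  refine and_congr_right fun hu => ⟨fun h j hj => ?_, fun h j => ?_⟩
  · obtain ⟨Γ, w, hΓ, hdisj, hU, hwm, hwG, hw⟩ := h ⟨j, hj⟩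
    rw [← π.grid_castSucc ⟨j, hj⟩, ← π.grid_succ ⟨j, hj⟩] at hwG hw
    obtain ⟨r, hr, hr'⟩ := hpq.inverse
    have hmem : ∀ ω, ∃ k, ω ∈ Γ k := fun ω => mem_iUnion.1 (hU ▸ mem_univ ω)
    choose cell hcell using hmem
    have hcelleq : ∀ k ω, ω ∈ Γ k → cell ω = k := fun k ω hk => by
      by_contra hne
      exact (hdisj hne).le_bot ⟨hcell ω, hk⟩
    -- Any sample point with private number y may be substituted in w k; the constant sequence with
    -- entries r (y, 0) is one that depends measurably on y.
    refine ⟨cell, fun k => ⟨fun s y => w k s fun _ => r (y, 0), ?_⟩, ?_, fun s hs ω => ?_⟩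
    · refine (hwm k).comp (measurable_fst.prodMk (measurable_pi_lambda _ fun _ => ?_))
      exact hr.comp (measurable_snd.prodMk measurable_const)
    · refine @measurable_to_countable' _ _ _ _ (Fil j) _ fun k => ?_
      convert! hΓ k using 1
      ext ω
      exact ⟨fun h' => h' ▸ hcell ω, fun h' => hcelleq k ω h'⟩
    · rw [hw (cell ω) s hs ω (hcell ω)]
      -- The level set of w through ω is a preimage under the private number, so it also contains
      -- the substituted sample point.
      have h1 : MeasurableSet[Pf p j] (w (cell ω) s ⁻¹' {w (cell ω) s ω}) :=
        hwG (cell ω) s hs (measurableSet_singleton _)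
      obtain ⟨S, -, hS⟩ := h1
      have h2 : ω ∈ (fun ω : Om => p (ω j)) ⁻¹' S := hS ▸ rfl
      have h3 : (fun _ => r (p (ω j), 0)) ∈ (fun ω : Om => p (ω j)) ⁻¹' S := by
        simpa [hr'] using h2
      rw [hS] at h3
      exact (mem_singleton_iff.1 h3).symm
  · obtain ⟨cell, w, hc, hw⟩ := h j j.2
    rw [π.grid_castSucc, π.grid_succ] at hw
    have hp := hpq.measurable_left
    refine ⟨fun k => cell ⁻¹' {k}, fun k s ω => (w k).1 s (p (ω j)),
      fun k => hc (measurableSet_singleton k), fun k l hkl => ?_, ?_, fun k => ?_, fun k s hs => ?_,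
      fun k s hs ω hω => ?_⟩
    · exact Disjoint.preimage _ (by simpa using hkl)
    · exact eq_univ_of_forall fun ω => mem_iUnion.2 ⟨cell ω, rfl⟩
    · exact (w k).2.comp (measurable_fst.prodMk
        (hp.comp ((measurable_pi_apply (j : ℕ)).comp measurable_snd)))
    · have h1 : Measurable fun y => (w k).1 s y :=
        (w k).2.comp (measurable_const.prodMk measurable_id)
      exact h1.comp (comap_measurable _)
    · rw [hw s hs ω, mem_preimage.1 hω]

lemma IsAdmissible.eq_of_agree [MeasurableSingletonClass C] (hpq : IsSplit p q) {u : ℝ → Om → C}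
    (h : IsAdmissible π (Pf p) u) {m : ℕ} (hm : m ≤ π.n) {s : ℝ} (hs0 : 0 ≤ s)
    (hs : s < π.grid m) {ω ω' : Om} (hω : Agree m ω ω') : u s ω = u s ω' := by
  obtain ⟨j, hj, hsj⟩ := π.exists_slot hs0 hm hs
  obtain ⟨cell, w, hw⟩ := ((isAdmissible_iff hpq).1 h).2 j (hj.trans_le hm)
  exact hw.eq_of_agree hsj (hω.mono hj)

/-- From time T on `π.slot` equals n, which is why the cells have to be measurable up to index n,
one more than the number of the last slot. -/
lemma isAdmissible_glue [MeasurableSingletonClass C] (hpq : IsSplit p q) {cell : ℕ → Om → ℕ}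
    (hc : ∀ j < π.n + 1, Measurable[Fil j] (cell j)) (w : ℕ → ℕ → MixedControl C) :
    IsAdmissible π (Pf p) fun s ω =>
      (w (π.slot s) (cell (π.slot s) ω)).1 s (p (ω (π.slot s))) := by
  refine (isAdmissible_iff hpq).2 ⟨?_, fun j hj => ⟨cell j, w j, hc j (by omega), fun s hs ω => ?_⟩⟩
  · have hle : ∀ s, π.slot s ≤ π.n := fun s => Nat.findGreatest_le _
    have h1 : Measurable fun r : ℕ × (ℝ × Om) =>
        (w (min r.1 π.n) (cell (min r.1 π.n) r.2.2)).1 r.2.1 (p (r.2.2 (min r.1 π.n))) := by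
      refine measurable_from_prod_countable_right fun k => ?_
      have hcm : Measurable (cell (min k π.n)) :=
        (hc _ (Nat.lt_succ_of_le (min_le_right k π.n))).mono (Fil_le _) le_rfl
      exact measurable_slotControl (j := min k π.n) hpq.measurable_left hcm (w (min k π.n))
    have h0 : Measurable fun r : ℝ × Om => (π.slot r.1, r) :=
      (π.measurable_slot.comp measurable_fst).prodMk measurable_id
    have h2 := h1.comp h0
    convert! h2 using 1
    funext ⟨s, ω⟩
    simp [min_eq_left (hle s), Function.uncurry]
  · simp only [Partition.slot_eq hj hs]

open Classical in
lemma isAdmissible_replace [MeasurableSingletonClass C] (hpq : IsSplit p q) {u : ℝ → Om → C}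
    (hu : IsAdmissible π (Pf p) u) {j : ℕ} (hj : j < π.n) {cell : Om → ℕ}
    (hc : Measurable[Fil j] cell) (w : ℕ → MixedControl C) :
    IsAdmissible π (Pf p) fun s ω => if s ∈ Ico (π.grid j) (π.grid (j + 1)) then
      (w (cell ω)).1 s (p (ω j)) else u s ω := by
  refine (isAdmissible_iff hpq).2 ⟨?_, fun k hk => ?_⟩
  · exact Measurable.ite (measurable_fst measurableSet_Ico)
      (measurable_slotControl hpq.measurable_left (hc.mono (Fil_le j) le_rfl) w) hu.1
  · by_cases hkj : k = j
    · subst hkj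
      exact ⟨cell, w, hc, fun s hs ω => if_pos hs⟩
    · obtain ⟨cell', w', hc', hw'⟩ := ((isAdmissible_iff hpq).1 hu).2 k hk
      refine ⟨cell', w', hc', fun s hs ω => ?_⟩
      have : s ∉ Ico (π.grid j) (π.grid (j + 1)) := fun h =>
        hkj ((Partition.slot_eq hk hs).symm.trans (Partition.slot_eq hj h))
      simp only [if_neg this, hw' s hs ω]

end Admissible

/-! ### One step of the game -/

section OneStep

variable [MeasurableSpace A] [MeasurableSpace B] [TopologicalSpace A] [TopologicalSpace B]
  [SecondCountableTopology A] [SecondCountableTopology B] [BorelSpace A] [BorelSpace B]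
  {f : ℝ → E d → A → B → E d} {C K T M : ℝ} (hf : IsDrift f C K)
  {p q : unitInterval × unitInterval → unitInterval}
include hf

lemma measurable_Fil_flow {t s : ℝ} (hs : s ∈ Icc t T) {m : ℕ} {Y : Om → E d}
    (hY : Measurable[Fil m] Y) {u : ℝ → Om → A} {v : ℝ → Om → B}
    (hu : Measurable (Function.uncurry u)) (hv : Measurable (Function.uncurry v))
    (h : ∀ r ∈ Ico t s, ∀ ω ω', Agree m ω ω' → u r ω = u r ω' ∧ v r ω = v r ω') :
    Measurable[Fil m] fun ω => flow T f t (Y ω) (fun r => u r ω) (fun r => v r ω) s := by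
  refine measurable_Fil_of_agree (measurable_flow hf (hY.mono (Fil_le m) le_rfl) hu hv hs)
    fun ω ω' hω => ?_
  rw [hω.eq hY]
  exact flow_congr hf (measurable_path hu _) (measurable_path hv _) (measurable_path hu _)
    (measurable_path hv _) hs.2
    (ae_of_all _ fun r hr => h r hr ω ω' hω) ⟨hs.1, le_rfl⟩

/-- Resampling coordinate j leaves the initial state and both cells unchanged, since they are `Fil
j`-measurable, and replaces the private numbers by fresh independent ones. The average over the copy
is a `stepCost` with these data frozen. -/
lemma setIntegral_flow_eq (hpq : IsSplit p q) {s₀ s₁ : ℝ} (hs : s₁ ∈ Icc s₀ T) {j : ℕ}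
    {Y : Om → E d} (hY : Measurable[Fil j] Y) {u : ℝ → Om → A} {v : ℝ → Om → B}
    (hu : Measurable (Function.uncurry u)) (hv : Measurable (Function.uncurry v))
    {cell₁ cell₂ : Om → ℕ} {w₁ : ℕ → MixedControl A} {w₂ : ℕ → MixedControl B}
    (h₁ : IsSlotControl p j (Ico s₀ s₁) u cell₁ w₁)
    (h₂ : IsSlotControl q j (Ico s₀ s₁) v cell₂ w₂) {ψ : E d → ℝ} (hψ : Continuous ψ)
    (hM : ∀ x, |ψ x| ≤ M) :
    Integrable (fun ω => stepCost T f s₀ s₁ ψ (Y ω) (w₁ (cell₁ ω)) (w₂ (cell₂ ω))) P ∧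
    ∀ Γ, MeasurableSet[Fil j] Γ →
      ∫ ω in Γ, ψ (flow T f s₀ (Y ω) (fun r => u r ω) (fun r => v r ω) s₁) ∂P =
      ∫ ω in Γ, stepCost T f s₀ s₁ ψ (Y ω) (w₁ (cell₁ ω)) (w₂ (cell₂ ω)) ∂P := by
  have key := setIntegral_resample (j := j) (M := M)
    (h := fun ω => ψ (flow T f s₀ (Y ω) (fun r => u r ω) (fun r => v r ω) s₁))
    (hψ.measurable.comp (measurable_flow hf (hY.mono (Fil_le j) le_rfl) hu hv hs))
    (fun _ => hM _)
  have e : ∀ ω, ∫ z, ψ (flow T f s₀ (Y (Function.update ω j z))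
      (fun r => u r (Function.update ω j z)) (fun r => v r (Function.update ω j z)) s₁) =
      stepCost T f s₀ s₁ ψ (Y ω) (w₁ (cell₁ ω)) (w₂ (cell₂ ω)) := by
    intro ω
    have e1 : ∀ z, flow T f s₀ (Y (Function.update ω j z))
        (fun r => u r (Function.update ω j z)) (fun r => v r (Function.update ω j z)) s₁ =
        flow T f s₀ (Y ω) (fun r => (w₁ (cell₁ ω)).1 r (p z)) (fun r => (w₂ (cell₂ ω)).1 r (q z))
          s₁ := by
      intro z
      have ha := agree_update j ω z
      rw [ha.eq hY]
      refine flow_congr hf (measurable_path hu _) (measurable_path hv _) (MixedControl.measurable_path _ _)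
        (MixedControl.measurable_path _ _) hs.2 (ae_of_all _ fun r hr => ?_) ⟨hs.1, le_rfl⟩
      rw [h₁.2 r hr, h₂.2 r hr, ha.eq h₁.1, ha.eq h₂.1]
      simp
    simp only [e1]
    unfold stepCost
    -- The controls see p z and q z, while `stepCost` is an integral over the two coordinates of z;
    -- the pair (p z, q z) has the law of z.
    conv_rhs => rw [← hpq.preserving.map_eq]
    rw [integral_map hpq.preserving.measurable.aemeasurable]
    exact (hψ.measurable.comp (measurable_flow_pair hf hs _ _ _)).aestronglyMeasurable
  simp only [e] at key
  exact key

end OneStep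

/-! ### Almost everywhere equality of controls on stochastic intervals. -/

section EqOnLemmas

variable {C : Type*} {t : ℝ} {σ σ' : Om → ℝ} {u u' u'' : ℝ → Om → C}

lemma EqOn.refl (t : ℝ) (σ : Om → ℝ) (u : ℝ → Om → C) : EqOn t σ u u :=
  ae_of_all _ fun _ _ => rfl

lemma EqOn.trans (h : EqOn t σ u u') (h' : EqOn t σ u' u'') : EqOn t σ u u'' := by
  filter_upwards [h, h'] with p hp hp' h1 using (hp h1).trans (hp' h1)

lemma EqOn.mono (h : EqOn t σ u u') (hσ : ∀ ω, σ' ω ≤ σ ω) : EqOn t σ' u u' := by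
  filter_upwards [h] with p hp h1 using hp ⟨h1.1, h1.2.trans (hσ _)⟩

/-- Fubini, after exchanging the factors: almost every path of the two controls agrees for almost
every time. -/
lemma EqOn.ae_path (h : EqOn t σ u u') :
    ∀ᵐ ω ∂P, ∀ᵐ s : ℝ, s ∈ Icc t (σ ω) → u s ω = u' s ω :=
  Measure.ae_ae_of_ae_prod
    ((Measure.measurePreserving_swap (μ := P) (ν := (volume : Measure ℝ))).quasiMeasurePreserving.ae
      (p := fun p : ℝ × Om => p.1 ∈ Icc t (σ p.2) → u p.1 p.2 = u' p.1 p.2) h)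

/-- Grid points may be disregarded; this reconciles the closed intervals of `EqOn` with the
half-open slots. -/
lemma eqOn_of_forall_ne {N : Set ℝ} (hN : N.Countable)
    (h : ∀ᵐ ω ∂P, ∀ s ∈ Icc t (σ ω), s ∉ N → u s ω = u' s ω) : EqOn t σ u u' := by
  have h1 : ∀ᵐ p ∂((volume : Measure ℝ).prod P), p.1 ∉ N :=
    Measure.quasiMeasurePreserving_fst.ae (p := fun s : ℝ => s ∉ N)
      (measure_eq_zero_iff_ae_notMem.1 (hN.measure_zero volume))
  have h2 := Measure.quasiMeasurePreserving_snd (μ := (volume : Measure ℝ)) |>.ae h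
  filter_upwards [h1, h2] with p hp1 hp2 hp3 using hp2 _ hp3 hp1

end EqOnLemmas

/-! ### Nonanticipative strategies and associated couples, for either order of the players. -/

section Strategies

variable {T : ℝ} {π : Partition T} {p q : unitInterval × unitInterval → unitInterval}

/-- Admissible controls of the player observing the coordinate `p`. -/
abbrev AdmControl (π : Partition T) (p : unitInterval × unitInterval → unitInterval) (C : Type*)
    [MeasurableSpace C] : Type _ := {u : ℝ → Om → C // IsAdmissible π (Pf p) u}

/-- Nonanticipativity with delay over `[t,T]`. -/
def IsNonanticipative [MeasurableSpace A] [MeasurableSpace B] (t : ℝ)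
    (α : AdmControl π q B → AdmControl π p A) : Prop :=
  ∀ τ : Om → Fin π.n, IsStopping τ → ∀ v v' : AdmControl π q B,
    EqOn t (fun ω => π.pt (τ ω).castSucc) v.1 v'.1 →
    EqOn t (fun ω => π.pt (τ ω).succ) (α v).1 (α v').1

/-- Constant stopping times suffice wherever nonanticipativity of a given strategy is exploited. -/
lemma IsNonanticipative.eqOn_grid [MeasurableSpace A] [MeasurableSpace B] {t : ℝ}
    {α : AdmControl π q B → AdmControl π p A} (hα : IsNonanticipative t α) {j : ℕ} (hj : j < π.n)
    {v v' : AdmControl π q B} (h : EqOn t (fun _ => π.grid j) v.1 v'.1) :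
    EqOn t (fun _ => π.grid (j + 1)) (α v).1 (α v').1 := by
  have := hα (fun _ => ⟨j, hj⟩) (fun k => MeasurableSet.const _) v v'
  rw [← π.grid_castSucc ⟨j, hj⟩, ← π.grid_succ ⟨j, hj⟩] at this
  exact this h

lemma eqOn_grid_zero {C : Type*} {t : ℝ} (ht : 0 ≤ t) (u u' : ℝ → Om → C) :
    EqOn t (fun _ => π.grid 0) u u' := by
  refine eqOn_of_forall_ne (countable_singleton 0) (ae_of_all _ fun ω s hs hne => ?_)
  rw [π.grid_zero] at hs
  exact absurd (le_antisymm hs.2 (ht.trans hs.1)) hne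

/-- Two nonanticipative strategies have an associated couple of controls. -/
lemma exists_associated [MeasurableSpace A] [MeasurableSpace B] {t : ℝ} (ht : 0 ≤ t)
    {α : AdmControl π q B → AdmControl π p A} (hα : IsNonanticipative t α)
    {β : AdmControl π p A → AdmControl π q B} (hβ : IsNonanticipative t β) (v₀ : AdmControl π q B) :
    ∃ v, EqOn t (fun _ => T) (β (α v)).1 v.1 := by
  -- Iterates of β ∘ α from an arbitrary control. Because of the delay each iteration settles one
  -- more slot, so after n of them a fixed point on [t,T] is reached.
  set w : ℕ → AdmControl π q B := fun k => (fun v => β (α v))^[k] v₀ with hw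
  have hsucc : ∀ k, w (k + 1) = β (α (w k)) := fun k => Function.iterate_succ_apply' _ _ _
  have key : ∀ k ≤ π.n, EqOn t (fun _ => π.grid k) (w (k + 1)).1 (w k).1 := by
    intro k
    induction k with
    | zero => exact fun _ => eqOn_grid_zero ht _ _
    | succ k ih =>
      intro hk
      have h1 := hα.eqOn_grid (Nat.lt_of_succ_le hk) (ih (by omega))
      have h2 := hβ.eqOn_grid (Nat.lt_of_succ_le hk)
        (h1.mono fun _ => π.grid_mono k.le_succ)
      rw [hsucc (k + 1), hsucc k]
      rw [hsucc k] at h2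
      exact h2
  refine ⟨w π.n, ?_⟩
  have := key π.n le_rfl
  rwa [hsucc, π.grid_n] at this

end Strategies

/-- Nearly optimal controls will be chosen only at the countably many centres c, so that the choice
depends measurably on the state without any measurable selection. -/
lemma exists_measurable_cell {δ : ℝ} (hδ : 0 < δ) : ∃ (cell : E d → ℕ) (c : ℕ → E d),
    Measurable cell ∧ ∀ x, ‖x - c (cell x)‖ ≤ δ := by
  classical
  have h : ∀ x : E d, ∃ k, ‖x - TopologicalSpace.denseSeq (E d) k‖ ≤ δ := fun x => by
    obtain ⟨k, hk⟩ := (TopologicalSpace.denseRange_denseSeq (E d)).exists_dist_lt x hδ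
    exact ⟨k, by rw [← dist_eq_norm]; exact hk.le⟩
  refine ⟨fun x => Nat.find (h x), TopologicalSpace.denseSeq (E d), measurable_find h fun k => ?_,
    fun x => Nat.find_spec (h x)⟩
  exact measurableSet_le (by fun_prop) measurable_const

/-! ### The minimizer's answer to a strategy. -/

section Game

variable [MeasurableSpace A] [MeasurableSpace B] [TopologicalSpace A] [TopologicalSpace B]
  [SecondCountableTopology A] [SecondCountableTopology B] [BorelSpace A] [BorelSpace B]
  [MeasurableSingletonClass A] [MeasurableSingletonClass B]
  {f : ℝ → E d → A → B → E d} {g : E d → ℝ} {C K T L M : ℝ} (hf : IsDrift f C K)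
  {p q : unitInterval × unitInterval → unitInterval} {π : Partition T} {W : ℝ → E d → ℝ}

-- The clamped times max t t_j equal t as long as t_j ≤ t and t_j afterwards. They let the
-- incomplete slot containing t be treated like the others.
omit [MeasurableSingletonClass A] [MeasurableSingletonClass B] [SecondCountableTopology A]
  [SecondCountableTopology B] [BorelSpace A] [BorelSpace B] [TopologicalSpace A]
  [TopologicalSpace B] in
lemma IsValue.step_grid (hW : IsValue π f g M L K W) {i j : ℕ} (hij : i ≤ j) (hj : j < π.n) {t : ℝ}
    (ht : t < π.grid (i + 1)) (x : E d) :
    IsMaxmin (stepCost T f (max t (π.grid j)) (max t (π.grid (j + 1)))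
      (W (max t (π.grid (j + 1)))) x) (W (max t (π.grid j)) x) := by
  have h1 : t ≤ π.grid (j + 1) := ht.le.trans (π.grid_mono (by omega))
  have := hW.step ⟨j, hj⟩ (max t (π.grid j))
  rw [← π.grid_castSucc ⟨j, hj⟩, ← π.grid_succ ⟨j, hj⟩] at this
  rw [max_eq_right h1]
  exact this ⟨le_max_right _ _, max_le h1 (π.grid_mono j.le_succ)⟩ x

lemma max_grid_mem (π : Partition T) {t : ℝ} (ht : t ∈ Icc 0 T) (j : ℕ) :
    max t (π.grid j) ∈ Icc t T := ⟨le_max_left _ _, max_le ht.2 (π.grid_mem j).2⟩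

lemma max_grid_mono (π : Partition T) (t : ℝ) (j : ℕ) :
    max t (π.grid j) ≤ max t (π.grid (j + 1)) := max_le_max_left _ (π.grid_mono j.le_succ)

lemma mem_slot_of_mem {π : Partition T} {t : ℝ} {j : ℕ} {r : ℝ}
    (hr : r ∈ Ico (max t (π.grid j)) (max t (π.grid (j + 1)))) :
    r ∈ Ico (π.grid j) (π.grid (j + 1)) := by
  refine ⟨(le_max_right _ _).trans hr.1, ?_⟩
  rcases lt_max_iff.1 hr.2 with h | h
  · exact absurd ((le_max_left _ _).trans hr.1) (not_le.2 h)
  · exact h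

/-- Summation of the one step inequalities. -/
lemma sub_le_of_steps {a : ℕ → ℝ} {i n : ℕ} {c : ℝ} (hin : i ≤ n)
    (h : ∀ j, i ≤ j → j < n → a (j + 1) ≤ a j + c) : a n ≤ a i + (n - i) * c := by
  induction n, hin using Nat.le_induction with
  | base => simp
  | succ n hn ih =>
    have h1 := ih fun j hj hjn => h j hj (by omega)
    have h2 := h n hn (by omega)
    push_cast
    linarith

include hf

omit [MeasurableSingletonClass A] [MeasurableSingletonClass B] in
lemma measurable_state {t : ℝ} (x : E d) {u : ℝ → Om → A} {v : ℝ → Om → B}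
    (hu : Measurable (Function.uncurry u)) (hv : Measurable (Function.uncurry v)) {s : ℝ}
    (hs : s ∈ Icc t T) : Measurable (state T f t x u v s) :=
  measurable_flow hf measurable_const hu hv hs

lemma measurable_Fil_state (hpq : IsSplit p q) {t : ℝ} (ht : t ∈ Icc 0 T) (x : E d)
    (u : AdmControl π p A) (v : AdmControl π q B) {m : ℕ} (hm : m ≤ π.n) :
    Measurable[Fil m] (state T f t x u.1 v.1 (max t (π.grid m))) := by
  refine measurable_Fil_flow hf (max_grid_mem π ht m) (@measurable_const _ _ _ (Fil m) _) u.2.1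
    v.2.1 fun r hr ω ω' hω => ?_
  have h0 : 0 ≤ r := ht.1.trans hr.1
  have h1 : r < π.grid m := (lt_max_iff.1 hr.2).resolve_left (not_lt.2 hr.1)
  exact ⟨u.2.eq_of_agree hpq hm h0 h1 hω, v.2.eq_of_agree hpq.symm hm h0 h1 hω⟩

omit [MeasurableSingletonClass A] [MeasurableSingletonClass B] in
lemma state_ae_eq {t : ℝ} (x : E d) {u u' : ℝ → Om → A} {v v' : ℝ → Om → B}
    (hu : Measurable (Function.uncurry u)) (hv : Measurable (Function.uncurry v))
    (hu' : Measurable (Function.uncurry u')) (hv' : Measurable (Function.uncurry v')) {s : ℝ}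
    (hs : s ∈ Icc t T) (h1 : EqOn t (fun _ => s) u u') (h2 : EqOn t (fun _ => s) v v') :
    state T f t x u v s =ᵐ[P] state T f t x u' v' s := by
  filter_upwards [h1.ae_path, h2.ae_path] with ω hω1 hω2
  refine flow_congr hf (measurable_path hu ω) (measurable_path hv ω) (measurable_path hu' ω)
    (measurable_path hv' ω) hs.2 ?_ ⟨hs.1, le_rfl⟩
  filter_upwards [hω1, hω2] with r hr1 hr2 hr
  exact ⟨hr1 (Ico_subset_Icc_self hr), hr2 (Ico_subset_Icc_self hr)⟩

variable (hW : IsValue π f g M L K W) (hL0 : 0 ≤ L)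
include hW hL0

/-- Replacing a state by a nearby one hardly changes the one step costs. -/
lemma step_discretize {s₀ s₁ : ℝ} (h0 : 0 ≤ s₀) (hs : s₀ ≤ s₁) (hT : s₁ ≤ T) {ε : ℝ} (hε : 0 < ε) :
    ∃ δ > 0, ∀ x y : E d, ‖x - y‖ ≤ δ →
      |W s₀ x - W s₀ y| ≤ ε ∧ ∀ (U : MixedControl A) (V : MixedControl B),
        |stepCost T f s₀ s₁ (W s₁) x U V - stepCost T f s₀ s₁ (W s₁) y U V| ≤ ε := by
  have hK := hf.K_nonneg
  have hs0 : s₀ ∈ Icc 0 T := ⟨h0, hs.trans hT⟩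
  have hs1 : s₁ ∈ Icc 0 T := ⟨h0.trans hs, hT⟩
  set L' := L * Real.exp (K * T) with hL'
  have hL'0 : 0 ≤ L' := by positivity
  set c := Real.exp (K * (s₁ - s₀)) with hc
  have hc1 : 1 ≤ c := Real.one_le_exp (mul_nonneg hK (sub_nonneg.2 hs))
  have hpos : 0 < L' * c + 1 := by positivity
  -- L' is the Lipschitz constant of the value and c the Gronwall factor of the slot; adding 1 keeps
  -- the denominator positive.
  refine ⟨ε / (L' * c + 1), by positivity, fun x y hxy => ?_⟩
  have h1 : (L' * c + 1) * ‖x - y‖ ≤ ε := by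
    rw [le_div_iff₀ hpos] at hxy; linarith
  have h2 := norm_nonneg (x - y)
  have h3 : L' * ‖x - y‖ ≤ L' * c * ‖x - y‖ := by
    have := mul_nonneg hL'0 h2
    nlinarith
  refine ⟨(hW.lip_uniform hK hL0 hs0 x y).trans (by linarith), fun U V => ?_⟩
  refine (abs_stepCost_sub_le hf hL'0 (hW.lip_uniform hK hL0 hs1) (hW.bdd _ hs1) le_rfl hs hT
    x y U V).trans ?_
  rw [sub_self, mul_zero, add_zero]
  linarith

lemma IsValue.continuous_of_mem {s : ℝ} (hs : s ∈ Icc 0 T) : Continuous (W s) :=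
  continuous_of_abs_sub_le (hW.lip_uniform hf.K_nonneg hL0 hs)

lemma integrable_value_comp {s : ℝ} (hs : s ∈ Icc 0 T) {Y : Om → E d} (hY : Measurable Y) :
    Integrable (fun ω => W s (Y ω)) P :=
  (integrable_const M).mono' ((hW.continuous_of_mem hf hL0 hs).measurable.comp hY).aestronglyMeasurable
    (ae_of_all _ fun _ => hW.bdd s hs _)

/-- The minimizer can respond in slot `j` to a known control of the maximizer. -/
lemma exists_slot_response (hpq : IsSplit p q) {t : ℝ} (ht : t ∈ Icc 0 T) {i j : ℕ} (hij : i ≤ j)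
    (hj : j < π.n) (hti : t < π.grid (i + 1)) (x : E d) (u : AdmControl π p A)
    (v : AdmControl π q B) {ε : ℝ} (hε : 0 < ε) :
    ∃ v' : AdmControl π q B, (∀ s < π.grid j, ∀ ω, v'.1 s ω = v.1 s ω) ∧
      ∀ Γ, MeasurableSet[Fil j] Γ →
        ∫ ω in Γ, W (max t (π.grid (j + 1))) (state T f t x u.1 v'.1 (max t (π.grid (j + 1))) ω) ∂P ≤
        ∫ ω in Γ, W (max t (π.grid j)) (state T f t x u.1 v.1 (max t (π.grid j)) ω) ∂P +
          ε * P.real Γ := by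
  classical
  set s₀ := max t (π.grid j) with hs₀
  set s₁ := max t (π.grid (j + 1)) with hs₁
  have hs0 : s₀ ∈ Icc t T := max_grid_mem π ht j
  have hs1 : s₁ ∈ Icc t T := max_grid_mem π ht (j + 1)
  have h01 : s₀ ≤ s₁ := max_grid_mono π t j
  have hs0' : s₀ ∈ Icc 0 T := ⟨ht.1.trans hs0.1, hs0.2⟩
  have hs1' : s₁ ∈ Icc 0 T := ⟨ht.1.trans hs1.1, hs1.2⟩
  obtain ⟨cell₁, w₁, hw₁⟩ := ((isAdmissible_iff hpq).1 u.2).2 j hj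
  -- Three errors of ε / 3: moving the value to the centre of the cell, moving the step cost there,
  -- and the optimality gap at the centre.
  obtain ⟨δ, hδ, hdisc⟩ := step_discretize hf hW hL0 hs0'.1 h01 hs1.2 (ε := ε / 3) (by positivity)
  obtain ⟨cellE, c, hcm, hc⟩ := exists_measurable_cell (d := d) hδ
  have hstep : ∀ k l, ∃ V : MixedControl B,
      stepCost T f s₀ s₁ (W s₁) (c l) (w₁ k) V ≤ W s₀ (c l) + ε / 3 := fun k l =>
    (hW.step_grid hij hj hti (c l)).2 (ε / 3) (by positivity) (w₁ k)
  choose V hV using hstep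
  set Y : Om → E d := state T f t x u.1 v.1 s₀ with hY
  have hYm : Measurable[Fil j] Y := measurable_Fil_state hf hpq ht x u v hj.le
  -- The reply depends on which mixed control the maximizer uses and on the cell of the state. Both
  -- are `Fil j`-measurable, whereas the maximizer's private number stays hidden.
  set cell₂ : Om → ℕ := fun ω => Nat.pair (cell₁ ω) (cellE (Y ω)) with hcell₂
  have hcell₂m : Measurable[Fil j] cell₂ := by
    have h1 : Measurable fun k : ℕ × ℕ => Nat.pair k.1 k.2 := measurable_of_countable _
    exact h1.comp (Measurable.prodMk hw₁.1 (hcm.comp hYm))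
  set w₂ : ℕ → MixedControl B := fun m => V m.unpair.1 m.unpair.2 with hw₂
  refine ⟨⟨_, isAdmissible_replace hpq.symm v.2 hj hcell₂m w₂⟩, fun s hs ω => ?_, fun Γ hΓ => ?_⟩
  · exact if_neg fun h => absurd h.1 (not_le.2 hs)
  set v' : AdmControl π q B := ⟨_, isAdmissible_replace hpq.symm v.2 hj hcell₂m w₂⟩ with hv'
  have hsub : Ico s₀ s₁ ⊆ Ico (π.grid j) (π.grid (j + 1)) := fun r hr => mem_slot_of_mem hr
  have hslot₂ : IsSlotControl q j (Ico s₀ s₁) v'.1 cell₂ w₂ :=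
    ⟨hcell₂m, fun s hs ω => if_pos (hsub hs)⟩
  have hstate : ∀ ω, state T f t x u.1 v'.1 s₁ ω =
      flow T f s₀ (Y ω) (fun r => u.1 r ω) (fun r => v'.1 r ω) s₁ := fun ω => by
    have e1 : Y ω = flow T f t x (fun r => u.1 r ω) (fun r => v'.1 r ω) s₀ := by
      refine flow_congr hf (measurable_path u.2.1 ω) (measurable_path v.2.1 ω)
        (measurable_path u.2.1 ω) (measurable_path v'.2.1 ω) hs0.2
        (ae_of_all _ fun r hr => ⟨rfl, ?_⟩) ⟨hs0.1, le_rfl⟩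
      have h1 : r < π.grid j := (lt_max_iff.1 hr.2).resolve_left (not_lt.2 hr.1)
      exact (if_neg fun h => absurd h.1 (not_le.2 h1)).symm
    rw [e1, flow_flow hf (measurable_path u.2.1 ω) (measurable_path v'.2.1 ω) hs0.1 h01 hs1.2]
    rfl
  obtain ⟨hint, heq⟩ := setIntegral_flow_eq hf hpq ⟨h01, hs1.2⟩ hYm u.2.1 v'.2.1 (hw₁.mono hsub)
    hslot₂ (hW.continuous_of_mem hf hL0 hs1') (hW.bdd s₁ hs1')
  simp only [hstate]
  rw [heq Γ hΓ]
  have hYi := integrable_value_comp hf hW hL0 hs0' (hYm.mono (Fil_le j) le_rfl)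
  have hle : ∀ ω, stepCost T f s₀ s₁ (W s₁) (Y ω) (w₁ (cell₁ ω)) (w₂ (cell₂ ω)) ≤
      W s₀ (Y ω) + ε := fun ω => by
    obtain ⟨h1, h2⟩ := hdisc (Y ω) (c (cellE (Y ω))) (hc _)
    have h3 := hV (cell₁ ω) (cellE (Y ω))
    have h4 : w₂ (cell₂ ω) = V (cell₁ ω) (cellE (Y ω)) := by simp [hw₂, hcell₂]
    rw [h4]
    have h5 := (abs_le.1 (h2 (w₁ (cell₁ ω)) (V (cell₁ ω) (cellE (Y ω))))).2
    linarith [(abs_le.1 h1).1]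
  refine (setIntegral_mono hint.integrableOn (hYi.add (integrable_const ε)).integrableOn
    hle).trans_eq ?_
  simp only [Pi.add_apply]
  rw [integral_add hYi.integrableOn (integrable_const ε), setIntegral_const,
    smul_eq_mul, mul_comm]

/-- Against a known strategy of the maximizer, the minimizer has an almost optimal control. -/
lemma exists_response (hpq : IsSplit p q) [Nonempty B] {t : ℝ} {i : ℕ} (hi : i < π.n)
    (ht : t ∈ Ico (π.grid i) (π.grid (i + 1))) (x : E d)
    {α : AdmControl π q B → AdmControl π p A} (hα : IsNonanticipative t α) {ε : ℝ} (hε : 0 < ε) :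
    ∃ v : AdmControl π q B, ∀ Γ, MeasurableSet[Fil i] Γ →
      ∫ ω in Γ, g (state T f t x (α v).1 v.1 T ω) ∂P ≤ (W t x + ε) * P.real Γ := by
  have ht' : t ∈ Icc 0 T := ⟨(π.grid_mem i).1.trans ht.1, ht.2.le.trans (π.grid_mem _).2⟩
  have hn : (0 : ℝ) < π.n := by exact_mod_cast (Nat.zero_le i).trans_lt hi
  set c := ε / π.n with hc
  have hc0 : 0 < c := by positivity
  have key : ∀ j, i ≤ j → j ≤ π.n → ∃ v : AdmControl π q B, ∀ Γ, MeasurableSet[Fil i] Γ →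
      ∫ ω in Γ, W (max t (π.grid j)) (state T f t x (α v).1 v.1 (max t (π.grid j)) ω) ∂P ≤
        (W t x + (j - i) * c) * P.real Γ := by
    intro j hij
    induction j, hij using Nat.le_induction with
    | base =>
      intro _
      obtain ⟨a⟩ : Nonempty (AdmControl π q B) := by
        refine ⟨⟨fun _ _ => Classical.arbitrary B, (isAdmissible_iff hpq.symm).2
          ⟨measurable_const, fun j _ => ⟨fun _ => 0, fun _ => ⟨fun _ _ => Classical.arbitrary B,
            measurable_const⟩, ?_, fun _ _ _ => rfl⟩⟩⟩⟩
        exact @measurable_const _ _ _ (Fil j) _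
      refine ⟨a, fun Γ hΓ => le_of_eq ?_⟩
      have e : ∀ ω, state T f t x (α a).1 a.1 t ω = x := fun ω =>
        flow_self hf (measurable_path (α a).2.1 ω) (measurable_path a.2.1 ω) ht'.2
      rw [max_eq_left ht.1]
      simp only [e]
      rw [setIntegral_const, smul_eq_mul]
      ring
    | succ j hij ih =>
      intro hj
      obtain ⟨v, hv⟩ := ih (by omega)
      have hjn : j < π.n := by omega
      obtain ⟨v', hv', hstep⟩ := exists_slot_response hf hW hL0 hpq ht' hij hjn ht.2 x (α v) v hc0
      -- Here the delay is used: v' differs from v only after t_j, so α(v') = α(v) up to t_{j+1}.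
      -- The reply computed against α(v) is thus a reply to α(v') in this slot.
      have hE : EqOn t (fun _ => π.grid j) v'.1 v.1 := by
        refine eqOn_of_forall_ne (countable_singleton (π.grid j))
          (ae_of_all _ fun ω s hs hne => hv' s (lt_of_le_of_ne hs.2 hne) ω)
      have hαE := hα.eqOn_grid hjn hE
      refine ⟨v', fun Γ hΓ => ?_⟩
      have hmax : max t (π.grid (j + 1)) = π.grid (j + 1) :=
        max_eq_right (ht.2.le.trans (π.grid_mono (by omega)))
      have hst : state T f t x (α v').1 v'.1 (max t (π.grid (j + 1))) =ᵐ[P]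
          state T f t x (α v).1 v'.1 (max t (π.grid (j + 1))) := by
        refine state_ae_eq hf x (α v').2.1 v'.2.1 (α v).2.1 v'.2.1 (max_grid_mem π ht' _) ?_
          (EqOn.refl _ _ _)
        rw [hmax]
        exact hαE
      calc ∫ ω in Γ, W (max t (π.grid (j + 1)))
            (state T f t x (α v').1 v'.1 (max t (π.grid (j + 1))) ω) ∂P
          = ∫ ω in Γ, W (max t (π.grid (j + 1)))
            (state T f t x (α v).1 v'.1 (max t (π.grid (j + 1))) ω) ∂P := by
            refine integral_congr_ae (ae_restrict_of_ae ?_)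
            filter_upwards [hst] with ω hω
            rw [hω]
        _ ≤ (W t x + (j - i) * c) * P.real Γ + c * P.real Γ :=
            (hstep Γ (Fil_mono hij _ hΓ)).trans (add_le_add_left (hv Γ hΓ) _)
        _ = _ := by push_cast; ring
  obtain ⟨v, hv⟩ := key π.n hi.le le_rfl
  refine ⟨v, fun Γ hΓ => ?_⟩
  have h1 := hv Γ hΓ
  rw [π.grid_n, max_eq_right ht'.2] at h1
  simp only [hW.terminal] at h1
  refine h1.trans (mul_le_mul_of_nonneg_right ?_ measureReal_nonneg)
  have : (π.n : ℝ) * c = ε := by rw [hc]; field_simp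
  have : 0 ≤ (i : ℝ) * c := by positivity
  linarith

end Game

/-! ### The maximizer's nearly optimal feedback strategy. -/

section Feedback

variable [MeasurableSpace A] [MeasurableSpace B] {T : ℝ}

/-- The states at the points of the partition when one player uses, in each slot, a mixed control
depending on the cell containing the state at its beginning. -/
def feedbackState (π : Partition T) (p : unitInterval × unitInterval → unitInterval)
    (f : ℝ → E d → A → B → E d) (t : ℝ) (x : E d) (cell : ℕ → E d → ℕ)
    (sel : ℕ → ℕ → MixedControl A) (v : ℝ → Om → B) : ℕ → Om → E d
  | 0 => fun _ => x
  | j + 1 => fun ω =>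
    flow T f (max t (π.grid j)) (feedbackState π p f t x cell sel v j ω)
      (fun r => (sel j (cell j (feedbackState π p f t x cell sel v j ω))).1 r (p (ω j)))
      (fun r => v r ω) (max t (π.grid (j + 1)))

lemma feedbackState_succ (π : Partition T) (p : unitInterval × unitInterval → unitInterval)
    (f : ℝ → E d → A → B → E d) (t : ℝ) (x : E d) (cell : ℕ → E d → ℕ)
    (sel : ℕ → ℕ → MixedControl A) (v : ℝ → Om → B) (j : ℕ) (ω : Om) :
    feedbackState π p f t x cell sel v (j + 1) ω =
    flow T f (max t (π.grid j)) (feedbackState π p f t x cell sel v j ω)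
      (fun r => (sel j (cell j (feedbackState π p f t x cell sel v j ω))).1 r (p (ω j)))
      (fun r => v r ω) (max t (π.grid (j + 1))) := rfl

variable [TopologicalSpace A] [TopologicalSpace B]
  [SecondCountableTopology A] [SecondCountableTopology B] [BorelSpace A] [BorelSpace B]
  [MeasurableSingletonClass A] [MeasurableSingletonClass B]
  {f : ℝ → E d → A → B → E d} {g : E d → ℝ} {C K L M : ℝ} (hf : IsDrift f C K)
  {p q : unitInterval × unitInterval → unitInterval} {π : Partition T} {W : ℝ → E d → ℝ}
  {cell : ℕ → E d → ℕ} {sel : ℕ → ℕ → MixedControl A}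
include hf

lemma measurable_feedbackState (hpq : IsSplit p q) {t : ℝ} (ht : t ∈ Icc 0 T) (x : E d)
    (hcell : ∀ j, Measurable (cell j)) (v : AdmControl π q B) :
    ∀ j ≤ π.n, Measurable[Fil j] (feedbackState π p f t x cell sel v.1 j) := by
  intro j
  induction j with
  | zero => exact fun _ => @measurable_const _ _ _ (Fil 0) _
  | succ j ih =>
    intro hj
    have hY := ih (by omega)
    have hc := (hcell j).comp hY
    refine measurable_Fil_flow hf ⟨max_grid_mono π t j, (max_grid_mem π ht (j + 1)).2⟩
      (hY.mono (Fil_mono j.le_succ) le_rfl)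
      (measurable_slotControl hpq.measurable_left (hc.mono (Fil_le j) le_rfl) (sel j)) v.2.1
      fun r hr ω ω' hω => ⟨?_, ?_⟩
    · have h1 := (hω.mono j.le_succ).eq hc
      simp only [Function.comp_apply] at h1
      simp only [h1, hω j j.lt_succ_self]
    · exact v.2.eq_of_agree hpq.symm hj (ht.1.trans ((le_max_left _ _).trans hr.1))
        (mem_slot_of_mem hr).2 hω

/-- The strategy playing in each slot the mixed control chosen by the current state. -/
def feedback (hpq : IsSplit p q) {t : ℝ} (ht : t ∈ Icc 0 T) (x : E d)
    (hcell : ∀ j, Measurable (cell j)) (sel : ℕ → ℕ → MixedControl A) (v : AdmControl π q B) :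
    AdmControl π p A :=
  ⟨fun s ω => (sel (π.slot s) (cell (π.slot s)
      (feedbackState π p f t x cell sel v.1 (π.slot s) ω))).1 s (p (ω (π.slot s))),
    isAdmissible_glue hpq (cell := fun j ω => cell j (feedbackState π p f t x cell sel v.1 j ω))
      (fun j hj => (hcell j).comp (measurable_feedbackState hf hpq ht x hcell v j (by omega))) sel⟩

/-- `feedbackState` solves each slot separately, so that it can be computed from v before the
control is defined; by the flow property it is the true state under the resulting control. -/
lemma state_feedback (hpq : IsSplit p q) {t : ℝ} (ht : t ∈ Icc 0 T) (x : E d)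
    (hcell : ∀ j, Measurable (cell j)) (v : AdmControl π q B) (ω : Om) :
    ∀ j ≤ π.n, state T f t x (feedback hf hpq ht x hcell sel v).1 v.1 (max t (π.grid j)) ω =
      feedbackState π p f t x cell sel v.1 j ω := by
  set u := feedback hf hpq ht x hcell sel v with hu
  have hum := measurable_path u.2.1 ω
  have hvm := measurable_path v.2.1 ω
  intro j
  induction j with
  | zero =>
    intro _
    rw [π.grid_zero, max_eq_left ht.1]
    exact flow_self hf hum hvm ht.2
  | succ j ih =>
    intro hj
    have h0 := max_grid_mem π ht j
    have h1 := max_grid_mem π ht (j + 1)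
    have h01 := max_grid_mono π t j
    have hj' := ih (by omega)
    rw [state_eq_flow] at hj' ⊢
    rw [← flow_flow hf hum hvm h0.1 h01 h1.2, hj', feedbackState_succ]
    refine flow_congr hf hum hvm (MixedControl.measurable_path _ _) hvm h1.2
      (ae_of_all _ fun r hr => ⟨?_, rfl⟩) ⟨h01, le_rfl⟩
    have hslot := Partition.slot_eq (Nat.lt_of_succ_le hj) (mem_slot_of_mem hr)
    simp only [hu, feedback, hslot]

/-- The argument is pathwise, hence covers all stopping times: the state at the beginning of slot
τ(ω) involves v only before that instant, and with the private number it determines the control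
during the slot. -/
lemma isNonanticipative_feedback (hpq : IsSplit p q) {t : ℝ} (ht : t ∈ Icc 0 T) (x : E d)
    (hcell : ∀ j, Measurable (cell j)) :
    IsNonanticipative (π := π) t (feedback hf hpq ht x hcell sel) := by
  intro τ _ v v' hvv
  have hτ : ∀ ω, π.pt (τ ω).castSucc = π.grid (τ ω) := fun ω => (π.grid_castSucc _).symm
  have hτ' : ∀ ω, π.pt (τ ω).succ = π.grid (τ ω + 1) := fun ω => (π.grid_succ _).symm
  simp only [hτ, hτ'] at hvv ⊢
  refine eqOn_of_forall_ne (N := range π.grid) (countable_range _) ?_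
  filter_upwards [hvv.ae_path] with ω hω s hs hsN
  have hY : ∀ j ≤ (τ ω : ℕ), feedbackState π p f t x cell sel v.1 j ω =
      feedbackState π p f t x cell sel v'.1 j ω := by
    intro j
    induction j with
    | zero => exact fun _ => rfl
    | succ j ih =>
      intro hj
      rw [feedbackState_succ, feedbackState_succ, ih (by omega)]
      have h1 := max_grid_mem π ht (j + 1)
      refine flow_congr hf (MixedControl.measurable_path _ _) (measurable_path v.2.1 ω)
        (MixedControl.measurable_path _ _) (measurable_path v'.2.1 ω) h1.2 ?_
        ⟨max_grid_mono π t j, le_rfl⟩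
      filter_upwards [hω] with r hr hr1
      refine ⟨rfl, hr ⟨(le_max_left _ _).trans hr1.1, ?_⟩⟩
      exact (mem_slot_of_mem hr1).2.le.trans (π.grid_mono hj)
  -- Without the grid points s lies strictly before t_{τ+1}, hence in a slot of number at most τ.
  have hslt : s < π.grid (τ ω + 1) := lt_of_le_of_ne hs.2 fun h => hsN ⟨_, h.symm⟩
  obtain ⟨j, hj, hsj⟩ := π.exists_slot (ht.1.trans hs.1) (m := τ ω + 1)
    (Nat.succ_le_of_lt (τ ω).2) hslt
  have hslot := Partition.slot_eq (lt_of_lt_of_le hj (Nat.succ_le_of_lt (τ ω).2)) hsj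
  simp only [feedback, hslot, hY j (Nat.lt_succ_iff.1 hj)]

variable (hW : IsValue π f g M L K W) (hL0 : 0 ≤ L)
include hW hL0

/-- The maximizer has an almost optimal strategy. -/
lemma exists_optimal_strategy (hpq : IsSplit p q) [Nonempty A] {t : ℝ} {i : ℕ}
    (hi : i < π.n) (ht : t ∈ Ico (π.grid i) (π.grid (i + 1))) (x : E d) {ε : ℝ} (hε : 0 < ε) :
    ∃ α : AdmControl π q B → AdmControl π p A, IsNonanticipative t α ∧
      ∀ v : AdmControl π q B, ∀ Γ, MeasurableSet[Fil i] Γ →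
        (W t x - ε) * P.real Γ ≤ ∫ ω in Γ, g (state T f t x (α v).1 v.1 T ω) ∂P := by
  have ht' : t ∈ Icc 0 T := ⟨(π.grid_mem i).1.trans ht.1, ht.2.le.trans (π.grid_mem _).2⟩
  have hn : (0 : ℝ) < π.n := by exact_mod_cast (Nat.zero_le i).trans_lt hi
  set c := ε / π.n with hc
  have hc0 : 0 < c := by positivity
  set σ : ℕ → ℝ := fun j => max t (π.grid j) with hσ
  have hσmem : ∀ j, σ j ∈ Icc 0 T := fun j =>
    ⟨ht'.1.trans (max_grid_mem π ht' j).1, (max_grid_mem π ht' j).2⟩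
  have hσmono : ∀ j, σ j ≤ σ (j + 1) := max_grid_mono π t
  -- One mixed control per cell, chosen at its centre, is c-optimal at all points of the cell. Slots
  -- outside the range from i to n - 1 receive arbitrary data.
  have hex : ∀ j, ∃ (cell : E d → ℕ) (sel : ℕ → MixedControl A), Measurable cell ∧
      (i ≤ j → j < π.n → ∀ x V, W (σ j) x - c ≤
        stepCost T f (σ j) (σ (j + 1)) (W (σ (j + 1))) x (sel (cell x)) V) := by
    intro j
    by_cases hj : i ≤ j ∧ j < π.n
    · obtain ⟨δ, hδ, hdisc⟩ := step_discretize hf hW hL0 (hσmem j).1 (hσmono j) (hσmem (j + 1)).2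
        (ε := c / 3) (by positivity)
      obtain ⟨cell, z, hcm, hcell⟩ := exists_measurable_cell (d := d) hδ
      have hstep : ∀ l, ∃ U : MixedControl A, ∀ V, W (σ j) (z l) - c / 3 ≤
          stepCost T f (σ j) (σ (j + 1)) (W (σ (j + 1))) (z l) U V := fun l =>
        (hW.step_grid hj.1 hj.2 ht.2 (z l)).1 (c / 3) (by positivity)
      choose U hU using hstep
      refine ⟨cell, U, hcm, fun _ _ y V => ?_⟩
      obtain ⟨h1, h2⟩ := hdisc y (z (cell y)) (hcell y)
      linarith [hU (cell y) V, (abs_le.1 h1).2, (abs_le.1 (h2 (U (cell y)) V)).1]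
    · exact ⟨fun _ => 0, fun _ => Classical.arbitrary _, measurable_const,
        fun h1 h2 => absurd ⟨h1, h2⟩ hj⟩
  choose cell sel hcm hsel using hex
  refine ⟨feedback hf hpq ht' x hcm sel, isNonanticipative_feedback hf hpq ht' x hcm,
    fun v Γ hΓ => ?_⟩
  set u := feedback hf hpq ht' x hcm sel v with hu
  set Y := feedbackState π p f t x cell sel v.1 with hY
  have hYm : ∀ j ≤ π.n, Measurable[Fil j] (Y j) := measurable_feedbackState hf hpq ht' x hcm v
  have hst : ∀ j ≤ π.n, ∀ ω, state T f t x u.1 v.1 (σ j) ω = Y j ω := fun j hj ω =>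
    state_feedback hf hpq ht' x hcm v ω j hj
  -- The signs are reversed because `sub_le_of_steps` sums upper bounds on increments.
  have hstep : ∀ j, i ≤ j → j < π.n → -∫ ω in Γ, W (σ (j + 1)) (Y (j + 1) ω) ∂P ≤
      -∫ ω in Γ, W (σ j) (Y j ω) ∂P + c * P.real Γ := by
    intro j hij hj
    obtain ⟨cell₂, w₂, hw₂⟩ := ((isAdmissible_iff hpq.symm).1 v.2).2 j hj
    have hsub : Ico (σ j) (σ (j + 1)) ⊆ Ico (π.grid j) (π.grid (j + 1)) :=
      fun r hr => mem_slot_of_mem hr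
    have hYj := hYm j hj.le
    have hw₁ : IsSlotControl p j (Ico (σ j) (σ (j + 1)))
        (fun r ω => (sel j (cell j (Y j ω))).1 r (p (ω j))) (fun ω => cell j (Y j ω)) (sel j) :=
      ⟨(hcm j).comp hYj, fun _ _ _ => rfl⟩
    have hum : Measurable (Function.uncurry fun r (ω : Om) =>
        (sel j (cell j (Y j ω))).1 r (p (ω j))) :=
      measurable_slotControl (j := j) hpq.measurable_left
        (((hcm j).comp hYj).mono (Fil_le j) le_rfl) (sel j)
    obtain ⟨hint, heq⟩ := setIntegral_flow_eq hf hpq ⟨hσmono j, (hσmem (j + 1)).2⟩ hYj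
      hum v.2.1 hw₁
      (hw₂.mono hsub) (hW.continuous_of_mem hf hL0 (hσmem (j + 1))) (hW.bdd _ (hσmem (j + 1)))
    have e : ∫ ω in Γ, W (σ (j + 1)) (Y (j + 1) ω) ∂P = _ := heq Γ (Fil_mono hij _ hΓ)
    rw [e]
    have hYi := integrable_value_comp hf hW hL0 (hσmem j) (hYj.mono (Fil_le j) le_rfl)
    have h2 := setIntegral_mono (s := Γ) (hYi.sub (integrable_const c)).integrableOn
      hint.integrableOn fun ω => hsel j hij hj (Y j ω) (w₂ (cell₂ ω))
    simp only [Pi.sub_apply] at h2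
    rw [integral_sub hYi.integrableOn (integrable_const c), setIntegral_const, smul_eq_mul,
      mul_comm] at h2
    linarith
  have htot := sub_le_of_steps (a := fun j => -∫ ω in Γ, W (σ j) (Y j ω) ∂P) hi.le hstep
  have e0 : ∀ ω, Y i ω = x := fun ω => by
    rw [← hst i hi.le]
    have : σ i = t := max_eq_left ht.1
    rw [this]
    exact flow_self hf (measurable_path u.2.1 ω) (measurable_path v.2.1 ω) ht'.2
  have e1 : σ π.n = T := by simp only [hσ]; rw [π.grid_n, max_eq_right ht'.2]
  have e2 : σ i = t := max_eq_left ht.1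
  have e3 : ∀ ω, g (state T f t x u.1 v.1 T ω) = W (σ π.n) (Y π.n ω) := fun ω => by
    rw [← hst _ le_rfl, e1, hW.terminal]
  simp only [e3]
  simp only [e0, e2, setIntegral_const, smul_eq_mul] at htot
  have h5 : (π.n - i : ℝ) * (c * P.real Γ) ≤ ε * P.real Γ := by
    rw [← mul_assoc]
    refine mul_le_mul_of_nonneg_right ?_ measureReal_nonneg
    have : (π.n : ℝ) * c = ε := by rw [hc]; field_simp
    have : 0 ≤ (i : ℝ) * c := by positivity
    linarith
  linarith

end Feedback

/-! ### Essential suprema and infima -/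

section EssInf

variable {ι : Type*}

/-- The essential infimum is the infimum over a countable subfamily whose integral is the smallest
possible. Including one more member cannot lower the integral, so that member already lies above it
almost surely. -/
lemma exists_ae_glb [Nonempty ι] {φ : ι → Om → ℝ} {M : ℝ} (hm : ∀ i, Measurable (φ i))
    (hM : ∀ i ω, |φ i ω| ≤ M) : ∃ Y : Om → ℝ, Measurable Y ∧ (∀ i, Y ≤ᵐ[P] φ i) ∧
      ∀ Z : Om → ℝ, (∀ i, Z ≤ᵐ[P] φ i) → Z ≤ᵐ[P] Y := by
  set I : (ℕ → ι) → Om → ℝ := fun s ω => ⨅ n, φ (s n) ω with hI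
  have hbd : ∀ (s : ℕ → ι) ω, BddBelow (range fun n => φ (s n) ω) := fun s ω =>
    ⟨-M, by rintro _ ⟨n, rfl⟩; exact (abs_le.1 (hM _ _)).1⟩
  have hIm : ∀ s, Measurable (I s) := fun s => Measurable.iInf fun n => hm (s n)
  have hIM : ∀ s ω, |I s ω| ≤ M := fun s ω => abs_le.2
    ⟨le_ciInf fun n => (abs_le.1 (hM _ _)).1, (ciInf_le (hbd s ω) 0).trans (abs_le.1 (hM _ _)).2⟩
  have hIi : ∀ s, Integrable (I s) P := fun s =>
    (integrable_const M).mono' (hIm s).aestronglyMeasurable (ae_of_all _ fun ω => hIM s ω)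
  have hIb : BddBelow (range fun s => ∫ ω, I s ω ∂P) := ⟨-M, by
    rintro _ ⟨s, rfl⟩
    have := integral_mono (integrable_const (-M)) (hIi s) fun ω => (abs_le.1 (hIM s ω)).1
    simpa using this⟩
  have hex : ∀ k : ℕ, ∃ s : ℕ → ι, ∫ ω, I s ω ∂P < (⨅ s, ∫ ω, I s ω ∂P) + 1 / (k + 1 : ℝ) :=
    fun k => exists_lt_of_ciInf_lt (lt_add_of_pos_right _ Nat.one_div_pos_of_nat)
  choose s hs using hex
  -- All the minimizing subfamilies are merged in one sequence, whose infimum lies below each of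
  -- theirs.
  set r : ℕ → ι := fun n => s n.unpair.1 n.unpair.2 with hr
  have hrle : ∀ k ω, I r ω ≤ I (s k) ω := fun k ω => le_ciInf fun n => by
    have := ciInf_le (hbd r ω) (Nat.pair k n)
    simpa [hr] using this
  have hrmin : ∫ ω, I r ω ∂P ≤ ⨅ s, ∫ ω, I s ω ∂P := by
    refine le_of_forall_pos_le_add fun ε hε => ?_
    obtain ⟨k, hk⟩ := exists_nat_one_div_lt hε
    exact ((integral_mono (hIi r) (hIi (s k)) (hrle k)).trans (hs k).le).trans (by linarith)
  refine ⟨I r, hIm r, fun i => ?_, fun Z hZ => ?_⟩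
  · set r' : ℕ → ι := fun n => Nat.casesOn n i r with hr'
    have h1 : ∀ ω, I r' ω ≤ I r ω := fun ω => le_ciInf fun n => ciInf_le (hbd r' ω) (n + 1)
    have h2 : ∀ ω, I r' ω ≤ φ i ω := fun ω => ciInf_le (hbd r' ω) 0
    have h3 : ∫ ω, I r ω ∂P ≤ ∫ ω, I r' ω ∂P := hrmin.trans (ciInf_le hIb r')
    have h4 : ∫ ω, (I r ω - I r' ω) ∂P = 0 := by
      refine le_antisymm ?_ (integral_nonneg fun ω => sub_nonneg.2 (h1 ω))
      rw [integral_sub (hIi r) (hIi r')]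
      linarith
    rw [integral_eq_zero_iff_of_nonneg (fun ω => sub_nonneg.2 (h1 ω)) ((hIi r).sub (hIi r'))] at h4
    filter_upwards [h4] with ω hω
    have : I r ω - I r' ω = 0 := hω
    linarith [h2 ω]
  · filter_upwards [ae_all_iff.2 fun n => hZ (r n)] with ω hω
    exact le_ciInf hω

lemma exists_ae_lub [Nonempty ι] {φ : ι → Om → ℝ} {M : ℝ} (hm : ∀ i, Measurable (φ i))
    (hM : ∀ i ω, |φ i ω| ≤ M) : ∃ Y : Om → ℝ, Measurable Y ∧ (∀ i, φ i ≤ᵐ[P] Y) ∧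
      ∀ Z : Om → ℝ, (∀ i, φ i ≤ᵐ[P] Z) → Y ≤ᵐ[P] Z := by
  obtain ⟨Y, hY, h1, h2⟩ := exists_ae_glb (φ := fun i ω => -φ i ω) (fun i => (hm i).neg)
    (fun i ω => (abs_neg _).trans_le (hM i ω))
  refine ⟨fun ω => -Y ω, hY.neg, fun i => ?_, fun Z hZ => ?_⟩
  · filter_upwards [h1 i] with ω hω
    linarith
  · have := h2 (fun ω => -Z ω) fun i => by
      filter_upwards [hZ i] with ω hω
      exact neg_le_neg hω
    filter_upwards [this] with ω hω
    linarith

/-- Truncation at ±M makes the almost sure bounds hold everywhere, as the countable infima above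
require. -/
lemma exists_bounded_representative {F : Om →ₘ[P] ℝ} {M : ℝ}
    (hF : AEEqFun.const Om (-M) ≤ F ∧ F ≤ AEEqFun.const Om M) :
    ∃ φ : Om → ℝ, Measurable φ ∧ (∀ ω, |φ ω| ≤ M) ∧ F =ᵐ[P] φ := by
  have h1 := AEEqFun.coeFn_le.2 hF.1
  have h2 := AEEqFun.coeFn_le.2 hF.2
  have hM : -M ≤ M := by
    have h3 : ∀ᵐ ω ∂P, -M ≤ M := by
      filter_upwards [h1, h2, AEEqFun.coeFn_const (α := Om) (μ := P) (-M),
        AEEqFun.coeFn_const (α := Om) (μ := P) M] with ω a1 a2 a3 a4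
      rw [a3] at a1; rw [a4] at a2
      exact a1.trans a2
    exact h3.exists.choose_spec
  refine ⟨fun ω => max (-M) (min M (F ω)),
    measurable_const.max (measurable_const.min F.stronglyMeasurable.measurable),
    fun ω => abs_le.2 ⟨le_max_left _ _, max_le hM (min_le_left _ _)⟩, ?_⟩
  filter_upwards [h1, h2, AEEqFun.coeFn_const (α := Om) (μ := P) (-M),
    AEEqFun.coeFn_const (α := Om) (μ := P) M] with ω a1 a2 a3 a4
  rw [a3] at a1; rw [a4] at a2
  simp only [Function.const_apply] at a1 a2
  rw [min_eq_right a2, max_eq_right a1]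

variable {F : ι → Om →ₘ[P] ℝ} {M : ℝ}

lemma isGLB_essInfFamily [Nonempty ι]
    (hF : ∀ i, AEEqFun.const Om (-M) ≤ F i ∧ F i ≤ AEEqFun.const Om M) :
    IsGLB (range F) (essInfFamily F) := by
  have hex : ∃ Y, IsGLB (range F) Y := by
    choose φ hm hM hφ using fun i => exists_bounded_representative (hF i)
    obtain ⟨Y, hY, h1, h2⟩ := exists_ae_glb hm hM
    refine ⟨AEEqFun.mk Y hY.aestronglyMeasurable, ?_, fun Z hZ => ?_⟩
    · rintro _ ⟨i, rfl⟩
      rw [← AEEqFun.coeFn_le]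
      filter_upwards [AEEqFun.coeFn_mk Y hY.aestronglyMeasurable, h1 i, hφ i] with ω a1 a2 a3
      rw [a1, a3]; exact a2
    · rw [← AEEqFun.coeFn_le]
      have := h2 Z fun i => by
        filter_upwards [AEEqFun.coeFn_le.2 (hZ ⟨i, rfl⟩), hφ i] with ω a1 a2
        rw [← a2]; exact a1
      filter_upwards [AEEqFun.coeFn_mk Y hY.aestronglyMeasurable, this] with ω a1 a2
      rw [a1]; exact a2
  rw [essInfFamily, dif_pos hex]
  exact hex.choose_spec

lemma isLUB_essSupFamily [Nonempty ι]
    (hF : ∀ i, AEEqFun.const Om (-M) ≤ F i ∧ F i ≤ AEEqFun.const Om M) :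
    IsLUB (range F) (essSupFamily F) := by
  have hex : ∃ Y, IsLUB (range F) Y := by
    choose φ hm hM hφ using fun i => exists_bounded_representative (hF i)
    obtain ⟨Y, hY, h1, h2⟩ := exists_ae_lub hm hM
    refine ⟨AEEqFun.mk Y hY.aestronglyMeasurable, ?_, fun Z hZ => ?_⟩
    · rintro _ ⟨i, rfl⟩
      rw [← AEEqFun.coeFn_le]
      filter_upwards [AEEqFun.coeFn_mk Y hY.aestronglyMeasurable, h1 i, hφ i] with ω a1 a2 a3
      rw [a1, a3]; exact a2
    · rw [← AEEqFun.coeFn_le]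
      have := h2 Z fun i => by
        filter_upwards [AEEqFun.coeFn_le.2 (hZ ⟨i, rfl⟩), hφ i] with ω a1 a2
        rw [← a2]; exact a1
      filter_upwards [AEEqFun.coeFn_mk Y hY.aestronglyMeasurable, this] with ω a1 a2
      rw [a1]; exact a2
  rw [essSupFamily, dif_pos hex]
  exact hex.choose_spec

lemma essSupFamily_eq {Y : Om →ₘ[P] ℝ} (h : IsLUB (range F) Y) : essSupFamily F = Y := by
  have hex : ∃ Y, IsLUB (range F) Y := ⟨Y, h⟩
  rw [essSupFamily, dif_pos hex]
  exact hex.choose_spec.unique h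

lemma essInfFamily_eq {Y : Om →ₘ[P] ℝ} (h : IsGLB (range F) Y) : essInfFamily F = Y := by
  have hex : ∃ Y, IsGLB (range F) Y := ⟨Y, h⟩
  rw [essInfFamily, dif_pos hex]
  exact hex.choose_spec.unique h

lemma const_le_iff {Y : Om →ₘ[P] ℝ} {c : ℝ} : AEEqFun.const Om c ≤ Y ↔ ∀ᵐ ω ∂P, c ≤ Y ω := by
  rw [← AEEqFun.coeFn_le]
  refine eventually_congr ?_
  filter_upwards [AEEqFun.coeFn_const (α := Om) (μ := P) c] with ω hω
  rw [hω]; rfl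

lemma le_const_iff {Y : Om →ₘ[P] ℝ} {c : ℝ} : Y ≤ AEEqFun.const Om c ↔ ∀ᵐ ω ∂P, Y ω ≤ c := by
  rw [← AEEqFun.coeFn_le]
  refine eventually_congr ?_
  filter_upwards [AEEqFun.coeFn_const (α := Om) (μ := P) c] with ω hω
  rw [hω]; rfl

lemma const_le_of_forall_sub {Y : Om →ₘ[P] ℝ} {c : ℝ}
    (h : ∀ ε > 0, AEEqFun.const Om (c - ε) ≤ Y) : AEEqFun.const Om c ≤ Y := by
  rw [const_le_iff]
  have h1 : ∀ n : ℕ, ∀ᵐ ω ∂P, c - 1 / (n + 1 : ℝ) ≤ Y ω := fun n =>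
    const_le_iff.1 (h _ Nat.one_div_pos_of_nat)
  filter_upwards [ae_all_iff.2 h1] with ω hω
  refine le_of_forall_pos_le_add fun ε hε => ?_
  obtain ⟨n, hn⟩ := exists_nat_one_div_lt hε
  linarith [hω n]

lemma le_const_of_forall_add {Y : Om →ₘ[P] ℝ} {c : ℝ}
    (h : ∀ ε > 0, Y ≤ AEEqFun.const Om (c + ε)) : Y ≤ AEEqFun.const Om c := by
  rw [le_const_iff]
  have h1 : ∀ n : ℕ, ∀ᵐ ω ∂P, Y ω ≤ c + 1 / (n + 1 : ℝ) := fun n =>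
    le_const_iff.1 (h _ Nat.one_div_pos_of_nat)
  filter_upwards [ae_all_iff.2 h1] with ω hω
  refine le_of_forall_pos_le_add fun ε hε => ?_
  obtain ⟨n, hn⟩ := exists_nat_one_div_lt hε
  linarith [hω n]

variable {κ : Type*} {H : ι → κ → Om →ₘ[P] ℝ} {w : ℝ}

/-- Guarantees by constants, up to every ε, on both sides determine the iterated essential bound.
The value is thereby shown to be constant. The bound M ensures that the inner infima exist. -/
lemma essSup_essInf_eq_const [Nonempty κ]
    (hH : ∀ i k, AEEqFun.const Om (-M) ≤ H i k ∧ H i k ≤ AEEqFun.const Om M)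
    (h1 : ∀ ε > 0, ∃ i, ∀ k, AEEqFun.const Om (w - ε) ≤ H i k)
    (h2 : ∀ ε > 0, ∀ i, ∃ k, H i k ≤ AEEqFun.const Om (w + ε)) :
    (essSupFamily fun i => essInfFamily fun k => H i k) = AEEqFun.const Om w := by
  have hglb := fun i => isGLB_essInfFamily (hH i)
  refine essSupFamily_eq ⟨?_, fun Z hZ => const_le_of_forall_sub fun ε hε => ?_⟩
  · rintro _ ⟨i, rfl⟩
    refine le_const_of_forall_add fun ε hε => ?_
    obtain ⟨k, hk⟩ := h2 ε hε i
    exact ((hglb i).1 ⟨k, rfl⟩).trans hk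
  · obtain ⟨i, hi⟩ := h1 ε hε
    refine le_trans ((hglb i).2 ?_) (hZ ⟨i, rfl⟩)
    rintro _ ⟨k, rfl⟩
    exact hi k

lemma essInf_essSup_eq_const [Nonempty κ]
    (hH : ∀ i k, AEEqFun.const Om (-M) ≤ H i k ∧ H i k ≤ AEEqFun.const Om M)
    (h1 : ∀ ε > 0, ∃ i, ∀ k, H i k ≤ AEEqFun.const Om (w + ε))
    (h2 : ∀ ε > 0, ∀ i, ∃ k, AEEqFun.const Om (w - ε) ≤ H i k) :
    (essInfFamily fun i => essSupFamily fun k => H i k) = AEEqFun.const Om w := by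
  have hlub := fun i => isLUB_essSupFamily (hH i)
  refine essInfFamily_eq ⟨?_, fun Z hZ => le_const_of_forall_add fun ε hε => ?_⟩
  · rintro _ ⟨i, rfl⟩
    refine const_le_of_forall_sub fun ε hε => ?_
    obtain ⟨k, hk⟩ := h2 ε hε i
    exact hk.trans ((hlub i).1 ⟨k, rfl⟩)
  · obtain ⟨i, hi⟩ := h1 ε hε
    refine le_trans (hZ ⟨i, rfl⟩) ((hlub i).2 ?_)
    rintro _ ⟨k, rfl⟩
    exact hi k

end EssInf

/-! ### Conditional expected payoffs -/

section Payoff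

/-- An inequality between `Fil i`-measurable functions may be tested on `Fil i`-sets, over which h
and its conditional expectation have the same integral. -/
lemma ae_le_condExp {h : Om → ℝ} (hh : Integrable h P) {i : ℕ} {c : ℝ}
    (hc : ∀ Γ, MeasurableSet[Fil i] Γ → c * P.real Γ ≤ ∫ ω in Γ, h ω ∂P) :
    ∀ᵐ ω ∂P, c ≤ (P[h | Fil i]) ω := by
  have hm := Fil_le i
  refine ae_le_of_ae_le_trim (hm := hm) (f₁ := fun _ => c) (f₂ := P[h | Fil i]) ?_
  refine ae_le_of_forall_setIntegral_le (integrable_const c)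
    (integrable_condExp.trim hm stronglyMeasurable_condExp) fun s hs _ => ?_
  rw [← setIntegral_trim hm stronglyMeasurable_const hs,
    ← setIntegral_trim hm stronglyMeasurable_condExp hs, setIntegral_condExp hm hh hs,
    setIntegral_const, smul_eq_mul, mul_comm]
  exact hc s hs

lemma ae_condExp_le {h : Om → ℝ} (hh : Integrable h P) {i : ℕ} {c : ℝ}
    (hc : ∀ Γ, MeasurableSet[Fil i] Γ → ∫ ω in Γ, h ω ∂P ≤ c * P.real Γ) :
    ∀ᵐ ω ∂P, (P[h | Fil i]) ω ≤ c := by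
  have hm := Fil_le i
  refine ae_le_of_ae_le_trim (hm := hm) (f₂ := fun _ => c) (f₁ := P[h | Fil i]) ?_
  refine ae_le_of_forall_setIntegral_le (integrable_condExp.trim hm stronglyMeasurable_condExp)
    (integrable_const c) fun s hs _ => ?_
  rw [← setIntegral_trim hm stronglyMeasurable_const hs,
    ← setIntegral_trim hm stronglyMeasurable_condExp hs, setIntegral_condExp hm hh hs,
    setIntegral_const, smul_eq_mul, mul_comm]
  exact hc s hs

variable {T : ℝ} {f : ℝ → E d → A → B → E d} {g : E d → ℝ} {M : ℝ}

lemma controlPayoff_bdd (hM : ∀ x, |g x| ≤ M) (i : ℕ) (t : ℝ) (x : E d) (u : ℝ → Om → A)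
    (v : ℝ → Om → B) : AEEqFun.const Om (-M) ≤ controlPayoff T f g i t x u v ∧
      controlPayoff T f g i t x u v ≤ AEEqFun.const Om M := by
  have h := ae_bdd_abs_condExp_of_ae_bdd_abs (m := Fil i) (μ := P) (R := M)
    (f := fun ω => g (state T f t x u v T ω)) (ae_of_all _ fun ω => hM _)
  have h2 := AEEqFun.coeFn_mk (P[fun ω => g (state T f t x u v T ω) | Fil i])
    integrable_condExp.aestronglyMeasurable
  rw [const_le_iff, le_const_iff]
  constructor <;> filter_upwards [h, h2] with ω a1 a2
  · rw [controlPayoff, a2]; exact (abs_le.1 a1).1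
  · rw [controlPayoff, a2]; exact (abs_le.1 a1).2

variable [MeasurableSpace A] [MeasurableSpace B] {π : Partition T}

lemma payoff_bdd (hM : ∀ x, |g x| ≤ M) (i : ℕ) {t : ℝ} (x : E d) (α : Strategy₁ π A B t)
    (β : Strategy₂ π A B t) : AEEqFun.const Om (-M) ≤ payoff π f g i t x α β ∧
      payoff π f g i t x α β ≤ AEEqFun.const Om M := by
  unfold payoff
  split_ifs with h
  · exact controlPayoff_bdd hM _ _ _ _ _
  · have hM0 : 0 ≤ M := (abs_nonneg _).trans (hM 0)
    rw [const_le_iff, le_const_iff]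
    constructor <;> filter_upwards [AEEqFun.coeFn_zero (μ := P) (α := Om) (β := ℝ)] with ω h0
    · rw [h0]; simpa using hM0
    · rw [h0]; simpa using hM0

/-- `payoff` uses a selected associated couple. A property shared by all associated couples holds
for it, so uniqueness of the couple is not needed. -/
lemma payoff_induction {i : ℕ} {t : ℝ} {x : E d} {α : Strategy₁ π A B t}
    {β : Strategy₂ π A B t} (hex : ∃ c, IsAssociated π α β c) {Q : (Om →ₘ[P] ℝ) → Prop}
    (hQ : ∀ c, IsAssociated π α β c → Q (controlPayoff T f g i t x c.1.1 c.2.1)) :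
    Q (payoff π f g i t x α β) := by
  unfold payoff
  rw [dif_pos hex]
  exact hQ _ hex.choose_spec

end Payoff

/-! ### The lower value function solves the dynamic programming equation. -/

section Values

variable [MeasurableSpace A] [MeasurableSpace B] [TopologicalSpace A] [TopologicalSpace B]
  [SecondCountableTopology A] [SecondCountableTopology B] [BorelSpace A] [BorelSpace B]
  [MeasurableSingletonClass A] [MeasurableSingletonClass B] [Nonempty A] [Nonempty B]
  {T : ℝ} {f : ℝ → E d → A → B → E d} {g : E d → ℝ} {C K L M : ℝ} (hf : IsDrift f C K)
  {p q : unitInterval × unitInterval → unitInterval} {π : Partition T} {W : ℝ → E d → ℝ}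

lemma nonempty_admControl (hpq : IsSplit p q) (π : Partition T) : Nonempty (AdmControl π p A) := by
  refine ⟨⟨fun _ _ => Classical.arbitrary A, (isAdmissible_iff hpq).2
    ⟨measurable_const, fun j _ => ⟨fun _ => 0, fun _ => ⟨fun _ _ => Classical.arbitrary A,
      measurable_const⟩, ?_, fun _ _ _ => rfl⟩⟩⟩⟩
  exact @measurable_const _ _ _ (Fil j) _

include hf

lemma integrable_terminal (hM : ∀ x, |g x| ≤ M) (hg : Continuous g) {t : ℝ} (ht : t ≤ T) (x : E d)
    {u : ℝ → Om → A} {v : ℝ → Om → B} (hu : Measurable (Function.uncurry u))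
    (hv : Measurable (Function.uncurry v)) :
    Integrable (fun ω => g (state T f t x u v T ω)) P :=
  (integrable_const M).mono' (hg.measurable.comp
    (measurable_state hf x hu hv ⟨ht, le_rfl⟩)).aestronglyMeasurable (ae_of_all _ fun _ => hM _)

variable (hW : IsValue π f g M L K W) (hL0 : 0 ≤ L)
include hW hL0

/-- An associated couple satisfies u = α(v) only almost everywhere on [t,T]; the terminal state does
not notice the difference. -/
lemma exists_optimal_strategy_associated (hpq : IsSplit p q) {t : ℝ} {i : ℕ} (hi : i < π.n)
    (ht : t ∈ Ico (π.grid i) (π.grid (i + 1))) (x : E d) {ε : ℝ} (hε : 0 < ε) :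
    ∃ α : AdmControl π q B → AdmControl π p A, IsNonanticipative t α ∧
      ∀ (u : AdmControl π p A) (v : AdmControl π q B), EqOn t (fun _ => T) (α v).1 u.1 → ∀ Γ, MeasurableSet[Fil i] Γ →
        (W t x - ε) * P.real Γ ≤ ∫ ω in Γ, g (state T f t x u.1 v.1 T ω) ∂P := by
  obtain ⟨α, hα, h⟩ := exists_optimal_strategy hf hW hL0 hpq hi ht x hε
  have htT : t ≤ T := ht.2.le.trans (π.grid_mem _).2
  refine ⟨α, hα, fun u v huv Γ hΓ => (h v Γ hΓ).trans_eq (integral_congr_ae (ae_restrict_of_ae ?_))⟩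
  filter_upwards [state_ae_eq hf x (α v).2.1 v.2.1 u.2.1 v.2.1 ⟨htT, le_rfl⟩ huv
    (EqOn.refl _ _ _)] with ω hω
  rw [hω]

lemma exists_response_associated (hpq : IsSplit p q) {t : ℝ} {i : ℕ} (hi : i < π.n)
    (ht : t ∈ Ico (π.grid i) (π.grid (i + 1))) (x : E d)
    {α : AdmControl π q B → AdmControl π p A} (hα : IsNonanticipative t α) {ε : ℝ} (hε : 0 < ε) :
    ∃ v : AdmControl π q B, ∀ (u' : AdmControl π p A) (v' : AdmControl π q B),
      EqOn t (fun _ => T) (α v').1 u'.1 →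
      EqOn t (fun _ => T) v.1 v'.1 → ∀ Γ, MeasurableSet[Fil i] Γ →
        ∫ ω in Γ, g (state T f t x u'.1 v'.1 T ω) ∂P ≤ (W t x + ε) * P.real Γ := by
  obtain ⟨v, h⟩ := exists_response hf hW hL0 hpq hi ht x hα hε
  have htT : t ≤ T := ht.2.le.trans (π.grid_mem _).2
  refine ⟨v, fun u' v' hu' hv' Γ hΓ => (integral_congr_ae (ae_restrict_of_ae ?_)).trans_le (h Γ hΓ)⟩
  have h1 : EqOn t (fun _ => T) (α v).1 u'.1 := by
    -- Equality of v and v' up to t_{n-1} is enough for equal answers up to t_n = T.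
    have h2 := hα.eqOn_grid (j := π.n - 1) (by omega)
      (hv'.mono fun _ => (π.grid_mem _).2)
    rw [show π.n - 1 + 1 = π.n by omega, π.grid_n] at h2
    exact h2.trans hu'
  filter_upwards [state_ae_eq hf x (α v).2.1 v.2.1 u'.2.1 v'.2.1 ⟨htT, le_rfl⟩ h1 hv'] with ω hω
  rw [hω]

omit hf hL0 in
lemma abs_terminal_le (x : E d) : |g x| ≤ M := by
  rw [← hW.terminal x]
  have := π.pt_mem 0
  exact hW.bdd T ⟨this.1.trans this.2, le_rfl⟩ x

lemma continuous_terminal : Continuous g := by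
  have := π.pt_mem 0
  rw [← show W T = g from funext hW.terminal]
  exact hW.continuous_of_mem hf hL0 ⟨this.1.trans this.2, le_rfl⟩

/-- The feedback strategy gives the lower bound against every β; the response to a given α gives the
upper bound. -/
theorem lowerValue_eq {t : ℝ} (ht : t ∈ Icc 0 T) (x : E d) :
    lowerValue π f g t x = W t x := by
  suffices h : lowerValueRV π f g t x = AEEqFun.const Om (W t x) by
    rw [lowerValue, h, integral_congr_ae (AEEqFun.coeFn_const Om (W t x))]
    simp
  have hM := abs_terminal_le hW
  have hgc := continuous_terminal hf hW hL0
  unfold lowerValueRV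
  split_ifs with h
  · set i := h.choose
    have hi : t ∈ Ico (π.grid i) (π.grid (i + 1)) := by
      rw [π.grid_castSucc, π.grid_succ]; exact h.choose_spec
    obtain ⟨u₀⟩ := nonempty_admControl (A := A) isSplit_fst_snd π
    obtain ⟨v₀⟩ := nonempty_admControl (A := B) isSplit_fst_snd.symm π
    have : Nonempty (Strategy₂ π A B t) :=
      ⟨⟨fun _ => v₀, fun _ _ _ _ _ => EqOn.refl _ _ _⟩⟩
    refine essSup_essInf_eq_const (fun α β => payoff_bdd hM _ _ _ _) (fun ε hε => ?_)
      (fun ε hε α => ?_)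
    · obtain ⟨α, hα, hopt⟩ := exists_optimal_strategy_associated hf hW hL0 isSplit_fst_snd i.2 hi x hε
      refine ⟨⟨α, hα⟩, fun β =>
        payoff_induction (Q := fun Y => AEEqFun.const Om (W t x - ε) ≤ Y) ?_ fun c hc => ?_⟩
      · obtain ⟨v, hv⟩ := exists_associated ht.1 hα β.2 v₀
        exact ⟨(α v, v), EqOn.refl _ _ _, hv⟩
      · rw [const_le_iff]
        have h1 := ae_le_condExp (integrable_terminal hf hM hgc ht.2 x c.1.2.1 c.2.2.1)
          (hopt c.1 c.2 hc.1)
        filter_upwards [h1, AEEqFun.coeFn_mk (P[fun ω => g (state T f t x c.1.1 c.2.1 T ω) | Fil i])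
          integrable_condExp.aestronglyMeasurable] with ω a1 a2
        rw [controlPayoff, a2]
        exact a1
    · obtain ⟨v, hv⟩ := exists_response_associated hf hW hL0 isSplit_fst_snd i.2 hi x α.2 hε
      -- Since α is known, β may ignore its argument; a constant map is nonanticipative.
      refine ⟨⟨fun _ => v, fun _ _ _ _ _ => EqOn.refl _ _ _⟩,
        payoff_induction (Q := fun Y => Y ≤ AEEqFun.const Om (W t x + ε)) ?_ fun c hc => ?_⟩
      · exact ⟨(α.1 v, v), EqOn.refl _ _ _, EqOn.refl _ _ _⟩
      · rw [le_const_iff]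
        have h1 := ae_condExp_le (integrable_terminal hf hM hgc ht.2 x c.1.2.1 c.2.2.1)
          (hv c.1 c.2 hc.1 hc.2)
        filter_upwards [h1, AEEqFun.coeFn_mk (P[fun ω => g (state T f t x c.1.1 c.2.1 T ω) | Fil i])
          integrable_condExp.aestronglyMeasurable] with ω a1 a2
        rw [controlPayoff, a2]
        exact a1
  · have : t = T := by
      by_contra hne
      exact h (π.exists_mem_Ico ⟨ht.1, lt_of_le_of_ne ht.2 hne⟩)
    rw [this, hW.terminal]

end Values

/-! ### The upper value function, by exchanging the players. -/

section UpperValue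

variable [MeasurableSpace A] [MeasurableSpace B] [TopologicalSpace A] [TopologicalSpace B]
  [SecondCountableTopology A] [SecondCountableTopology B] [BorelSpace A] [BorelSpace B]
  [MeasurableSingletonClass A] [MeasurableSingletonClass B] [Nonempty A] [Nonempty B]
  {T : ℝ} {f : ℝ → E d → A → B → E d} {g : E d → ℝ} {C K L M : ℝ} {π : Partition T}
  {W : ℝ → E d → ℝ}

/-- Player 2 is the maximizer of -g in the exchanged game and moves first there. The preceding
results apply with the coordinates of the square exchanged, and the inequalities change sign. -/
theorem upperValue_eq (hf : IsDrift f C K)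
    (hW : IsValue π (fun t x b a => f t x a b) (fun x => -g x) M L K W) (hL0 : 0 ≤ L) {t : ℝ}
    (ht : t ∈ Icc 0 T) (x : E d) : upperValue π f g t x = -W t x := by
  suffices h : upperValueRV π f g t x = AEEqFun.const Om (-W t x) by
    rw [upperValue, h, integral_congr_ae (AEEqFun.coeFn_const Om (-W t x))]
    simp
  have hM : ∀ x, |g x| ≤ M := fun x => (abs_neg (g x)) ▸ abs_terminal_le hW x
  have hgc : Continuous g := by
    have h1 : Continuous fun x => -(-g x) := (continuous_terminal hf.swap hW hL0).neg
    simpa only [neg_neg] using h1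
  unfold upperValueRV
  split_ifs with h
  · set i := h.choose
    have hi : t ∈ Ico (π.grid i) (π.grid (i + 1)) := by
      rw [π.grid_castSucc, π.grid_succ]; exact h.choose_spec
    obtain ⟨u₀⟩ := nonempty_admControl (A := A) isSplit_fst_snd π
    obtain ⟨v₀⟩ := nonempty_admControl (A := B) isSplit_fst_snd.symm π
    have : Nonempty (Strategy₁ π A B t) :=
      ⟨⟨fun _ => u₀, fun _ _ _ _ _ => EqOn.refl _ _ _⟩⟩
    refine essInf_essSup_eq_const (H := fun (β : Strategy₂ π A B t) (α : Strategy₁ π A B t) =>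
      payoff π f g i t x α β) (fun α β => payoff_bdd hM _ _ _ _) (fun ε hε => ?_) (fun ε hε β => ?_)
    · obtain ⟨β, hβ, hopt⟩ := exists_optimal_strategy_associated hf.swap hW hL0 isSplit_fst_snd.symm
        i.2 hi x hε
      refine ⟨⟨β, hβ⟩, fun α =>
        payoff_induction (Q := fun Y => Y ≤ AEEqFun.const Om (-W t x + ε)) ?_ fun c hc => ?_⟩
      · obtain ⟨u, hu⟩ := exists_associated ht.1 hβ α.2 u₀
        exact ⟨(u, β u), hu, EqOn.refl _ _ _⟩
      · rw [le_const_iff]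
        have h1 := ae_condExp_le (c := -W t x + ε)
          (integrable_terminal hf hM hgc ht.2 x c.1.2.1 c.2.2.1) fun Γ hΓ => by
            have h2 : (W t x - ε) * P.real Γ ≤ ∫ ω in Γ, -g (state T f t x c.1.1 c.2.1 T ω) ∂P :=
              hopt c.2 c.1 hc.2 Γ hΓ
            rw [integral_neg] at h2
            linarith
        filter_upwards [h1, AEEqFun.coeFn_mk (P[fun ω => g (state T f t x c.1.1 c.2.1 T ω) | Fil i])
          integrable_condExp.aestronglyMeasurable] with ω a1 a2
        rw [controlPayoff, a2]
        exact a1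
    · obtain ⟨u, hu⟩ := exists_response_associated hf.swap hW hL0 isSplit_fst_snd.symm i.2 hi x β.2 hε
      refine ⟨⟨fun _ => u, fun _ _ _ _ _ => EqOn.refl _ _ _⟩,
        payoff_induction (Q := fun Y => AEEqFun.const Om (-W t x - ε) ≤ Y) ?_ fun c hc => ?_⟩
      · exact ⟨(u, β.1 u), EqOn.refl _ _ _, EqOn.refl _ _ _⟩
      · rw [const_le_iff]
        have h1 := ae_le_condExp (c := -W t x - ε)
          (integrable_terminal hf hM hgc ht.2 x c.1.2.1 c.2.2.1) fun Γ hΓ => by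
            have h2 : ∫ ω in Γ, -g (state T f t x c.1.1 c.2.1 T ω) ∂P ≤ (W t x + ε) * P.real Γ :=
              hu c.2 c.1 hc.2 hc.1 Γ hΓ
            rw [integral_neg] at h2
            linarith
        filter_upwards [h1, AEEqFun.coeFn_mk (P[fun ω => g (state T f t x c.1.1 c.2.1 T ω) | Fil i])
          integrable_condExp.aestronglyMeasurable] with ω a1 a2
        rw [controlPayoff, a2]
        exact a1
  · have : t = T := by
      by_contra hne
      exact h (π.exists_mem_Ico ⟨ht.1, lt_of_le_of_ne ht.2 hne⟩)
    rw [this, hW.terminal, neg_neg]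

end UpperValue

/-! ### The minimax theorem for mixed actions -/

section Minimax

open Matrix in
/-- Von Neumann's minimax theorem for matrix games, in saddle point form. -/
lemma exists_matrix_saddle {ι κ : Type*} [Fintype ι] [Fintype κ] [Nonempty ι] [Nonempty κ]
    (N : ι → κ → ℝ) : ∃ y ∈ stdSimplex ℝ ι, ∃ x ∈ stdSimplex ℝ κ,
      ∀ i j, ∑ l, x l * N i l ≤ ∑ k, y k * N k j := by
  classical
  set F : (κ → ℝ) → (ι → ℝ) → ℝ := fun x y => y ⬝ᵥ ((Matrix.of N) *ᵥ x) with hF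
  have hcont : Continuous fun z : (κ → ℝ) × (ι → ℝ) => F z.1 z.2 := by
    simp only [hF]
    exact continuous_snd.dotProduct (continuous_const.matrix_mulVec continuous_fst)
  obtain ⟨x, hx, y, hy, h⟩ := Sion.exists_isSaddlePointOn' (X := stdSimplex ℝ κ)
    (Y := stdSimplex ℝ ι) (f := F) ⟨_, single_mem_stdSimplex ℝ (Classical.arbitrary κ)⟩
    (isCompact_stdSimplex ℝ κ)
    (fun y _ => ((hcont.comp (continuous_id.prodMk continuous_const)).lowerSemicontinuous).lowerSemicontinuousOn _)
    (fun y _ => ConvexOn.quasiconvexOn ⟨convex_stdSimplex ℝ κ, fun x _ x' _ a b _ _ _ => by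
      simp only [hF, mulVec_add, mulVec_smul, dotProduct_add, dotProduct_smul]; rfl⟩)
    (convex_stdSimplex ℝ ι) (isCompact_stdSimplex ℝ ι)
    (fun x _ => ((hcont.comp (continuous_const.prodMk continuous_id)).upperSemicontinuous).upperSemicontinuousOn _)
    (fun x _ => ConcaveOn.quasiconcaveOn ⟨convex_stdSimplex ℝ ι, fun x _ x' _ a b _ _ _ => by
      simp only [hF, add_dotProduct, smul_dotProduct]; rfl⟩)
    (convex_stdSimplex ℝ κ) ⟨_, single_mem_stdSimplex ℝ (Classical.arbitrary ι)⟩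
  refine ⟨y, hy, x, hx, fun i j => ?_⟩
  have := h (Pi.single j 1) (single_mem_stdSimplex ℝ j) (Pi.single i 1) (single_mem_stdSimplex ℝ i)
  simp only [hF, single_one_dotProduct, mulVec_single_one] at this
  calc _ = (Matrix.of N *ᵥ x) i := by simp [mulVec, dotProduct, mul_comm]
    _ ≤ _ := this
    _ = _ := by simp [dotProduct, Matrix.col_apply]

lemma exists_finite_mixture [MeasurableSpace A] {ι : Type*} [Fintype ι] (c : ι → A) {y : ι → ℝ}
    (hy : y ∈ stdSimplex ℝ ι) : ∃ μ : ProbabilityMeasure A, ∀ h : A → ℝ, StronglyMeasurable h →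
      ∫ a, h a ∂(μ : Measure A) = ∑ i, y i * h (c i) := by
  have hp : IsProbabilityMeasure (∑ i, ENNReal.ofReal (y i) • Measure.dirac (c i)) := by
    constructor
    simp only [Measure.coe_finsetSum, Finset.sum_apply, Measure.smul_apply, measure_univ,
      smul_eq_mul, mul_one]
    rw [← ENNReal.ofReal_sum_of_nonneg fun i _ => hy.1 i, hy.2, ENNReal.ofReal_one]
  refine ⟨⟨_, hp⟩, fun h hh => ?_⟩
  change ∫ a, h a ∂(∑ i, ENNReal.ofReal (y i) • Measure.dirac (c i)) = _
  rw [integral_finsetSum_measure]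
  · refine Finset.sum_congr rfl fun i _ => ?_
    rw [integral_smul_measure, integral_dirac' _ _ hh, ENNReal.toReal_ofReal (hy.1 i), smul_eq_mul]
  · intro i _
    refine Integrable.smul_measure ?_ ENNReal.ofReal_ne_top
    exact integrable_dirac' hh (by simp)

variable [MetricSpace A] [CompactSpace A] [Nonempty A] [MeasurableSpace A] [BorelSpace A]
  [MetricSpace B] [CompactSpace B] [Nonempty B] [MeasurableSpace B] [BorelSpace B]
  {G : A → B → ℝ}

lemma exists_bound_of_continuous (hG : Continuous (Function.uncurry G)) :
    ∃ M, ∀ a b, |G a b| ≤ M := by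
  obtain ⟨M, hM⟩ := isCompact_univ.exists_bound_of_continuousOn hG.continuousOn
  exact ⟨M, fun a b => hM (a, b) (mem_univ _)⟩

lemma integrable_of_continuous {X : Type*} [TopologicalSpace X] [CompactSpace X]
    [MeasurableSpace X] [BorelSpace X] {F : Type*} [NormedAddCommGroup F]
    [SecondCountableTopology F]
    {h : X → F} (hh : Continuous h) (μ : Measure X) [IsFiniteMeasure μ] :
    Integrable h μ := by
  borelize F
  obtain ⟨M, hM⟩ := isCompact_univ.exists_bound_of_continuousOn hh.continuousOn
  exact (integrable_const M).mono' hh.measurable.aestronglyMeasurable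
    (ae_of_all _ fun x => hM x (mem_univ _))

/-- Uniform continuity reduces the game to a matrix game on finite δ-nets; moving a and b to points
of the nets costs η / 2 each. -/
lemma exists_saddle (hG : Continuous (Function.uncurry G)) {η : ℝ} (hη : 0 < η) :
    ∃ (μ : ProbabilityMeasure A) (ν : ProbabilityMeasure B), ∀ a b,
      ∫ b', G a b' ∂(ν : Measure B) ≤ ∫ a', G a' b ∂(μ : Measure A) + η := by
  have huc := CompactSpace.uniformContinuous_of_continuous hG
  obtain ⟨δ, hδ, hunif⟩ := Metric.uniformContinuous_iff.1 huc (η / 2) (by positivity)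
  obtain ⟨s, -, hsf, hs⟩ := finite_cover_balls_of_compact (isCompact_univ (X := A)) hδ
  obtain ⟨r, -, hrf, hr⟩ := finite_cover_balls_of_compact (isCompact_univ (X := B)) hδ
  have hsA : ∀ a : A, ∃ i : s, dist a i < δ := fun a => by
    obtain ⟨i, hi, hai⟩ := mem_iUnion₂.1 (hs (mem_univ a)); exact ⟨⟨i, hi⟩, hai⟩
  have hrB : ∀ b : B, ∃ j : r, dist b j < δ := fun b => by
    obtain ⟨i, hi, hai⟩ := mem_iUnion₂.1 (hr (mem_univ b)); exact ⟨⟨i, hi⟩, hai⟩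
  have := hsf.fintype
  have := hrf.fintype
  have : Nonempty s := ⟨(hsA (Classical.arbitrary A)).choose⟩
  have : Nonempty r := ⟨(hrB (Classical.arbitrary B)).choose⟩
  obtain ⟨y, hy, x, hx, h⟩ := exists_matrix_saddle fun (i : s) (j : r) => G i j
  obtain ⟨μ, hμ⟩ := exists_finite_mixture (fun i : s => (i : A)) hy
  obtain ⟨ν, hν⟩ := exists_finite_mixture (fun j : r => (j : B)) hx
  refine ⟨μ, ν, fun a b => ?_⟩
  obtain ⟨i, hi⟩ := hsA a
  obtain ⟨j, hj⟩ := hrB b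
  have hGa : ∀ a, Continuous fun b => G a b := fun a =>
    hG.comp (continuous_const.prodMk continuous_id)
  have hGb : ∀ b, Continuous fun a => G a b := fun b =>
    hG.comp (continuous_id.prodMk continuous_const)
  have h1 : ∫ b', G a b' ∂(ν : Measure B) ≤ ∫ b', (G i b' + η / 2) ∂(ν : Measure B) := by
    refine integral_mono (integrable_of_continuous (hGa a) _)
      ((integrable_of_continuous (hGa i) _).add (integrable_const _)) fun b' => ?_
    have := hunif (a := (a, b')) (b := ((i : A), b')) (by simpa [Prod.dist_eq, hδ] using hi)
    rw [Real.dist_eq] at this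
    have := (abs_lt.1 this).2
    simp only [Function.uncurry] at this
    linarith
  have h2 : ∫ a', (G a' j - η / 2) ∂(μ : Measure A) ≤ ∫ a', G a' b ∂(μ : Measure A) := by
    refine integral_mono ((integrable_of_continuous (hGb j) _).sub (integrable_const _))
      (integrable_of_continuous (hGb b) _) fun a' => ?_
    have := hunif (a := (a', b)) (b := (a', (j : B))) (by simpa [Prod.dist_eq, hδ] using hj)
    rw [Real.dist_eq] at this
    have := (abs_lt.1 this).1
    simp only [Function.uncurry] at this
    linarith
  rw [integral_add (integrable_of_continuous (hGa i) _) (integrable_const _),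
    hν _ (hGa i).measurable.stronglyMeasurable] at h1
  rw [integral_sub (integrable_of_continuous (hGb j) _) (integrable_const _),
    hμ _ (hGb j).measurable.stronglyMeasurable] at h2
  simp only [integral_const, probReal_univ, smul_eq_mul, one_mul] at h1 h2
  linarith [h i j]

/-- The expected value of `G` under independent mixed actions. -/
def mixedValue (G : A → B → ℝ) (μ : ProbabilityMeasure A) (ν : ProbabilityMeasure B) : ℝ :=
  ∫ a, ∫ b, G a b ∂(ν : Measure B) ∂(μ : Measure A)

lemma mixedValue_swap (hG : Continuous (Function.uncurry G)) (μ : ProbabilityMeasure A)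
    (ν : ProbabilityMeasure B) :
    mixedValue G μ ν = ∫ b, ∫ a, G a b ∂(μ : Measure A) ∂(ν : Measure B) :=
  integral_integral_swap (integrable_of_continuous hG _)

lemma continuous_integral_left (hG : Continuous (Function.uncurry G)) (μ : ProbabilityMeasure A) :
    Continuous fun b => ∫ a, G a b ∂(μ : Measure A) := by
  obtain ⟨M, hM⟩ := exists_bound_of_continuous hG
  refine continuous_of_dominated (bound := fun _ => M) (fun b => ?_)
    (fun b => ae_of_all _ fun a => hM a b) (integrable_const M) (ae_of_all _ fun a => ?_)
  · exact (hG.comp (continuous_id.prodMk continuous_const)).measurable.aestronglyMeasurable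
  · exact hG.comp (continuous_const.prodMk continuous_id)

lemma continuous_integral_right (hG : Continuous (Function.uncurry G)) (ν : ProbabilityMeasure B) :
    Continuous fun a => ∫ b, G a b ∂(ν : Measure B) :=
  continuous_integral_left (G := fun b a => G a b) (hG.comp continuous_swap) ν

lemma mixedValue_le (hG : Continuous (Function.uncurry G)) {μ : ProbabilityMeasure A}
    {ν : ProbabilityMeasure B} {c : ℝ} (h : ∀ a, ∫ b, G a b ∂(ν : Measure B) ≤ c) :
    mixedValue G μ ν ≤ c := by
  have := integral_mono (μ := (μ : Measure A))
    (integrable_of_continuous (continuous_integral_right hG ν) _) (integrable_const c) h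
  simpa [mixedValue] using this

lemma le_mixedValue (hG : Continuous (Function.uncurry G)) {μ : ProbabilityMeasure A}
    {ν : ProbabilityMeasure B} {c : ℝ} (h : ∀ b, c ≤ ∫ a, G a b ∂(μ : Measure A)) :
    c ≤ mixedValue G μ ν := by
  rw [mixedValue_swap hG]
  have := integral_mono (μ := (ν : Measure B)) (integrable_const c)
    (integrable_of_continuous (continuous_integral_left hG μ) _) h
  simpa using this

lemma abs_mixedValue_le {M : ℝ} (hM : ∀ a b, |G a b| ≤ M) (μ : ProbabilityMeasure A)
    (ν : ProbabilityMeasure B) : |mixedValue G μ ν| ≤ M := by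
  have h1 : ∀ a, ‖∫ b, G a b ∂(ν : Measure B)‖ ≤ M := fun a => by
    simpa using norm_integral_le_of_norm_le_const (μ := (ν : Measure B)) (f := G a)
      (ae_of_all _ fun b => hM a b)
  simpa [mixedValue] using norm_integral_le_of_norm_le_const (μ := (μ : Measure A))
    (f := fun a => ∫ b, G a b ∂(ν : Measure B)) (ae_of_all _ h1)

instance : Nonempty (ProbabilityMeasure A) :=
  ⟨⟨Measure.dirac (Classical.arbitrary A), inferInstance⟩⟩

lemma bddBelow_mixedValue (hG : Continuous (Function.uncurry G)) (μ : ProbabilityMeasure A) :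
    BddBelow (range fun ν : ProbabilityMeasure B => mixedValue G μ ν) := by
  obtain ⟨M, hM⟩ := exists_bound_of_continuous hG
  exact ⟨-M, by rintro _ ⟨ν, rfl⟩; exact (abs_le.1 (abs_mixedValue_le hM μ ν)).1⟩

lemma bddAbove_iInf_mixedValue (hG : Continuous (Function.uncurry G)) :
    BddAbove (range fun μ : ProbabilityMeasure A =>
      ⨅ ν : ProbabilityMeasure B, mixedValue G μ ν) := by
  obtain ⟨M, hM⟩ := exists_bound_of_continuous hG
  refine ⟨M, ?_⟩
  rintro _ ⟨μ, rfl⟩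
  exact (ciInf_le (bddBelow_mixedValue hG μ) (Classical.arbitrary _)).trans
    (abs_le.1 (abs_mixedValue_le hM μ _)).2

/-- The lower value of the game with mixed actions is attained up to `ε` by a mixed action of the
maximizer. -/
lemma exists_mixed_maximizer (hG : Continuous (Function.uncurry G)) {ε : ℝ} (hε : 0 < ε) :
    ∃ μ : ProbabilityMeasure A, ∀ ν : ProbabilityMeasure B,
      (⨆ μ : ProbabilityMeasure A, ⨅ ν : ProbabilityMeasure B, mixedValue G μ ν) - ε ≤
        mixedValue G μ ν := by
  obtain ⟨μ, hμ⟩ := exists_lt_of_lt_ciSup (sub_lt_self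
    (⨆ μ : ProbabilityMeasure A, ⨅ ν : ProbabilityMeasure B, mixedValue G μ ν) hε)
  exact ⟨μ, fun ν => hμ.le.trans (ciInf_le (bddBelow_mixedValue hG μ) ν)⟩

/-- Against a known mixed action the minimizer has an almost optimal pure reply. -/
lemma exists_pure_reply (hG : Continuous (Function.uncurry G)) {ε : ℝ} (hε : 0 < ε)
    (μ : ProbabilityMeasure A) : ∃ b : B, ∫ a, G a b ∂(μ : Measure A) ≤
      (⨆ μ : ProbabilityMeasure A, ⨅ ν : ProbabilityMeasure B, mixedValue G μ ν) + ε := by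
  by_contra! h
  have h1 : (⨆ μ : ProbabilityMeasure A, ⨅ ν : ProbabilityMeasure B, mixedValue G μ ν) + ε ≤
      ⨅ ν : ProbabilityMeasure B, mixedValue G μ ν :=
    le_ciInf fun ν => le_mixedValue hG fun b => (h b).le
  linarith [le_ciSup (bddAbove_iInf_mixedValue hG) μ]

/-- The left side is minus the inf sup of G, in the form the exchanged game produces. One inequality
is weak duality; the other follows from approximate saddle points. -/
theorem minimax (hG : Continuous (Function.uncurry G)) :
    (⨆ ν : ProbabilityMeasure B, ⨅ μ : ProbabilityMeasure A, mixedValue (fun b a => -G a b) ν μ) =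
    -⨆ μ : ProbabilityMeasure A, ⨅ ν : ProbabilityMeasure B, mixedValue G μ ν := by
  have hG' : Continuous (Function.uncurry fun b a => -G a b) := (hG.comp continuous_swap).neg
  have hneg : ∀ μ ν, mixedValue (fun b a => -G a b) ν μ = -mixedValue G μ ν := fun μ ν => by
    rw [mixedValue_swap hG]
    simp only [mixedValue, integral_neg]
  apply le_antisymm
  · refine le_of_forall_pos_le_add fun ε hε => ?_
    obtain ⟨μ, hμ⟩ := exists_mixed_maximizer hG hε
    refine ciSup_le fun ν => (ciInf_le (bddBelow_mixedValue hG' ν) μ).trans ?_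
    rw [hneg]
    linarith [hμ ν]
  · refine le_of_forall_pos_le_add fun ε hε => ?_
    obtain ⟨μ, ν, h⟩ := exists_saddle hG hε
    have h1 : ∀ b, ∀ μ', mixedValue G μ' ν ≤ ∫ a', G a' b ∂(μ : Measure A) + ε := fun b μ' =>
      mixedValue_le hG fun a => h a b
    have h2 : ∀ μ' ν', mixedValue G μ' ν ≤ mixedValue G μ ν' + ε := fun μ' ν' => by
      have := le_mixedValue hG (μ := μ) (ν := ν') (c := mixedValue G μ' ν - ε) fun b => by
        linarith [h1 b μ']
      linarith
    have h3 : ∀ μ', mixedValue G μ' ν - ε ≤ ⨅ ν', mixedValue G μ ν' := fun μ' =>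
      le_ciInf fun ν' => by linarith [h2 μ' ν']
    have h4 : ∀ μ', mixedValue G μ' ν - ε ≤
        ⨆ μ : ProbabilityMeasure A, ⨅ ν : ProbabilityMeasure B, mixedValue G μ ν := fun μ' =>
      (h3 μ').trans (le_ciSup (bddAbove_iInf_mixedValue hG) μ)
    have h5 : -(⨆ μ : ProbabilityMeasure A, ⨅ ν : ProbabilityMeasure B, mixedValue G μ ν) - ε ≤
        ⨅ μ : ProbabilityMeasure A, mixedValue (fun b a => -G a b) ν μ :=
      le_ciInf fun μ' => by rw [hneg]; linarith [h4 μ']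
    linarith [le_ciSup (bddAbove_iInf_mixedValue hG') ν]

end Minimax

/-! ### The mixed Hamiltonian and the exchange of the players. -/

section Hamiltonian

variable [MetricSpace A] [CompactSpace A] [Nonempty A] [MeasurableSpace A] [BorelSpace A]
  [MetricSpace B] [CompactSpace B] [Nonempty B] [MeasurableSpace B] [BorelSpace B]
  {f : ℝ → E d → A → B → E d} {C K : ℝ} (hf : IsDrift f C K)
include hf

lemma IsDrift.continuous_inner (t : ℝ) (x p : E d) :
    Continuous (Function.uncurry fun a b => inner ℝ (f t x a b) p) :=
  (hf.cont.comp (f := fun q : A × B => (t, x, q.1, q.2)) (by fun_prop)).inner continuous_const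

lemma inner_mixedDrift (t : ℝ) (x p : E d) (μ : ProbabilityMeasure A) (ν : ProbabilityMeasure B) :
    inner ℝ (mixedDrift f t x μ ν) p = mixedValue (fun a b => inner ℝ (f t x a b) p) μ ν := by
  have hc : Continuous fun q : A × B => f t x q.1 q.2 :=
    hf.cont.comp (f := fun q : A × B => (t, x, q.1, q.2)) (by fun_prop)
  have hi : ∀ a, Integrable (fun b => f t x a b) (ν : Measure B) := fun a =>
    integrable_of_continuous (hc.comp (continuous_const.prodMk continuous_id)) _
  have hi2 : Integrable (fun a => ∫ b, f t x a b ∂(ν : Measure B)) (μ : Measure A) :=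
    (integrable_of_continuous hc ((μ : Measure A).prod (ν : Measure B))).integral_prod_left
  simp only [mixedValue, mixedDrift]
  simp only [real_inner_comm p]
  rw [← integral_inner hi2 p]
  refine integral_congr_ae (ae_of_all _ fun a => ?_)
  exact (integral_inner (hi a) p).symm

lemma hamiltonian_eq (t : ℝ) (x p : E d) : hamiltonian f t x p =
    ⨆ μ : ProbabilityMeasure A, ⨅ ν : ProbabilityMeasure B,
      mixedValue (fun a b => inner ℝ (f t x a b) p) μ ν := by
  simp only [hamiltonian, inner_mixedDrift hf]

/-- Isaacs' condition, automatic for mixed actions: this is why lower and upper values lead to the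
same equation. -/
lemma hamiltonian_swap (t : ℝ) (x p : E d) :
    hamiltonian (fun t x b a => f t x a b) t x (-p) = -hamiltonian f t x p := by
  rw [hamiltonian_eq hf, hamiltonian_eq hf.swap, ← minimax (hf.continuous_inner t x p)]
  simp only [inner_neg_right]

end Hamiltonian

/-! ### First order expansions of test functions -/

section Expansion

/-- `φ` has the strict first order expansion with slopes `a` in time and `p` in space at
`(t₀, x₀)`, relative to `[0,T] × ℝ^d`. -/
def HasExpansion (T : ℝ) (φ : ℝ × E d → ℝ) (t₀ : ℝ) (x₀ : E d) (a : ℝ) (p : E d) : Prop :=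
  ∀ η > 0, ∃ δ > 0, ∀ s ∈ Icc 0 T, ∀ s' ∈ Icc 0 T, ∀ y y' : E d, |s - t₀| ≤ δ → |s' - t₀| ≤ δ →
    ‖y - x₀‖ ≤ δ → ‖y' - x₀‖ ≤ δ →
    |φ (s', y') - φ (s, y) - a * (s' - s) - inner ℝ (y' - y) p| ≤ η * (|s' - s| + ‖y' - y‖)

/-- A penalty with a strict minimum at `(t₀, x₀)`. -/
def penalty (t₀ : ℝ) (x₀ : E d) (z : ℝ × E d) : ℝ := (z.1 - t₀) ^ 2 + ‖z.2 - x₀‖ ^ 2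

variable {T : ℝ} {φ ψ : ℝ × E d → ℝ} {t₀ : ℝ} {x₀ : E d} {a b : ℝ} {p q : E d}

lemma HasExpansion.add (h : HasExpansion T φ t₀ x₀ a p) (h' : HasExpansion T ψ t₀ x₀ b q) :
    HasExpansion T (fun z => φ z + ψ z) t₀ x₀ (a + b) (p + q) := by
  intro η hη
  obtain ⟨δ, hδ, H⟩ := h (η / 2) (by positivity)
  obtain ⟨δ', hδ', H'⟩ := h' (η / 2) (by positivity)
  refine ⟨min δ δ', lt_min hδ hδ', fun s hs s' hs' y y' h1 h2 h3 h4 => ?_⟩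
  have e1 := H s hs s' hs' y y' (h1.trans (min_le_left _ _)) (h2.trans (min_le_left _ _))
    (h3.trans (min_le_left _ _)) (h4.trans (min_le_left _ _))
  have e2 := H' s hs s' hs' y y' (h1.trans (min_le_right _ _)) (h2.trans (min_le_right _ _))
    (h3.trans (min_le_right _ _)) (h4.trans (min_le_right _ _))
  rw [inner_add_right]
  rw [abs_le] at e1 e2 ⊢
  constructor <;> nlinarith [e1.1, e1.2, e2.1, e2.2]

lemma HasExpansion.neg (h : HasExpansion T φ t₀ x₀ a p) :
    HasExpansion T (fun z => -φ z) t₀ x₀ (-a) (-p) := by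
  intro η hη
  obtain ⟨δ, hδ, H⟩ := h η hη
  refine ⟨δ, hδ, fun s hs s' hs' y y' h1 h2 h3 h4 => ?_⟩
  rw [← abs_neg]
  convert! H s hs s' hs' y y' h1 h2 h3 h4 using 2
  rw [inner_neg_right]; ring

/-- Both slopes vanish, so the penalty makes a maximum strict without affecting the expansion of φ.
-/
lemma hasExpansion_penalty : HasExpansion T (penalty t₀ x₀) t₀ x₀ 0 (0 : E d) := by
  intro η hη
  refine ⟨η / 2, by positivity, fun s _ s' _ y y' h1 h2 h3 h4 => ?_⟩
  have e1 : |(s' - t₀) ^ 2 - (s - t₀) ^ 2| ≤ η * |s' - s| := by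
    rw [show (s' - t₀) ^ 2 - (s - t₀) ^ 2 = ((s' - t₀) + (s - t₀)) * (s' - s) by ring, abs_mul]
    exact mul_le_mul_of_nonneg_right ((abs_add_le _ _).trans (by linarith)) (abs_nonneg _)
  have e2 : |‖y' - x₀‖ ^ 2 - ‖y - x₀‖ ^ 2| ≤ η * ‖y' - y‖ := by
    rw [show ‖y' - x₀‖ ^ 2 - ‖y - x₀‖ ^ 2 =
      (‖y' - x₀‖ + ‖y - x₀‖) * (‖y' - x₀‖ - ‖y - x₀‖) by ring, abs_mul,
      abs_of_nonneg (by positivity)]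
    refine mul_le_mul (by linarith) ?_ (abs_nonneg _) hη.le
    refine (abs_norm_sub_norm_le _ _).trans_eq ?_
    rw [sub_sub_sub_cancel_right]
  simp only [penalty, inner_zero_right]
  rw [abs_le] at e1 e2 ⊢
  constructor <;> linarith [e1.1, e1.2, e2.1, e2.2]

/-- Mean value inequality on the convex intersection of the strip with a small ball, where the
derivative within the strip is η-close to its value at the point. At t₀ = 0 the time slope is
one-sided. -/
lemma hasExpansion_of_contDiffOn (hT : 0 < T) (hφ : ContDiffOn ℝ 1 φ (Icc 0 T ×ˢ univ))
    (ht : t₀ ∈ Icc 0 T) : HasExpansion T φ t₀ x₀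
      (derivWithin (fun s => φ (s, x₀)) (Icc 0 T) t₀) (gradient (fun y => φ (t₀, y)) x₀) := by
  set S : Set (ℝ × E d) := Icc 0 T ×ˢ univ with hS
  have hU : UniqueDiffOn ℝ S := (uniqueDiffOn_Icc hT).prod uniqueDiffOn_univ
  have hz : (t₀, x₀) ∈ S := ⟨ht, mem_univ _⟩
  set D := fderivWithin ℝ φ S (t₀, x₀) with hD
  have hd : ∀ z ∈ S, HasFDerivWithinAt φ (fderivWithin ℝ φ S z) S z := fun z hz =>
    (hφ.differentiableOn one_ne_zero z hz).hasFDerivWithinAt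
  have ha : derivWithin (fun s => φ (s, x₀)) (Icc 0 T) t₀ = D (1, 0) := by
    have h1 : HasDerivWithinAt (fun s : ℝ => (s, x₀)) ((1 : ℝ), (0 : E d)) (Icc 0 T) t₀ :=
      (hasDerivWithinAt_id _ _).prodMk (hasDerivWithinAt_const _ _ _)
    have hm : MapsTo (fun s : ℝ => (s, x₀)) (Icc 0 T) S := fun s hs => ⟨hs, mem_univ _⟩
    have h2 := (hd _ hz).comp_hasDerivWithinAt t₀ h1 hm
    exact h2.derivWithin (uniqueDiffOn_Icc hT t₀ ht)
  have hp : ∀ e, inner ℝ e (gradient (fun y => φ (t₀, y)) x₀) = D (0, e) := fun e => by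
    have h1 : HasFDerivWithinAt (fun y : E d => (t₀, y)) (ContinuousLinearMap.inr ℝ ℝ (E d)) univ
        x₀ := (hasFDerivAt_prodMk_right t₀ x₀).hasFDerivWithinAt
    have h2 := (hd _ hz).comp x₀ h1 (fun y _ => ⟨ht, mem_univ _⟩)
    have h3 := (hasFDerivWithinAt_univ.1 h2).fderiv
    rw [real_inner_comm, gradient, InnerProductSpace.toDual_symm_apply]
    have h4 : fderiv ℝ (fun y => φ (t₀, y)) x₀ = D.comp (ContinuousLinearMap.inr ℝ ℝ (E d)) := h3
    rw [h4]
    simp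
  intro η hη
  have hc : ContinuousOn (fderivWithin ℝ φ S) S := hφ.continuousOn_fderivWithin hU le_rfl
  obtain ⟨δ, hδ, hball⟩ := Metric.continuousWithinAt_iff.1 (hc _ hz) η hη
  refine ⟨δ / 2, by positivity, fun s hs s' hs' y y' h1 h2 h3 h4 => ?_⟩
  have hconv : Convex ℝ (S ∩ Metric.ball (t₀, x₀) δ) :=
    ((convex_Icc 0 T).prod convex_univ).inter (convex_ball _ _)
  have hmem : ∀ s ∈ Icc 0 T, ∀ y : E d, |s - t₀| ≤ δ / 2 → ‖y - x₀‖ ≤ δ / 2 →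
      (s, y) ∈ S ∩ Metric.ball (t₀, x₀) δ := fun s hs y h1 h2 => by
    refine ⟨⟨hs, mem_univ _⟩, ?_⟩
    rw [Metric.mem_ball, Prod.dist_eq, Real.dist_eq, dist_eq_norm]
    exact max_lt (by simpa using h1.trans_lt (by linarith)) (by simpa using h2.trans_lt (by linarith))
  have key := hconv.norm_image_sub_le_of_norm_hasFDerivWithin_le' (f := φ) (φ := D) (C := η)
    (fun z hz => (hd z hz.1).mono inter_subset_left)
    (fun z hz => by
      rw [← dist_eq_norm]; exact (hball hz.1 hz.2).le)
    (hmem s hs y h1 h3) (hmem s' hs' y' h2 h4)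
  have e : D ((s', y') - (s, y)) = (s' - s) * D (1, 0) + D (0, y' - y) := by
    rw [← smul_eq_mul, ← map_smul, ← map_add]
    congr 1
    simp
  rw [ha, hp]
  rw [e, Real.norm_eq_abs] at key
  rw [show φ (s', y') - φ (s, y) - D (1, 0) * (s' - s) - D (0, y' - y) =
    φ (s', y') - φ (s, y) - ((s' - s) * D (1, 0) + D (0, y' - y)) by ring]
  refine key.trans (mul_le_mul_of_nonneg_left ?_ hη.le)
  rw [Prod.norm_def]
  refine max_le ?_ ?_
  · simp
  · simp

lemma continuous_penalty (t₀ : ℝ) (x₀ : E d) : Continuous (penalty t₀ x₀) := by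
  unfold penalty; fun_prop

lemma norm_sq_le_penalty (t₀ : ℝ) (x₀ : E d) (z : ℝ × E d) :
    ‖z - (t₀, x₀)‖ ^ 2 ≤ penalty t₀ x₀ z := by
  unfold penalty
  rw [Prod.norm_def]
  rcases max_choice ‖(z - (t₀, x₀)).1‖ ‖(z - (t₀, x₀)).2‖ with h | h <;> rw [h]
  · simp only [Prod.fst_sub, Real.norm_eq_abs, sq_abs]
    nlinarith [sq_nonneg ‖z.2 - x₀‖]
  · simp only [Prod.snd_sub]
    nlinarith [sq_nonneg (z.1 - t₀)]

/-- Maximum points of penalized approximations converge. -/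
lemma eventually_exists_isMaxOn {k : Set (ℝ × E d)} (hk : IsCompact k) {F : ℕ → ℝ × E d → ℝ}
    {V φ : ℝ × E d → ℝ} (hF : ∀ n, ContinuousOn (F n) k) (hφ : ContinuousOn φ k)
    (hFV : TendstoUniformlyOn F V atTop k) (h0 : (t₀, x₀) ∈ k)
    (hmax : ∀ z ∈ k, V z - φ z ≤ V (t₀, x₀) - φ (t₀, x₀)) {δ : ℝ} (hδ : 0 < δ) :
    ∀ᶠ n in atTop, ∃ z ∈ k, ‖z - (t₀, x₀)‖ ≤ δ ∧
      ∀ z' ∈ k, F n z' - (φ z' + penalty t₀ x₀ z') ≤ F n z - (φ z + penalty t₀ x₀ z) := by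
  -- The uniform error enters once at z and once at (t₀, x₀), so the penalty at z is at most δ².
  filter_upwards [Metric.tendstoUniformlyOn_iff.1 hFV (δ ^ 2 / 2) (by positivity)] with n hn
  obtain ⟨z, hz, hzmax⟩ := hk.exists_isMaxOn ⟨_, h0⟩
    ((hF n).sub (hφ.add (continuous_penalty t₀ x₀).continuousOn))
  refine ⟨z, hz, ?_, fun z' hz' => hzmax hz'⟩
  have h1 : F n (t₀, x₀) - (φ (t₀, x₀) + penalty t₀ x₀ (t₀, x₀)) ≤
    F n z - (φ z + penalty t₀ x₀ z) := hzmax h0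
  have h2 : penalty t₀ x₀ (t₀, x₀) = 0 := by simp [penalty]
  have h3 := hn z hz
  have h4 := hn _ h0
  rw [Real.dist_eq, abs_lt] at h3 h4
  have h5 := norm_sq_le_penalty t₀ x₀ z
  have h6 := hmax z hz
  exact abs_le_of_sq_le_sq' (by linarith [h3.1, h3.2, h4.1, h4.2]) hδ.le |>.2

end Expansion

/-! ### One step of the dynamic programming equation for mixed actions -/

section StepLimit

variable [MetricSpace A] [CompactSpace A] [Nonempty A] [MeasurableSpace A] [BorelSpace A]
  [MetricSpace B] [CompactSpace B] [Nonempty B] [MeasurableSpace B] [BorelSpace B]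

/-- The occupation measure of a process on a time interval. -/
lemma exists_occupation_measure {Θ : ℝ → unitInterval × unitInterval → A}
    (hΘ : Measurable (Function.uncurry Θ)) {s s' : ℝ} (hs : s < s') :
    ∃ μ : ProbabilityMeasure A, ∀ k : A → ℝ, Continuous k →
      ∫ z, ∫ r in s..s', k (Θ r z) = (s' - s) * ∫ a, k a ∂(μ : Measure A) := by
  -- After normalization the image of m is the law of the control at a uniformly distributed time of
  -- the slot.
  set m : Measure (ℝ × (unitInterval × unitInterval)) :=
    (volume.restrict (Ioc s s')).prod volume with hm
  have hmass : m univ = ENNReal.ofReal (s' - s) := by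
    rw [hm, ← univ_prod_univ, Measure.prod_prod]
    simp
  have hpos : 0 < s' - s := sub_pos.2 hs
  have hne : ENNReal.ofReal (s' - s) ≠ 0 := by simpa using hpos
  have hp : IsProbabilityMeasure (((ENNReal.ofReal (s' - s))⁻¹ • m).map (Function.uncurry Θ)) := by
    have : IsProbabilityMeasure ((ENNReal.ofReal (s' - s))⁻¹ • m) := by
      constructor
      rw [Measure.smul_apply, hmass, smul_eq_mul, ENNReal.inv_mul_cancel hne ENNReal.ofReal_ne_top]
    exact Measure.isProbabilityMeasure_map hΘ.aemeasurable
  refine ⟨⟨_, hp⟩, fun k hk => ?_⟩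
  change _ = (s' - s) * ∫ a, k a ∂(((ENNReal.ofReal (s' - s))⁻¹ • m).map (Function.uncurry Θ))
  rw [integral_map hΘ.aemeasurable hk.measurable.aestronglyMeasurable, integral_smul_measure,
    ENNReal.toReal_inv, ENNReal.toReal_ofReal hpos.le, smul_eq_mul, mul_inv_cancel_left₀ hpos.ne']
  obtain ⟨M, hM⟩ := isCompact_univ.exists_bound_of_continuousOn hk.continuousOn
  have hi : Integrable (fun q : ℝ × (unitInterval × unitInterval) => k (Function.uncurry Θ q)) m :=
    (integrable_const M).mono' (hk.measurable.comp hΘ).aestronglyMeasurable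
      (ae_of_all _ fun q => hM _ (mem_univ _))
  rw [hm, integral_prod_symm _ hi]
  simp only [intervalIntegral.integral_of_le hs.le, Function.uncurry]

variable {f : ℝ → E d → A → B → E d} {C K T M : ℝ} (hf : IsDrift f C K)
  {G : A → B → ℝ} (hG : Continuous (Function.uncurry G))
include hG

lemma integrable_running {s s' : ℝ} (hs : s ≤ s') (U : MixedControl A) (V : MixedControl B) :
    Integrable (fun q : (unitInterval × unitInterval) × ℝ => G (U.1 q.2 q.1.1) (V.1 q.2 q.1.2))
        (volume.prod (volume.restrict (Ioc s s'))) ∧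
    Integrable (fun z : unitInterval × unitInterval =>
      ∫ r in s..s', G (U.1 r z.1) (V.1 r z.2)) := by
  obtain ⟨M, hM⟩ := exists_bound_of_continuous hG
  have hU : Measurable fun q : (unitInterval × unitInterval) × ℝ => U.1 q.2 q.1.1 :=
    U.2.comp (g := Function.uncurry U.1)
      (f := fun q : (unitInterval × unitInterval) × ℝ => (q.2, q.1.1)) (by fun_prop)
  have hV : Measurable fun q : (unitInterval × unitInterval) × ℝ => V.1 q.2 q.1.2 :=
    V.2.comp (g := Function.uncurry V.1)
      (f := fun q : (unitInterval × unitInterval) × ℝ => (q.2, q.1.2)) (by fun_prop)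
  have hi : Integrable (fun q : (unitInterval × unitInterval) × ℝ => G (U.1 q.2 q.1.1)
      (V.1 q.2 q.1.2)) (volume.prod (volume.restrict (Ioc s s'))) :=
    (integrable_const M).mono' (hG.measurable.comp (hU.prodMk hV)).aestronglyMeasurable
      (ae_of_all _ fun q => hM _ _)
  refine ⟨hi, ?_⟩
  simp only [intervalIntegral.integral_of_le hs]
  exact hi.integral_prod_left

/-- The maximizer has a mixed action that is almost optimal against all pure ones. -/
lemma exists_mixed_maximizer_pure {ε : ℝ} (hε : 0 < ε) : ∃ μ : ProbabilityMeasure A, ∀ b,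
    (⨆ μ : ProbabilityMeasure A, ⨅ ν : ProbabilityMeasure B, mixedValue G μ ν) - ε ≤
      ∫ a, G a b ∂(μ : Measure A) := by
  obtain ⟨μ, hμ⟩ := exists_mixed_maximizer hG hε
  refine ⟨μ, fun b => ?_⟩
  let ν : ProbabilityMeasure B := ⟨Measure.dirac b, inferInstance⟩
  refine (hμ ν).trans_eq ((mixedValue_swap hG μ ν).trans ?_)
  exact integral_dirac' _ _ (continuous_integral_left hG μ).measurable.stronglyMeasurable

include hf

variable {ψ : E d → ℝ} (hψ : Continuous ψ) (hM : ∀ x, |ψ x| ≤ M) {s s' : ℝ} (hs : s < s')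
  (hT : s' ≤ T) {y : E d} {w a : ℝ} (hw : IsMaxmin (stepCost T f s s' ψ y) w)
include hψ hM hs hT hw

/-- Against a constant pure action b, a nearly optimal U contributes only through its occupation
measure μ. Taking b as a nearly best reply to μ bounds the running integral by (s' - s) (H + ε / 2).
-/
lemma nonneg_of_isMaxmin (hpath : ∀ (u : ℝ → A) (v : ℝ → B), Measurable u → Measurable v →
      ψ (flow T f s y u v s') ≤ w + a * (s' - s) + ∫ r in s..s', G (u r) (v r)) :
    0 ≤ a + ⨆ μ : ProbabilityMeasure A, ⨅ ν : ProbabilityMeasure B, mixedValue G μ ν := by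
  set H := ⨆ μ : ProbabilityMeasure A, ⨅ ν : ProbabilityMeasure B, mixedValue G μ ν with hH
  have hpos : 0 < s' - s := sub_pos.2 hs
  refine le_of_forall_pos_le_add fun ε hε => ?_
  obtain ⟨U, hU⟩ := hw.1 (ε / 2 * (s' - s)) (by positivity)
  have hΘ : Measurable (Function.uncurry fun r (z : unitInterval × unitInterval) => U.1 r z.1) :=
    U.2.comp (g := Function.uncurry U.1) (f := fun q : ℝ × unitInterval × unitInterval =>
      (q.1, q.2.1)) (by fun_prop)
  obtain ⟨μ, hμ⟩ := exists_occupation_measure hΘ hs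
  obtain ⟨b, hb⟩ := exists_pure_reply hG (half_pos hε) μ
  set V : MixedControl B := ⟨fun _ _ => b, measurable_const⟩ with hV
  have h1 := hU V
  have h2 : stepCost T f s s' ψ y U V ≤
      ∫ z : unitInterval × unitInterval, (w + a * (s' - s) +
        ∫ r in s..s', G (U.1 r z.1) (V.1 r z.2)) := by
    refine integral_mono (integrable_stepCost hf hψ hM ⟨hs.le, hT⟩ y U V)
      ((integrable_const _).add (integrable_running hG hs.le U V).2) fun z => ?_
    exact hpath _ _ (U.measurable_path _) (V.measurable_path _)
  rw [integral_add (integrable_const _) (integrable_running hG hs.le U V).2,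
    hμ (fun a => G a b) (hG.comp (continuous_id.prodMk continuous_const))] at h2
  simp only [integral_const, probReal_univ, smul_eq_mul, one_mul] at h2
  have h3 := mul_le_mul_of_nonneg_left hb hpos.le
  have h4 : 0 ≤ (s' - s) * (a + H + ε) := by nlinarith
  exact nonneg_of_mul_nonneg_right h4 hpos

/-- The maximizer plays a nearly optimal mixed action, constant in time. The opponent's control
depends on an independent number, so at each time it faces the full law μ. -/
lemma nonpos_of_isMaxmin (hpath : ∀ (u : ℝ → A) (v : ℝ → B), Measurable u → Measurable v →
      w + a * (s' - s) + ∫ r in s..s', G (u r) (v r) ≤ ψ (flow T f s y u v s')) :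
    a + (⨆ μ : ProbabilityMeasure A, ⨅ ν : ProbabilityMeasure B, mixedValue G μ ν) ≤ 0 := by
  set H := ⨆ μ : ProbabilityMeasure A, ⨅ ν : ProbabilityMeasure B, mixedValue G μ ν with hH
  have hpos : 0 < s' - s := sub_pos.2 hs
  refine le_of_forall_pos_le_add fun ε hε => ?_
  obtain ⟨μ, hμ⟩ := exists_mixed_maximizer_pure hG (half_pos hε)
  -- The mixed action μ is the image of Lebesgue measure on the unit interval under m, hence it can
  -- be played with the private number.
  obtain ⟨m, hm, hmμ⟩ := (μ : Measure A).exists_measurable_map_eq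
  set U : MixedControl A := ⟨fun _ y => m y, hm.comp measurable_snd⟩ with hU
  obtain ⟨V, hV⟩ := hw.2 (ε / 2 * (s' - s)) (by positivity) U
  obtain ⟨hint, hint'⟩ := integrable_running hG hs.le U V
  have h2 : ∫ z : unitInterval × unitInterval, (w + a * (s' - s) +
        ∫ r in s..s', G (U.1 r z.1) (V.1 r z.2)) ≤ stepCost T f s s' ψ y U V := by
    refine integral_mono ((integrable_const _).add hint')
      (integrable_stepCost hf hψ hM ⟨hs.le, hT⟩ y U V) fun z => ?_
    exact hpath _ _ (U.measurable_path _) (V.measurable_path _)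
  rw [integral_add (integrable_const _) hint'] at h2
  simp only [integral_const, probReal_univ, smul_eq_mul, one_mul] at h2
  have h3 : (s' - s) * (H - ε / 2) ≤
      ∫ z : unitInterval × unitInterval, ∫ r in s..s', G (U.1 r z.1) (V.1 r z.2) := by
    simp only [intervalIntegral.integral_of_le hs.le]
    rw [integral_integral_swap hint]
    -- For fixed r and z₂ the opponent's action is pure, and averaging over z₁ alone already gives
    -- the bound.
    have h4 : ∀ r, H - ε / 2 ≤
        ∫ z : unitInterval × unitInterval, G (U.1 r z.1) (V.1 r z.2) := fun r => by
      obtain ⟨M', hM'⟩ := exists_bound_of_continuous hG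
      have hVr : Measurable fun z => V.1 r z := V.2.comp (measurable_const.prodMk measurable_id)
      have hi : Integrable (fun z : unitInterval × unitInterval => G (m z.1) (V.1 r z.2))
          (volume.prod volume) :=
        (integrable_const M').mono' (hG.measurable.comp ((hm.comp measurable_fst).prodMk
          (hVr.comp measurable_snd))).aestronglyMeasurable (ae_of_all _ fun z => hM' _ _)
      have h5 : ∀ z₂, H - ε / 2 ≤ ∫ z₁, G (m z₁) (V.1 r z₂) := fun z₂ => by
        refine (hμ (V.1 r z₂)).trans_eq ?_
        rw [← hmμ, integral_map hm.aemeasurable]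
        exact (hG.comp (continuous_id.prodMk continuous_const)).measurable.aestronglyMeasurable
      change _ ≤ ∫ z : unitInterval × unitInterval, G (m z.1) (V.1 r z.2) ∂(volume.prod volume)
      rw [integral_prod_symm _ hi]
      have := integral_mono (integrable_const (H - ε / 2)) hi.integral_prod_right h5
      simpa using this
    have h6 := integral_mono (μ := (volume.restrict (Ioc s s'))) (integrable_const (H - ε / 2))
      hint.integral_prod_right h4
    simp only [integral_const, smul_eq_mul, measureReal_restrict_apply_univ, Real.volume_real_Ioc,
      max_eq_left hpos.le] at h6
    exact h6
  have h4 : (s' - s) * (a + H - ε) ≤ 0 := by nlinarith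
  have := nonpos_of_mul_nonpos_right h4 hpos
  linarith

end StepLimit

/-! ### Limits of the dynamic programming equations are viscosity solutions -/

section Viscosity

lemma Partition.sub_le_mesh {T : ℝ} (π : Partition T) (j : Fin π.n) :
    π.pt j.succ - π.pt j.castSucc ≤ π.mesh :=
  le_ciSup (f := fun j : Fin π.n => π.pt j.succ - π.pt j.castSucc) (finite_range _).bddAbove j

variable [MetricSpace A] [CompactSpace A] [Nonempty A] [MeasurableSpace A] [BorelSpace A]
  [MetricSpace B] [CompactSpace B] [Nonempty B] [MeasurableSpace B] [BorelSpace B]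
  {f : ℝ → E d → A → B → E d} {C K T : ℝ} (hf : IsDrift f C K)
include hf

/-- Compactness of A × B makes the modulus of continuity at (t₀, x₀) uniform in the actions. -/
lemma IsDrift.exists_modulus (t₀ : ℝ) (x₀ : E d) {η : ℝ} (hη : 0 < η) :
    ∃ δ > 0, ∀ r x a b, |r - t₀| ≤ δ → ‖x - x₀‖ ≤ δ → ‖f r x a b - f t₀ x₀ a b‖ ≤ η := by
  have hc : Continuous (Function.uncurry fun (z : ℝ × E d) (c : A × B) => f z.1 z.2 c.1 c.2) :=
    hf.cont.comp (f := fun q : (ℝ × E d) × A × B => (q.1.1, q.1.2, q.2.1, q.2.2)) (by fun_prop)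
  have h := Metric.tendstoUniformly_iff.1 (Continuous.tendstoUniformly
    (fun (z : ℝ × E d) (c : A × B) => f z.1 z.2 c.1 c.2) hc (t₀, x₀)) η hη
  obtain ⟨δ, hδ, H⟩ := Metric.nhds_basis_closedBall.eventually_iff.1 h
  refine ⟨δ, hδ, fun r x a b hr hx => ?_⟩
  have hz : (r, x) ∈ Metric.closedBall (t₀, x₀) δ := by
    rw [Metric.mem_closedBall, Prod.dist_eq, Real.dist_eq, dist_eq_norm]
    exact max_le hr hx
  rw [← dist_eq_norm, dist_comm]
  exact (H hz (a, b)).le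

lemma flow_sub_eq_integral {s s' : ℝ} (hs : s' ∈ Icc s T) (y : E d) {u : ℝ → A} {v : ℝ → B}
    (hu : Measurable u) (hv : Measurable v) :
    flow T f s y u v s' - y = ∫ r in s..s', f r (flow T f s y u v r) (u r) (v r) := by
  rw [(isTrajectory_flow hf hu hv T s y).2 s' hs, add_sub_cancel_left]

variable {φ : ℝ × E d → ℝ} {t₀ : ℝ} {x₀ : E d} {a : ℝ} {p : E d}

/-- Increments of test functions along short trajectories. -/
lemma HasExpansion.exists_abs_flow_sub_le (hφ : HasExpansion T φ t₀ x₀ a p) {η : ℝ} (hη : 0 < η) :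
    ∃ δ > 0, ∀ s ∈ Icc 0 T, ∀ s' ∈ Icc s T, ∀ y : E d, |s - t₀| ≤ δ → s' - s ≤ δ →
      ‖y - x₀‖ ≤ δ → ∀ (u : ℝ → A) (v : ℝ → B), Measurable u → Measurable v →
      |φ (s', flow T f s y u v s') - φ (s, y) - a * (s' - s) -
        ∫ r in s..s', inner ℝ (f t₀ x₀ (u r) (v r)) p| ≤ η * (s' - s) := by
  have hC := hf.C_nonneg
  -- The three terms pay for the increment in time, the increment in space, at most C times the
  -- former, and the freezing of f at (t₀, x₀) in the product with p.
  set η' := η / (1 + C + ‖p‖) with hη'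
  have hη'0 : 0 < η' := by positivity
  obtain ⟨δ₁, hδ₁, H₁⟩ := hφ η' hη'0
  obtain ⟨δ₂, hδ₂, H₂⟩ := hf.exists_modulus t₀ x₀ hη'0
  have hδ₀ : 0 < min δ₁ δ₂ := lt_min hδ₁ hδ₂
  -- Over a duration δ the time stays within 2 δ of t₀ and the state within (1 + C) δ of x₀, so both
  -- stay where the two estimates hold.
  refine ⟨min δ₁ δ₂ / (2 + C), by positivity, fun s hs s' hs' y h1 h2 h3 u v hu hv => ?_⟩
  set δ := min δ₁ δ₂ / (2 + C) with hδ
  have hδpos : 0 < δ := by positivity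
  have hmul : 2 * δ + C * δ = min δ₁ δ₂ := by rw [← add_mul, hδ]; field_simp
  have hCδ : 0 ≤ C * δ := by positivity
  have hm1 := min_le_left δ₁ δ₂
  have hm2 := min_le_right δ₁ δ₂
  set X := flow T f s y u v with hX
  have htime : ∀ r ∈ Icc s s', |r - t₀| ≤ min δ₁ δ₂ := fun r hr => by
    rw [abs_le] at h1 ⊢
    constructor <;> linarith [hr.1, hr.2]
  have hspace : ∀ r ∈ Icc s s', ‖X r - x₀‖ ≤ min δ₁ δ₂ := fun r hr => by
    have e1 : ‖X r - y‖ ≤ C * (r - s) := norm_flow_sub_le hf hu hv ⟨hr.1, hr.2.trans hs'.2⟩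
    have e2 : C * (r - s) ≤ C * δ := mul_le_mul_of_nonneg_left (by linarith [hr.2]) hC
    calc ‖X r - x₀‖ ≤ ‖X r - y‖ + ‖y - x₀‖ := norm_sub_le_norm_sub_add_norm_sub _ _ _
      _ ≤ _ := by linarith
  have hss : s ∈ Icc s s' := ⟨le_rfl, hs'.1⟩
  have hss' : s' ∈ Icc s s' := ⟨hs'.1, le_rfl⟩
  have e1 := H₁ s hs s' ⟨hs.1.trans hs'.1, hs'.2⟩ y (X s') ((htime s hss).trans hm1)
    ((htime s' hss').trans hm1) (h3.trans (by linarith)) ((hspace s' hss').trans hm1)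
  have e2 : ‖X s' - y‖ ≤ C * (s' - s) := norm_flow_sub_le hf hu hv hs'
  have hint : IntervalIntegrable (fun r => f r (X r) (u r) (v r)) volume s s' :=
    (isTrajectory_flow hf hu hv T s y).intervalIntegrable hf hu hv ⟨le_rfl, hs'.1.trans hs'.2⟩ hs'
  have e3 : inner ℝ (X s' - y) p = ∫ r in s..s', inner ℝ (f r (X r) (u r) (v r)) p := by
    rw [hX, flow_sub_eq_integral hf hs' y hu hv, real_inner_comm]
    have := (innerSL ℝ p).intervalIntegral_comp_comm hint
    simp only [innerSL_apply_apply] at this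
    rw [← this]
    simp only [real_inner_comm p, hX]
  have hi1 : IntervalIntegrable (fun r => inner ℝ (f r (X r) (u r) (v r)) p) volume s s' := by
    simp only [intervalIntegrable_iff] at hint ⊢
    exact hint.inner_const p
  have hi2 : IntervalIntegrable (fun r => inner ℝ (f t₀ x₀ (u r) (v r)) p) volume s s' := by
    obtain ⟨M, hM⟩ := exists_bound_of_continuous (hf.continuous_inner t₀ x₀ p)
    refine (intervalIntegrable_const (c := M)).mono_fun' ((hf.continuous_inner t₀ x₀ p).measurable.comp
      (hu.prodMk hv)).aestronglyMeasurable (ae_of_all _ fun r => hM (u r) (v r))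
  have e4 : |inner ℝ (X s' - y) p - ∫ r in s..s', inner ℝ (f t₀ x₀ (u r) (v r)) p| ≤
      η' * ‖p‖ * (s' - s) := by
    rw [e3, ← intervalIntegral.integral_sub hi1 hi2, ← abs_of_nonneg (sub_nonneg.2 hs'.1),
      ← Real.norm_eq_abs]
    refine intervalIntegral.norm_integral_le_of_norm_le_const fun r hr => ?_
    rw [uIoc_of_le hs'.1] at hr
    rw [← inner_sub_left]
    refine (norm_inner_le_norm _ _).trans ?_
    gcongr
    exact H₂ r (X r) (u r) (v r) ((htime r ⟨hr.1.le, hr.2⟩).trans hm2)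
      ((hspace r ⟨hr.1.le, hr.2⟩).trans hm2)
  have e5 : η' * (1 + C + ‖p‖) = η := by rw [hη']; field_simp
  rw [abs_of_nonneg (sub_nonneg.2 hs'.1)] at e1
  calc |φ (s', X s') - φ (s, y) - a * (s' - s) - ∫ r in s..s', inner ℝ (f t₀ x₀ (u r) (v r)) p|
      = |(φ (s', X s') - φ (s, y) - a * (s' - s) - inner ℝ (X s' - y) p) +
        (inner ℝ (X s' - y) p - ∫ r in s..s', inner ℝ (f t₀ x₀ (u r) (v r)) p)| := by
        congr 1; ring
    _ ≤ η' * ((s' - s) + ‖X s' - y‖) + η' * ‖p‖ * (s' - s) :=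
        (abs_add_le _ _).trans (add_le_add e1 e4)
    _ ≤ η' * ((s' - s) + C * (s' - s)) + η' * ‖p‖ * (s' - s) := by gcongr
    _ = η' * (1 + C + ‖p‖) * (s' - s) := by ring
    _ = η * (s' - s) := by rw [e5]

variable {F : ℕ → ℝ × E d → ℝ} {V : ℝ × E d → ℝ} {π : ℕ → Partition T}

/-- Near a local maximum of `V - φ` some approximation of `V` grows along all trajectories, up to
the end of the current slot, at most like `φ`. -/
lemma exists_slot_growth_le (hmesh : Tendsto (fun n => (π n).mesh) atTop (𝓝 0))
    (hF : ∀ n, ContinuousOn (F n) (Icc 0 T ×ˢ univ))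
    (hFV : TendstoLocallyUniformlyOn F V atTop (Icc 0 T ×ˢ univ))
    (hφc : ContinuousOn φ (Icc 0 T ×ˢ univ)) (hφ : HasExpansion T φ t₀ x₀ a p)
    (ht : t₀ ∈ Ico 0 T) (hmax : IsLocalMaxOn (fun z => V z - φ z) (Icc 0 T ×ˢ univ) (t₀, x₀))
    {η : ℝ} (hη : 0 < η) :
    ∃ (n : ℕ) (j : Fin (π n).n) (s : ℝ) (y : E d),
      s ∈ Ico ((π n).pt j.castSucc) ((π n).pt j.succ) ∧
      ∀ (u : ℝ → A) (v : ℝ → B), Measurable u → Measurable v →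
        F n ((π n).pt j.succ, flow T f s y u v ((π n).pt j.succ)) ≤
          F n (s, y) + (a + η) * ((π n).pt j.succ - s) +
            ∫ r in s..(π n).pt j.succ, inner ℝ (f t₀ x₀ (u r) (v r)) p := by
  have hC := hf.C_nonneg
  -- The maximum point is sought for the penalized test function, which has the same slopes as φ.
  have hexp := hφ.add (hasExpansion_penalty (t₀ := t₀) (x₀ := x₀))
  rw [add_zero, add_zero] at hexp
  obtain ⟨δ₀, hδ₀, H⟩ := hexp.exists_abs_flow_sub_le hf hη
  obtain ⟨ρ, hρ, hball⟩ := ((nhdsWithin_hasBasis Metric.nhds_basis_closedBall _).eventually_iff).1 hmax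
  set k : Set (ℝ × E d) := Metric.closedBall (t₀, x₀) ρ ∩ Icc 0 T ×ˢ univ with hk
  have hkS : k ⊆ Icc 0 T ×ˢ univ := inter_subset_right
  have hkc : IsCompact k :=
    (isCompact_closedBall _ _).inter_right (isClosed_Icc.prod isClosed_univ)
  have hρ' : 0 < ρ / (2 + C) := by positivity
  have hT : 0 < (T - t₀) / 2 := by linarith [ht.2]
  -- The three bounds make the expansion available, keep trajectories up to the end of the slot
  -- inside k, and force s < T.
  set δ := min δ₀ (min (ρ / (2 + C)) ((T - t₀) / 2)) with hδ
  have hδpos : 0 < δ := lt_min hδ₀ (lt_min hρ' hT)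
  have hδ1 : δ ≤ δ₀ := min_le_left _ _
  have hδ2 : δ ≤ ρ / (2 + C) := (min_le_right _ _).trans (min_le_left _ _)
  have hδ3 : δ ≤ (T - t₀) / 2 := (min_le_right _ _).trans (min_le_right _ _)
  have hδ4 : 2 * δ + C * δ ≤ ρ := by
    rw [← add_mul, mul_comm]; exact (le_div_iff₀ (by positivity)).1 hδ2
  have hunif := (tendstoLocallyUniformlyOn_iff_tendstoUniformlyOn_of_compact hkc).1 (hFV.mono hkS)
  have h0 : (t₀, x₀) ∈ k := ⟨Metric.mem_closedBall_self hρ.le, ⟨ht.1, ht.2.le⟩, mem_univ _⟩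
  obtain ⟨n, ⟨⟨s, y⟩, hz, hzδ, hzmax⟩, hn⟩ :=
    ((eventually_exists_isMaxOn hkc (fun n => (hF n).mono hkS) (hφc.mono hkS) hunif h0
      (fun z hz => hball hz) hδpos).and (hmesh.eventually (gt_mem_nhds hδpos))).exists
  have hs0 : s ∈ Icc 0 T := (hkS hz).1
  have hst : |s - t₀| ≤ δ := by simpa using (norm_fst_le _).trans hzδ
  have hyx : ‖y - x₀‖ ≤ δ := by simpa using (norm_snd_le _).trans hzδ
  have hsT : s < T := by linarith [(abs_le.1 hst).2]
  -- The maximum point need not lie on the grid, which is why `IsValue.step` is required at all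
  -- times of a slot.
  obtain ⟨j, hj⟩ := (π n).exists_mem_Ico ⟨hs0.1, hsT⟩
  refine ⟨n, j, s, y, hj, fun u v hu hv => ?_⟩
  set s' := (π n).pt j.succ with hs'
  have hs'T : s' ∈ Icc s T := ⟨hj.2.le, ((π n).pt_mem _).2⟩
  have hss : s' - s ≤ δ := by linarith [(π n).sub_le_mesh j, hj.1]
  have e1 := H s hs0 s' hs'T y (hst.trans hδ1) (hss.trans hδ1) (hyx.trans hδ1) u v hu hv
  set X := flow T f s y u v s' with hX
  have hXy : ‖X - y‖ ≤ C * (s' - s) := norm_flow_sub_le hf hu hv hs'T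
  have hXx : ‖X - x₀‖ ≤ ‖X - y‖ + ‖y - x₀‖ := norm_sub_le_norm_sub_add_norm_sub _ _ _
  have hCδ : C * (s' - s) ≤ C * δ := mul_le_mul_of_nonneg_left hss hC
  have hCδ0 : 0 ≤ C * δ := by positivity
  have hmem : (s', X) ∈ k := by
    refine ⟨?_, ⟨hs0.1.trans hs'T.1, hs'T.2⟩, mem_univ _⟩
    rw [Metric.mem_closedBall, Prod.dist_eq, Real.dist_eq, dist_eq_norm]
    refine max_le ?_ (by linarith)
    change |s' - t₀| ≤ ρ
    rw [abs_le] at hst ⊢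
    constructor <;> linarith [hs'T.1]
  have e2 := hzmax _ hmem
  rw [abs_le] at e1
  linarith [e1.2]

variable {g : E d → ℝ} {M L : ℝ} {W : ℕ → ℝ → E d → ℝ}

/-- Locally uniform limits of solutions of the dynamic programming equation along partitions of
vanishing mesh are viscosity solutions. -/
theorem isViscositySolution_of_tendsto (hT : 0 < T) (hL0 : 0 ≤ L)
    (hW : ∀ n, IsValue (π n) f g M L K (W n))
    (hmesh : Tendsto (fun n => (π n).mesh) atTop (𝓝 0))
    (hV : TendstoLocallyUniformlyOn (fun n z => W n z.1 z.2) V atTop (Icc 0 T ×ˢ univ)) :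
    (∀ z ∈ Icc 0 T ×ˢ (univ : Set (E d)), |V z| ≤ M) ∧ IsViscositySolution T f g V := by
  have hWc : ∀ n, ContinuousOn (fun z : ℝ × E d => W n z.1 z.2) (Icc 0 T ×ˢ univ) := fun n =>
    (hW n).continuousOn hf hL0
  have hlim : ∀ z ∈ Icc 0 T ×ˢ (univ : Set (E d)), Tendsto (fun n => W n z.1 z.2) atTop (𝓝 (V z)) :=
    fun z hz => hV.tendsto_at hz
  have hVc : ContinuousOn V (Icc 0 T ×ˢ univ) :=
    hV.continuousOn (Frequently.of_forall hWc)
  have hterm : ∀ x, V (T, x) = g x := fun x => by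
    refine tendsto_nhds_unique (hlim (T, x) ⟨⟨hT.le, le_rfl⟩, mem_univ _⟩) ?_
    simp only [fun n => (hW n).terminal x]
    exact tendsto_const_nhds
  have hψ : ∀ n (j : Fin ((π n).n + 1)), Continuous (W n ((π n).pt j)) ∧
      ∀ x, |W n ((π n).pt j) x| ≤ M := fun n j =>
    ⟨(hW n).continuous_of_mem hf hL0 ((π n).pt_mem j), (hW n).bdd _ ((π n).pt_mem j)⟩
  refine ⟨fun z hz => ?_, ⟨hVc, fun x => (hterm x).le, fun φ hφ t ht x hmax => ?_⟩,
    ⟨hVc, fun x => (hterm x).ge, fun φ hφ t ht x hmin => ?_⟩⟩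
  · exact le_of_tendsto (hlim z hz).abs (Eventually.of_forall fun n => (hW n).bdd _ hz.1 _)
  · refine le_of_forall_pos_le_add fun η hη => ?_
    obtain ⟨n, j, s, y, hs, H⟩ := exists_slot_growth_le hf hmesh hWc hV hφ.continuousOn
      (hasExpansion_of_contDiffOn hT hφ ⟨ht.1, ht.2.le⟩) ht hmax hη
    have := nonneg_of_isMaxmin hf (hf.continuous_inner t x _) (hψ n j.succ).1 (hψ n j.succ).2 hs.2
      ((π n).pt_mem _).2 ((hW n).step j s ⟨hs.1, hs.2.le⟩ y) H
    rw [hjiOperator, hamiltonian_eq hf]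
    linarith
  · refine le_of_forall_pos_le_add fun η hη => ?_
    -- A minimum of V - φ is a maximum of -V + φ; the growth lemma for -W bounds the growth of W
    -- from below.
    have hV' : TendstoLocallyUniformlyOn (fun n z => -W n z.1 z.2) (fun z => -V z) atTop
        (Icc 0 T ×ˢ univ) := hV.neg
    have hmax : IsLocalMaxOn (fun z => -V z - -φ z) (Icc 0 T ×ˢ univ) (t, x) := by
      convert! hmin.neg using 2
      ring
    obtain ⟨n, j, s, y, hs, H⟩ := exists_slot_growth_le hf hmesh (fun n => (hWc n).neg) hV'
      hφ.continuousOn.neg (hasExpansion_of_contDiffOn hT hφ ⟨ht.1, ht.2.le⟩).neg ht hmax hη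
    have := nonpos_of_isMaxmin hf (hf.continuous_inner t x (gradient (fun y => φ (t, y)) x)) (hψ n j.succ).1 (hψ n j.succ).2 hs.2
      ((π n).pt_mem _).2 ((hW n).step j s ⟨hs.1, hs.2.le⟩ y)
      (a := derivWithin (fun s => φ (s, x)) (Icc 0 T) t - η) fun u v hu hv => by
        have := H u v hu hv
        simp only [inner_neg_right, intervalIntegral.integral_neg, Pi.neg_apply] at this
        linarith
    rw [hjiOperator, hamiltonian_eq hf]
    linarith

omit hf in
/-- Reversing the roles of the players. -/
lemma hjiOperator_swap (hf : IsDrift f C K) (φ : ℝ × E d → ℝ) (t : ℝ) (x : E d) :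
    hjiOperator T (fun t x b a => f t x a b) (fun z => -φ z) t x = -hjiOperator T f φ t x := by
  have h1 : gradient (fun y => -φ (t, y)) x = -gradient (fun y => φ (t, y)) x := by
    simp only [gradient]
    rw [← map_neg]
    congr 1
    exact fderiv_fun_neg
  rw [hjiOperator, h1, hamiltonian_swap hf, hjiOperator, derivWithin.fun_neg]
  ring

/-- Passing to -V exchanges maxima with minima, hence the subsolution and supersolution
inequalities. -/
lemma IsViscositySolution.of_swap
    (h : IsViscositySolution T (fun t x b a => f t x a b) (fun x => -g x) (fun z => -V z)) :
    IsViscositySolution T f g V := by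
  have hc : ContinuousOn V (Icc 0 T ×ˢ univ) := 
    h.1.1.neg.congr fun z _ => (neg_neg (V z)).symm
  refine ⟨⟨hc, fun x => neg_le_neg_iff.1 (h.2.2.1 x), fun φ hφ t ht x hmax => ?_⟩,
    ⟨hc, fun x => neg_le_neg_iff.1 (h.1.2.1 x), fun φ hφ t ht x hmin => ?_⟩⟩
  · have := h.2.2.2 (fun z => -φ z) hφ.neg t ht x (by convert! hmax.neg using 2; ring)
    rw [hjiOperator_swap hf] at this
    linarith
  · have := h.1.2.2 (fun z => -φ z) hφ.neg t ht x (by convert! hmin.neg using 2; ring)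
    rw [hjiOperator_swap hf] at this
    linarith

end Viscosity

/-! ### Reduction to drifts defined for all times -/

section Clamp

/-- Both equations have the same set of solutions on [t,T], so even the selected solutions coincide,
including at times outside that interval. -/
lemma state_congr {T t : ℝ} {f f' : ℝ → E d → A → B → E d} (h : ∀ r ∈ Icc t T, f r = f' r) (x : E d)
    (u : ℝ → Om → A) (v : ℝ → Om → B) : state T f t x u v = state T f' t x u v := by
  have e : ∀ u v, IsTrajectory T f t x u v = IsTrajectory T f' t x u v := fun u v => by
    funext X
    refine propext (and_congr_right fun _ => forall₂_congr fun s hs => ?_)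
    rw [intervalIntegral.integral_congr (g := fun r => f' r (X r) (u r) (v r)) fun r hr => ?_]
    rw [uIcc_of_le hs.1] at hr
    simp only [h r ⟨hr.1, hr.2.trans hs.2⟩]
  funext s ω
  unfold state
  rw [e]

variable [MeasurableSpace A] [MeasurableSpace B] {T t : ℝ} {f f' : ℝ → E d → A → B → E d}

lemma payoff_congr (h : ∀ r ∈ Icc t T, f r = f' r) (π : Partition T) (g : E d → ℝ) (i : ℕ)
    (x : E d) (α : Strategy₁ π A B t) (β : Strategy₂ π A B t) :
    payoff π f g i t x α β = payoff π f' g i t x α β := by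
  simp only [payoff, controlPayoff, state_congr h]

lemma lowerValue_congr (h : ∀ r ∈ Icc t T, f r = f' r) (π : Partition T) (g : E d → ℝ) (x : E d) :
    lowerValue π f g t x = lowerValue π f' g t x := by
  simp only [lowerValue, lowerValueRV, payoff_congr h]

lemma upperValue_congr (h : ∀ r ∈ Icc t T, f r = f' r) (π : Partition T) (g : E d → ℝ) (x : E d) :
    upperValue π f g t x = upperValue π f' g t x := by
  simp only [upperValue, upperValueRV, payoff_congr h]

lemma IsViscositySolution.congr {g : E d → ℝ} {V : ℝ × E d → ℝ} (h : ∀ r ∈ Icc 0 T, f r = f' r)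
    (hV : IsViscositySolution T f' g V) : IsViscositySolution T f g V := by
  have e : ∀ φ : ℝ × E d → ℝ, ∀ t ∈ Ico 0 T, ∀ x, hjiOperator T f φ t x = hjiOperator T f' φ t x :=
    fun φ t ht x => by
      simp only [hjiOperator, hamiltonian, mixedDrift, h t ⟨ht.1, ht.2.le⟩]
  refine ⟨⟨hV.1.1, hV.1.2.1, fun φ hφ t ht x hx => ?_⟩, hV.2.1, hV.2.2.1, fun φ hφ t ht x hx => ?_⟩
  · rw [e φ t ht x]; exact hV.1.2.2 φ hφ t ht x hx
  · rw [e φ t ht x]; exact hV.2.2.2 φ hφ t ht x hx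

/-- Drifts on `[0,T]` extend to all times. -/
lemma exists_isDrift_eqOn [TopologicalSpace A] [TopologicalSpace B] (hT : 0 ≤ T)
    (hf_cont : ContinuousOn (fun q : ℝ × E d × A × B => f q.1 q.2.1 q.2.2.1 q.2.2.2)
      (Icc 0 T ×ˢ univ))
    (hf_bdd : ∃ C : ℝ, ∀ t ∈ Icc 0 T, ∀ x a b, ‖f t x a b‖ ≤ C)
    (hf_lip : ∃ K : ℝ, ∀ t ∈ Icc 0 T, ∀ x y a b, ‖f t x a b - f t y a b‖ ≤ K * ‖x - y‖) :
    ∃ f' C K, IsDrift f' C K ∧ ∀ r ∈ Icc 0 T, f r = f' r := by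
  obtain ⟨C, hC⟩ := hf_bdd
  obtain ⟨K, hK⟩ := hf_lip
  refine ⟨fun t => f (projIcc 0 T hT t), max C 0, max K 0, ⟨?_, fun t x a b => ?_,
    fun t x y a b => ?_, le_max_right _ _, le_max_right _ _⟩, fun r hr => ?_⟩
  · refine hf_cont.comp_continuous (f := fun q : ℝ × E d × A × B =>
      (((projIcc 0 T hT q.1 : Icc 0 T) : ℝ), q.2)) ?_ fun q => ⟨(projIcc 0 T hT q.1).2, mem_univ _⟩
    exact (continuous_subtype_val.comp (continuous_projIcc.comp continuous_fst)).prodMk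
      continuous_snd
  · exact (hC _ (projIcc 0 T hT t).2 x a b).trans (le_max_left _ _)
  · exact (hK _ (projIcc 0 T hT t).2 x y a b).trans (by gcongr; exact le_max_left _ _)
  · simp only [projIcc_of_mem hT hr]

end Clamp

end MixedGame

end

/-! ### Conclusion for lower and upper values. -/

theorem proposition4p1
    {A B : Type*} [MetricSpace A] [CompactSpace A] [Nonempty A] [MeasurableSpace A] [BorelSpace A]
    [MetricSpace B] [CompactSpace B] [Nonempty B] [MeasurableSpace B] [BorelSpace B]
    {d : ℕ} {T : ℝ} (hT : 0 < T)
    (f : ℝ → MixedGame.E d → A → B → MixedGame.E d) (g : MixedGame.E d → ℝ)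
    (hf_cont : ContinuousOn (fun q : ℝ × MixedGame.E d × A × B => f q.1 q.2.1 q.2.2.1 q.2.2.2)
      (Set.Icc 0 T ×ˢ Set.univ))
    (hf_bdd : ∃ C : ℝ, ∀ t ∈ Set.Icc 0 T, ∀ x a b, ‖f t x a b‖ ≤ C)
    (hf_lip : ∃ K : ℝ, ∀ t ∈ Set.Icc 0 T, ∀ x y a b, ‖f t x a b - f t y a b‖ ≤ K * ‖x - y‖)
    (hg_bdd : ∃ C : ℝ, ∀ x, |g x| ≤ C)
    (hg_lip : ∃ K : ℝ, ∀ x y, |g x - g y| ≤ K * ‖x - y‖)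
    (π : ℕ → MixedGame.Partition T)
    (hmesh : Filter.Tendsto (fun n => (π n).mesh) Filter.atTop (nhds 0)) :
    (∀ V : ℝ × MixedGame.E d → ℝ,
      TendstoLocallyUniformlyOn (fun n p => MixedGame.lowerValue (π n) f g p.1 p.2) V
        Filter.atTop (Set.Icc 0 T ×ˢ Set.univ) →
      (∃ C : ℝ, ∀ p ∈ Set.Icc 0 T ×ˢ (Set.univ : Set (MixedGame.E d)), |V p| ≤ C) ∧
        MixedGame.IsViscositySolution T f g V) ∧
    (∀ U : ℝ × MixedGame.E d → ℝ,
      TendstoLocallyUniformlyOn (fun n p => MixedGame.upperValue (π n) f g p.1 p.2) U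
        Filter.atTop (Set.Icc 0 T ×ˢ Set.univ) →
      (∃ C : ℝ, ∀ p ∈ Set.Icc 0 T ×ˢ (Set.univ : Set (MixedGame.E d)), |U p| ≤ C) ∧
        MixedGame.IsViscositySolution T f g U) := by
  -- The hypotheses on f concern times in [0,T] only. The value functions on [0,T] and the equation
  -- are unchanged by the extension f'.
  obtain ⟨f', C, K, hf, hff'⟩ := MixedGame.exists_isDrift_eqOn hT.le hf_cont hf_bdd hf_lip
  obtain ⟨M, hM⟩ := hg_bdd
  obtain ⟨L, hL0, hL⟩ : ∃ L : ℝ, 0 ≤ L ∧ ∀ x y, |g x - g y| ≤ L * ‖x - y‖ := by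
    obtain ⟨L, hL⟩ := hg_lip
    exact ⟨max L 0, le_max_right _ _, fun x y =>
      (hL x y).trans (mul_le_mul_of_nonneg_right (le_max_left _ _) (norm_nonneg _))⟩
  refine ⟨fun V hV => ?_, fun U hU => ?_⟩
  · choose W hW using fun n => MixedGame.exists_isValue (π n) hf hM hL0 hL
    obtain ⟨hb, hs⟩ := MixedGame.isViscositySolution_of_tendsto hf hT hL0 hW hmesh
      (hV.congr fun n p hp => by
        simp only
        rw [MixedGame.lowerValue_congr fun r hr => hff' r ⟨hp.1.1.trans hr.1, hr.2⟩,
          MixedGame.lowerValue_eq hf (hW n) hL0 hp.1])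
    exact ⟨⟨M, hb⟩, hs.congr hff'⟩
  -- In the exchanged game with payoff -g the lower values are -U^Π, so the limit theorem applies to
  -- -U.
  · choose W hW using fun n => MixedGame.exists_isValue (g := fun x => -g x) (π n) hf.swap
      (fun x => (abs_neg (g x)).trans_le (hM x)) hL0 fun x y => by
        rw [← neg_sub', abs_neg]; exact hL x y
    obtain ⟨hb, hs⟩ := MixedGame.isViscositySolution_of_tendsto (V := fun z => -U z) hf.swap hT hL0
      hW hmesh (hU.neg.congr fun n p hp => by
        simp only [Pi.neg_apply]
        rw [MixedGame.upperValue_congr fun r hr => hff' r ⟨hp.1.1.trans hr.1, hr.2⟩,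
          MixedGame.upperValue_eq hf (hW n) hL0 hp.1, neg_neg])
    exact ⟨⟨M, fun p hp => (abs_neg (U p)).ge.trans (hb p hp)⟩,
      (MixedGame.IsViscositySolution.of_swap hf hs).congr hff'⟩
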